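/- Let $S$ be a closed (compact, connected, boundaryless) surface that is not simply connected, i.e. not the $2$-sphere. A hyperbolic cone-metric on $S$ is an intrinsic metric $d$ inducing the topology of $S$ such that every point of $S$ has a neighbourhood isometric to a neighbourhood of the apex of a cone of curvature $-1$ with some total angle $\kappa>0$, with $\kappa=2\pi$ (i.e. the neighbourhood is isometric to one in the hyperbolic plane) for all but finitely many points. The exceptional points, those with $\kappa\neq 2\pi$, form the set $V(d)$ of cone-points, which may be empty; $d$ is convex if all its cone-angles are at most $2\pi$. The systole $\mathrm{sys}(d)$ is the infimum of the $d$-lengths of non-contractible loops in $S$, and the cone-sparsity is $\mathrm{cosp}(d)=\sup_{p\in S} d(p,V(d))$, with $d(p,\emptyset)=\infty$. The distortion of a homeomorphism $f:(S,d_1)\to(S,d_2)$ is $\sup_{p\ne q}\left|\ln\frac{d_2(f(p),f(q))}{d_1(p,q)}\right|$, the Lipschitz distance between $d_1$ and $d_2$ is the infimum of the distortions of all homeomorphisms $(S,d_1)\to(S,d_2)$, and the Lipschitz topology is the topology of this (pseudo-)distance. Let $\delta:\mathbb{R}_{>0}\to\mathbb{R}_{>0}$ be any continuous function (for instance one such that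 every hyperbolic pair of pants whose boundary components all have length at least $\Delta$ contains a point at distance greater than $\delta(\Delta)$ from its boundary). Call $d$ balanced if $\mathrm{cosp}(d)<\delta(\mathrm{sys}(d))$. Then the set of balanced metrics is open and dense in the space of all convex hyperbolic cone-metrics on $S$, endowed with the Lipschitz topology. -/

import Mathlib

open scoped ENNReal
open Set

noncomputable section

namespace ConeSurface

/-! ### Notions on a metric space -/

section Metric

variable {X : Type*} [MetricSpace X]

/-- The length of a path: the supremum of the lengths of inscribed polygons. -/
def pathLength {x y : X} (γ : Path x y) : ℝ≥0∞ := eVariationOn γ univ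

variable (X) in
/-- The metric is intrinsic: distances are infima of lengths of paths. -/
def IsIntrinsic : Prop := ∀ x y : X, edist x y = ⨅ γ : Path x y, pathLength γ

/-- The hyperbolic cosine of the distance between the points with polar coordinates `(r, θ)` and
`(r', θ')` in the cone of curvature `-1` with total angle `κ` (`θ`, `θ'` in the circle `ℝ / κℤ`
of length `κ`, on which the norm of `θ - θ'` is the arc-length distance). If the angle `φ` between
the points is at least `π`, the shortest path passes through the apex and has length `r + r'`;
otherwise the distance is given by the hyperbolic law of cosines. -/
def coneCosh (κ : ℝ) (r : ℝ) (θ : AddCircle κ) (r' : ℝ) (θ' : AddCircle κ) : ℝ :=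
  Real.cosh r * Real.cosh r' -
    Real.sinh r * Real.sinh r' * Real.cos (min ‖θ - θ'‖ Real.pi)

/-- Some ball around `p` is isometric, with `p` going to the apex, to the ball of the same radius
around the apex of the cone of curvature `-1` with total angle `κ > 0`. The isometry is given by
polar coordinates `e`. For `κ = 2π` the cone is the hyperbolic plane. -/
def HasConeAngle (p : X) (κ : ℝ) : Prop :=
  0 < κ ∧ ∃ ρ : ℝ, 0 < ρ ∧ ∃ e : ℝ → AddCircle κ → X,
    (∀ θ, e 0 θ = p) ∧
    {x | ∃ r ∈ Ico 0 ρ, ∃ θ, e r θ = x} = Metric.ball p ρ ∧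
    ∀ r ∈ Ico 0 ρ, ∀ r' ∈ Ico 0 ρ, ∀ θ θ',
      Real.cosh (dist (e r θ) (e r' θ')) = coneCosh κ r θ r' θ'

variable (X) in
/-- The set of cone-points (vertices): the points without a neighbourhood isometric to
a neighbourhood of a point of the hyperbolic plane. -/
def conePoints : Set X := {p | ¬ HasConeAngle p (2 * Real.pi)}

variable (X) in
/-- A hyperbolic cone-metric: an intrinsic metric that is locally isometric to the hyperbolic plane
away from finitely many points, each of which has a neighbourhood isometric to a neighbourhood
of the apex of a hyperbolic cone. -/
def IsHyperbolicConeMetric : Prop :=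
  IsIntrinsic X ∧ (conePoints X).Finite ∧ ∀ p : X, ∃ κ, HasConeAngle p κ

variable (X) in
/-- Convexity of a cone-metric: no cone-angle exceeds `2π`. -/
def IsConvexConeMetric : Prop := ∀ (p : X) (κ : ℝ), HasConeAngle p κ → κ ≤ 2 * Real.pi

variable (X) in
/-- The systole: the infimum of the lengths of non-contractible loops. -/
def systole : ℝ≥0∞ :=
  ⨅ (x : X) (γ : Path x x) (_ : ¬ γ.Homotopic (Path.refl x)), pathLength γ

/-- The sparsity of a set: the supremum of the distances of points to the set
(it is `∞` for the empty set). -/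
def sparsity (V : Set X) : ℝ≥0∞ := ⨆ p : X, Metric.infEDist p V

variable (X) in
/-- The cone-sparsity: the sparsity of the set of cone-points. -/
def coneSparsity : ℝ≥0∞ := sparsity (conePoints X)

variable (X) in
/-- The metric is balanced with respect to `δ`. -/
def IsBalanced (δ : ℝ → ℝ) : Prop :=
  coneSparsity X < ENNReal.ofReal (δ (systole X).toReal)

/-- The distortion of a map between metric spaces. -/
def distortion {Y : Type*} [MetricSpace Y] (f : X → Y) : ℝ≥0∞ :=
  ⨆ (p : X) (q : X) (_ : p ≠ q), ENNReal.ofReal |Real.log (dist (f p) (f q) / dist p q)|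

lemma distortion_id : distortion (id : X → X) = 0 := by
  simp only [distortion, ENNReal.iSup_eq_zero]
  intro p q h
  simp [div_self (dist_ne_zero.2 h)]

lemma distortion_symm_le {Y : Type*} [MetricSpace Y] (f : X ≃ Y) :
    distortion f.symm ≤ distortion f := by
  refine iSup_le fun p => iSup_le fun q => iSup_le fun h => ?_
  have h' : f.symm p ≠ f.symm q := fun e => h (f.symm.injective e)
  refine le_trans ?_ (le_iSup_of_le (f.symm p) (le_iSup_of_le (f.symm q) (le_iSup_of_le h' le_rfl)))
  rw [f.apply_symm_apply, f.apply_symm_apply, ← inv_div, Real.log_inv, abs_neg]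

lemma distortion_comp_le {Y Z : Type*} [MetricSpace Y] [MetricSpace Z] (f : X → Y) (g : Y → Z)
    (hf : Function.Injective f) (hg : Function.Injective g) :
    distortion (g ∘ f) ≤ distortion f + distortion g := by
  refine iSup_le fun p => iSup_le fun q => iSup_le fun h => ?_
  have hfh : f p ≠ f q := fun e => h (hf e)
  have hgh : g (f p) ≠ g (f q) := fun e => hfh (hg e)
  have e : dist (g (f p)) (g (f q)) / dist p q =
      (dist (f p) (f q) / dist p q) * (dist (g (f p)) (g (f q)) / dist (f p) (f q)) := by
    have := dist_ne_zero.2 h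
    have := dist_ne_zero.2 hfh
    field_simp
  have e2 : |Real.log (dist (g (f p)) (g (f q)) / dist p q)| ≤
      |Real.log (dist (f p) (f q) / dist p q)| +
        |Real.log (dist (g (f p)) (g (f q)) / dist (f p) (f q))| := by
    rw [e, Real.log_mul (div_ne_zero (dist_ne_zero.2 hfh) (dist_ne_zero.2 h))
      (div_ne_zero (dist_ne_zero.2 hgh) (dist_ne_zero.2 hfh))]
    exact abs_add_le _ _
  refine (ENNReal.ofReal_le_ofReal e2).trans ?_
  rw [ENNReal.ofReal_add (abs_nonneg _) (abs_nonneg _)]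
  refine add_le_add ?_ ?_
  · exact le_iSup_of_le p (le_iSup_of_le q (le_iSup_of_le h le_rfl))
  · exact le_iSup_of_le (f p) (le_iSup_of_le (f q) (le_iSup_of_le hfh le_rfl))

end Metric

/-! ### The space of convex hyperbolic cone-metrics on a surface -/

/-- A convex hyperbolic cone-metric on `S`, inducing the given topology of `S`. -/
structure ConvexConeMetric (S : Type*) [t : TopologicalSpace S] where
  metric : MetricSpace S
  topology_eq : metric.toPseudoMetricSpace.toUniformSpace.toTopologicalSpace = t
  isHyperbolicConeMetric : @IsHyperbolicConeMetric S metric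
  isConvex : @IsConvexConeMetric S metric

namespace ConvexConeMetric

variable {S : Type*} [TopologicalSpace S]

/-- The Lipschitz distance: the infimum of the distortions of the homeomorphisms
`(S, d₁) → (S, d₂)`. -/
def lipschitzDist (d₁ d₂ : ConvexConeMetric S) : ℝ≥0∞ :=
  ⨅ f : S ≃ₜ S, @distortion S d₁.metric S d₂.metric f

/-- The space of convex hyperbolic cone-metrics on `S` with the Lipschitz topology, the topology
of the (pseudo-)distance `lipschitzDist`. -/
instance : PseudoEMetricSpace (ConvexConeMetric S) where
  edist := lipschitzDist
  edist_self d := by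
    refine le_antisymm (iInf_le_of_le (Homeomorph.refl S) ?_) bot_le
    exact (@distortion_id S d.metric).le
  edist_comm d₁ d₂ := by
    have key : ∀ a b : ConvexConeMetric S, lipschitzDist a b ≤ lipschitzDist b a := by
      intro a b
      refine le_iInf fun f => iInf_le_of_le f.symm ?_
      exact @distortion_symm_le S b.metric S a.metric f.toEquiv
    exact le_antisymm (key _ _) (key _ _)
  edist_triangle d₁ d₂ d₃ := by
    refine ENNReal.le_iInf_add_iInf fun f g => iInf_le_of_le (f.trans g) ?_
    exact @distortion_comp_le S d₁.metric S S d₂.metric d₃.metric f g f.injective g.injective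

/-- The set of balanced convex hyperbolic cone-metrics: the cone-sparsity is less than the value
of `δ` at the systole. -/
def balanced (S : Type*) [TopologicalSpace S] (δ : ℝ → ℝ) : Set (ConvexConeMetric S) :=
  {d | @IsBalanced S d.metric δ}

end ConvexConeMetric

end ConeSurface

end

/-! Openness. In a balanced metric the finite set of cone-points is nonempty, and every point lies
within some `s < δ (sys)` of it. A homeomorphism of small distortion is `K`-bi-Lipschitz with `K`
close to 1. The systole, which is positive and finite (`systole_pos`, `systole_lt_top`), then
changes by a factor at most `K`, so it remains to see that cone-points persist nearby
(`exists_conePoint_near`). For an angle less than `2π`, the apex of a cone and three equidistributed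
points around it have a matrix of hyperbolic cosines of distances with nonzero determinant
(`IsConeChart.exists_four_points`). Four points of the hyperboloid, being vectors in a space of
dimension three, have determinant zero. If a nearby metric had no cone-point close to the old one, a
disc around it could be developed into the hyperboloid (`exists_development_square`), isometrically
along geodesics (`IsDevelopment.mink_eq`). The determinant of the nearby distances would then
vanish, against continuity.

Density. Choose a finite, fine net of sites containing all cone-points (`exists_sites`) and lift
each point `x` to the height `a x = c * cosh (d(x, sites))`: the vector `x` of the hyperboloid is
replaced by `(x, a x)`, rescaled to lie on the hyperboloid of one dimension more (`deform`). On the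
Voronoi cell of a site `y` the height is the linear function `c * mink x y`, so the cell is carried
into a linear subspace of dimension three, that is, into another hyperbolic plane. The heights agree
on the walls between cells, so the deformed cells fit together. The new metric is the infimum of the
lengths of chains whose steps stay in single cells (`exists_metric_of_cells`).

The cone-angles of the new metric are as follows. At a site the picture is rotationally symmetric
and the angle is unchanged. At any other point the directions of each cell are transformed by
`diag(k, 1)` with `k > 1`, the first axis pointing to the site. The induced map `squeeze k` of
angles is superadditive (`squeeze_add_lt`), so the total angle is at most `2π`, and it is less than
`2π` at a farthest point of a cell from its site (`exists_squeeze_circle`,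
`exists_cellChart_of_notMem`). Every cell therefore contains a cone-point, the new metric is convex
with small cone-sparsity, and it tends to the old one as `c` tends to 0 (`deform_le`). -/

namespace ConeSurface

/-! ### The hyperboloid model of the hyperbolic plane -/

/-- The Lorentz form on `ℝ × ℂ`, positive on time-like vectors. -/
noncomputable def mink (u v : ℝ × ℂ) : ℝ := u.1 * v.1 - (u.2.re * v.2.re + u.2.im * v.2.im)

lemma mink_comm (u v : ℝ × ℂ) : mink u v = mink v u := by simp only [mink]; ring

lemma mink_add_left (u u' v : ℝ × ℂ) : mink (u + u') v = mink u v + mink u' v := by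
  simp only [mink, Prod.fst_add, Prod.snd_add, Complex.add_re, Complex.add_im]; ring

lemma mink_smul_left (c : ℝ) (u v : ℝ × ℂ) : mink (c • u) v = c * mink u v := by
  simp only [mink, Prod.smul_fst, Prod.smul_snd, Complex.smul_re, Complex.smul_im, smul_eq_mul]
  ring

lemma mink_add_right (u v v' : ℝ × ℂ) : mink u (v + v') = mink u v + mink u v' := by
  rw [mink_comm, mink_add_left, mink_comm v, mink_comm v']

lemma mink_smul_right (c : ℝ) (u v : ℝ × ℂ) : mink u (c • v) = c * mink u v := by
  rw [mink_comm, mink_smul_left, mink_comm]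

lemma mink_sub_left (u u' v : ℝ × ℂ) : mink (u - u') v = mink u v - mink u' v := by
  simp only [mink, Prod.fst_sub, Prod.snd_sub, Complex.sub_re, Complex.sub_im]; ring

lemma mink_sub_right (u v v' : ℝ × ℂ) : mink u (v - v') = mink u v - mink u v' := by
  rw [mink_comm, mink_sub_left, mink_comm v, mink_comm v']

/-- The Lorentz form as a bilinear form. -/
noncomputable def minkForm : LinearMap.BilinForm ℝ (ℝ × ℂ) :=
  LinearMap.mk₂ ℝ mink mink_add_left mink_smul_left mink_add_right mink_smul_right

@[simp] lemma minkForm_apply (u v : ℝ × ℂ) : minkForm u v = mink u v := rfl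

lemma eq_zero_of_forall_mink (u : ℝ × ℂ) (h : ∀ v, mink u v = 0) : u = 0 := by
  have h1 := h (1, 0)
  have h2 := h (0, 1)
  have h3 := h (0, Complex.I)
  simp [mink] at h1 h2 h3
  exact Prod.ext h1 (Complex.ext h2 h3)

/-- The orthogonal complement of a unit time-like vector is negative semidefinite. -/
lemma mink_self_nonpos {y u : ℝ × ℂ} (hy : mink y y = 1) (h : mink y u = 0) : mink u u ≤ 0 := by
  obtain ⟨t, w⟩ := y
  obtain ⟨s, v⟩ := u
  simp only [mink] at *
  have h1 : (t * s) ^ 2 = (w.re * v.re + w.im * v.im) ^ 2 := by rw [sub_eq_zero.1 h]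
  have h2 : (w.re * v.re + w.im * v.im) ^ 2 ≤ (w.re ^ 2 + w.im ^ 2) * (v.re ^ 2 + v.im ^ 2) := by
    nlinarith [sq_nonneg (w.re * v.im - w.im * v.re)]
  by_contra hc
  nlinarith [sq_nonneg s, sq_nonneg v.re, sq_nonneg v.im, sq_nonneg w.re, sq_nonneg w.im,
    mul_nonneg (add_nonneg (sq_nonneg w.re) (sq_nonneg w.im)) (le_of_not_ge hc)]

/-- The orthogonal complement of a time-like vector is in fact negative definite, so it contains no
nonzero null vector. -/
lemma eq_zero_of_mink_self_eq_zero {y u : ℝ × ℂ} (hy : mink y y = 1) (h : mink y u = 0)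
    (hu : mink u u = 0) : u = 0 := by
  obtain ⟨t, w⟩ := y
  obtain ⟨s, v⟩ := u
  simp only [mink] at *
  have h1 : (t * s) ^ 2 = (w.re * v.re + w.im * v.im) ^ 2 := by rw [sub_eq_zero.1 h]
  have h2 : (w.re * v.re + w.im * v.im) ^ 2 ≤ (w.re ^ 2 + w.im ^ 2) * (v.re ^ 2 + v.im ^ 2) := by
    nlinarith [sq_nonneg (w.re * v.im - w.im * v.re)]
  have h3 : s ^ 2 = v.re ^ 2 + v.im ^ 2 := by linarith
  have h4 : t ^ 2 = 1 + (w.re ^ 2 + w.im ^ 2) := by linarith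
  have h5 : s ^ 2 ≤ 0 := by
    rw [mul_pow, h4, ← h3] at *
    nlinarith
  have hs : s = 0 := by nlinarith
  have hr : v.re = 0 := by nlinarith [sq_nonneg v.re, sq_nonneg v.im]
  have hi : v.im = 0 := by nlinarith [sq_nonneg v.re, sq_nonneg v.im]
  exact Prod.ext hs (Complex.ext hr hi)

/-- The triangle inequality of the hyperboloid model. -/
lemma mink_triangle {x y z : ℝ × ℂ} (hx : mink x x = 1) (hy : mink y y = 1) (hz : mink z z = 1)
    {a b : ℝ} (ha : 0 ≤ a) (hb : 0 ≤ b) (hxy : mink x y = Real.cosh a)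
    (hyz : mink y z = Real.cosh b) : mink x z ≤ Real.cosh (a + b) := by
  -- This polynomial is minus the Lorentz square of `p + s • q`, where `p` and `q` are the
  -- components of `x` and `z` orthogonal to `y`. Its discriminant gives the Cauchy–Schwarz
  -- inequality for `p` and `q`.
  have key : ∀ s : ℝ, 0 ≤ Real.sinh b ^ 2 * (s * s) +
      (-2 * (mink x z - Real.cosh a * Real.cosh b)) * s + Real.sinh a ^ 2 := by
    intro s
    have horth : mink y ((x - Real.cosh a • y) + s • (z - Real.cosh b • y)) = 0 := by
      simp only [mink_add_right, mink_sub_right, mink_smul_right, hy, hyz, mink_comm y x, hxy]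
      ring
    have := mink_self_nonpos hy horth
    simp only [mink_add_right, mink_sub_right, mink_smul_right, mink_add_left, mink_sub_left,
      mink_smul_left, hx, hy, hz, hyz, mink_comm y x, hxy, mink_comm z x, mink_comm z y] at this
    nlinarith [Real.cosh_sq a, Real.cosh_sq b]
  have hd := discrim_le_zero key
  rw [discrim] at hd
  rw [Real.cosh_add]
  have h1 : (mink x z - Real.cosh a * Real.cosh b) ^ 2 ≤ (Real.sinh a * Real.sinh b) ^ 2 := by
    nlinarith
  have h2 : 0 ≤ Real.sinh a * Real.sinh b :=
    mul_nonneg (Real.sinh_nonneg_iff.2 ha) (Real.sinh_nonneg_iff.2 hb)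
  linarith [abs_le_of_sq_le_sq' h1 h2]

/-- If `y` is the midpoint of `x` and `z`, then `x + z` is a multiple of `y`. -/
lemma add_eq_smul_of_midpoint {x y z : ℝ × ℂ} {a : ℝ} (hx : mink x x = 1) (hy : mink y y = 1)
    (hz : mink z z = 1) (hxy : mink x y = Real.cosh a) (hyz : mink y z = Real.cosh a)
    (hxz : mink x z = Real.cosh (2 * a)) : x + z = (2 * Real.cosh a) • y := by
  rw [← sub_eq_zero]
  -- The difference of the two sides is orthogonal to `y` and null.
  refine eq_zero_of_mink_self_eq_zero hy ?_ ?_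
  · simp only [mink_add_right, mink_sub_right, mink_smul_right, hy, hyz, mink_comm y x, hxy]
    ring
  · simp only [mink_add_right, mink_sub_right, mink_smul_right, mink_add_left, mink_sub_left,
      mink_smul_left, hx, hy, hz, hyz, mink_comm y x, hxy, mink_comm z x, mink_comm z y, hxz,
      Real.cosh_two_mul]
    nlinarith [Real.cosh_sq a]

/-- A chain of points on the hyperboloid, each the midpoint of its neighbours, is on a geodesic. -/
lemma mink_chain {z : ℕ → ℝ × ℂ} {a : ℝ} {N : ℕ} (h0 : ∀ i ≤ N, mink (z i) (z i) = 1)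
    (h1 : ∀ i < N, mink (z i) (z (i + 1)) = Real.cosh a)
    (h2 : ∀ i, i + 2 ≤ N → mink (z i) (z (i + 2)) = Real.cosh (2 * a)) :
    ∀ n ≤ N, mink (z 0) (z n) = Real.cosh (n * a) := by
  intro n
  induction n using Nat.strong_induction_on with
  | _ n ih =>
    intro hn
    match n with
    | 0 => simp [h0 0 (Nat.zero_le _)]
    | 1 => simpa using h1 0 hn
    | n + 2 =>
      -- Paired with `z 0`, this is the three-term recurrence satisfied by `cosh (n * a)`.
      have e := add_eq_smul_of_midpoint (h0 n (by omega)) (h0 (n + 1) (by omega)) (h0 (n + 2) hn)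
        (h1 n (by omega)) (h1 (n + 1) (by omega)) (h2 n hn)
      have e2 := congrArg (mink (z 0)) e
      rw [mink_add_right, mink_smul_right, ih n (by omega) (by omega),
        ih (n + 1) (by omega) (by omega)] at e2
      have c1 := Real.cosh_add (((n + 1 : ℕ) : ℝ) * a) a
      have c2 := Real.cosh_sub (((n + 1 : ℕ) : ℝ) * a) a
      have d1 : ((n + 1 : ℕ) : ℝ) * a + a = ((n + 2 : ℕ) : ℝ) * a := by push_cast; ring
      have d2 : ((n + 1 : ℕ) : ℝ) * a - a = (n : ℝ) * a := by push_cast; ring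
      rw [d1] at c1
      rw [d2] at c2
      linarith

/-- The point of the hyperboloid with polar coordinates `(r, θ)`. -/
noncomputable def hpt (r θ : ℝ) : ℝ × ℂ :=
  (Real.cosh r, ⟨Real.sinh r * Real.cos θ, Real.sinh r * Real.sin θ⟩)

lemma mink_hpt (r θ r' θ' : ℝ) : mink (hpt r θ) (hpt r' θ') =
    Real.cosh r * Real.cosh r' - Real.sinh r * Real.sinh r' * Real.cos (θ - θ') := by
  simp only [mink, hpt, Real.cos_sub]; ring

lemma mink_hpt_self (r θ : ℝ) : mink (hpt r θ) (hpt r θ) = 1 := by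
  rw [mink_hpt, sub_self, Real.cos_zero]; nlinarith [Real.cosh_sq r]

/-- Points of the upper hyperboloid have polar coordinates. -/
lemma exists_hpt {u : ℝ × ℂ} (h : mink u u = 1) (h0 : 0 < u.1) :
    1 ≤ u.1 ∧ u = hpt (Real.arcosh u.1) u.2.arg := by
  obtain ⟨t, w⟩ := u
  simp only [mink] at h h0
  have hw : ‖w‖ ^ 2 = t ^ 2 - 1 := by
    rw [← Complex.normSq_eq_norm_sq, Complex.normSq_apply]; linarith
  have h1 : 1 ≤ t := by nlinarith [sq_nonneg ‖w‖]
  refine ⟨h1, ?_⟩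
  have hs : Real.sinh (Real.arcosh t) = ‖w‖ := by
    rw [Real.sinh_arcosh h1, ← hw, Real.sqrt_sq (norm_nonneg _)]
  simp only [hpt, hs, Real.cosh_arcosh h1, Complex.norm_mul_cos_arg, Complex.norm_mul_sin_arg]

lemma mink_eq_one_iff {x y : ℝ × ℂ} (hx : mink x x = 1) (hy : mink y y = 1) :
    mink x y = 1 ↔ x = y := by
  refine ⟨fun h => ?_, fun h => h ▸ hx⟩
  rw [← sub_eq_zero]
  refine eq_zero_of_mink_self_eq_zero hx ?_ ?_
  · rw [mink_sub_right, hx, h, sub_self]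
  · rw [mink_sub_right, mink_sub_left, mink_sub_left, hx, hy, h, mink_comm y x, h]; ring

/-- The boost moving the origin of the hyperboloid by `t` in the direction `0`. -/
noncomputable def boost (t : ℝ) (u : ℝ × ℂ) : ℝ × ℂ :=
  (Real.cosh t * u.1 + Real.sinh t * u.2.re, ⟨Real.sinh t * u.1 + Real.cosh t * u.2.re, u.2.im⟩)

lemma mink_boost (t : ℝ) (u v : ℝ × ℂ) : mink (boost t u) (boost t v) = mink u v := by
  simp only [mink, boost]
  linear_combination (u.1 * v.1 - u.2.re * v.2.re) * Real.cosh_sq t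

lemma boost_neg (t : ℝ) (u : ℝ × ℂ) : boost t (boost (-t) u) = u := by
  simp only [boost, Real.cosh_neg, Real.sinh_neg]
  refine Prod.ext ?_ (Complex.ext ?_ rfl)
  · linear_combination u.1 * Real.cosh_sq t
  · linear_combination u.2.re * Real.cosh_sq t

lemma boost_fst_pos (t : ℝ) {u : ℝ × ℂ} (h : mink u u = 1) (h0 : 0 < u.1) : 0 < (boost t u).1 := by
  have h1 : mink (hpt 0 0) (hpt 0 0) = 1 := mink_hpt_self 0 0
  simp only [mink] at h
  have h2 : u.2.re ^ 2 < u.1 ^ 2 := by nlinarith [sq_nonneg u.2.im]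
  have h3 : |u.2.re| < u.1 := abs_lt_of_sq_lt_sq h2 h0.le
  have h4 : |Real.sinh t| < Real.cosh t := by
    refine abs_lt_of_sq_lt_sq ?_ (Real.cosh_pos t).le
    linarith [Real.cosh_sq t]
  have h5 : |Real.sinh t * u.2.re| ≤ Real.cosh t * |u.2.re| := by
    rw [abs_mul]; exact mul_le_mul_of_nonneg_right h4.le (abs_nonneg _)
  have h6 : Real.cosh t * |u.2.re| < Real.cosh t * u.1 :=
    mul_lt_mul_of_pos_left h3 (Real.cosh_pos t)
  simp only [boost]
  linarith [neg_abs_le (Real.sinh t * u.2.re)]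

lemma boost_hpt_zero (t θ : ℝ) : boost t (hpt 0 θ) = hpt t 0 := by
  simp [boost, hpt]

/-! ### The geometry of hyperbolic cones -/

lemma coneCosh_eq (κ r : ℝ) (θ : AddCircle κ) (r' : ℝ) (θ' : AddCircle κ) :
    coneCosh κ r θ r' θ' = Real.cosh (r - r') +
      Real.sinh r * Real.sinh r' * (1 - Real.cos (min ‖θ - θ'‖ Real.pi)) := by
  rw [coneCosh, Real.cosh_sub]; ring

lemma coneCosh_comm (κ r : ℝ) (θ : AddCircle κ) (r' : ℝ) (θ' : AddCircle κ) :
    coneCosh κ r θ r' θ' = coneCosh κ r' θ' r θ := by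
  rw [coneCosh, coneCosh, norm_sub_rev]; ring

lemma cosh_sub_le_coneCosh {κ r r' : ℝ} (hr : 0 ≤ r) (hr' : 0 ≤ r') (θ θ' : AddCircle κ) :
    Real.cosh (r - r') ≤ coneCosh κ r θ r' θ' := by
  rw [coneCosh_eq]
  have := mul_nonneg (mul_nonneg (Real.sinh_nonneg_iff.2 hr) (Real.sinh_nonneg_iff.2 hr'))
    (sub_nonneg.2 (Real.cos_le_one (min ‖θ - θ'‖ Real.pi)))
  linarith

lemma one_le_coneCosh {κ r r' : ℝ} (hr : 0 ≤ r) (hr' : 0 ≤ r') (θ θ' : AddCircle κ) :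
    1 ≤ coneCosh κ r θ r' θ' :=
  (Real.one_le_cosh _).trans (cosh_sub_le_coneCosh hr hr' θ θ')

lemma coneCosh_le_cosh_add {κ r r' : ℝ} (hr : 0 ≤ r) (hr' : 0 ≤ r') (θ θ' : AddCircle κ) :
    coneCosh κ r θ r' θ' ≤ Real.cosh (r + r') := by
  rw [coneCosh, Real.cosh_add]
  have := mul_nonneg (mul_nonneg (Real.sinh_nonneg_iff.2 hr) (Real.sinh_nonneg_iff.2 hr'))
    (neg_le_iff_add_nonneg.1 (Real.neg_one_le_cos (min ‖θ - θ'‖ Real.pi)))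
  linarith

@[simp] lemma coneCosh_zero_left (κ : ℝ) (θ : AddCircle κ) (r' : ℝ) (θ' : AddCircle κ) :
    coneCosh κ 0 θ r' θ' = Real.cosh r' := by simp [coneCosh]

@[simp] lemma coneCosh_zero_right (κ : ℝ) (θ : AddCircle κ) (r' : ℝ) (θ' : AddCircle κ) :
    coneCosh κ r' θ 0 θ' = Real.cosh r' := by simp [coneCosh]

lemma coneCosh_self_angle (κ r r' : ℝ) (θ : AddCircle κ) :
    coneCosh κ r θ r' θ = Real.cosh (r - r') := by
  rw [coneCosh_eq]; simp [Real.pi_pos.le]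

lemma coneCosh_eq_one {κ r r' : ℝ} (hr : 0 ≤ r) (hr' : 0 ≤ r') {θ θ' : AddCircle κ}
    (h : coneCosh κ r θ r' θ' = 1) : r = r' ∧ (r = 0 ∨ θ = θ') := by
  have h1 : r = r' := by
    have h2 := cosh_sub_le_coneCosh hr hr' θ θ'
    rw [h] at h2
    by_contra hne
    exact absurd (Real.one_lt_cosh.2 (sub_ne_zero.2 hne)) (not_lt.2 h2)
  subst h1
  refine ⟨rfl, ?_⟩
  rw [or_iff_not_imp_left]
  intro h0
  rw [coneCosh_eq, sub_self, Real.cosh_zero] at h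
  have hs : Real.sinh r ≠ 0 := by simpa using h0
  have hc : Real.cos (min ‖θ - θ'‖ Real.pi) = 1 := by
    have : Real.sinh r * Real.sinh r * (1 - Real.cos (min ‖θ - θ'‖ Real.pi)) = 0 := by linarith
    have h3 := (mul_eq_zero.1 this).resolve_left (mul_ne_zero hs hs)
    linarith
  have h4 := (Real.cos_eq_one_iff_of_lt_of_lt (by
    have := le_min (norm_nonneg (θ - θ')) Real.pi_pos.le
    linarith [Real.pi_pos]) (by
    have := min_le_right ‖θ - θ'‖ Real.pi
    linarith [Real.pi_pos])).1 hc
  rcases min_choice ‖θ - θ'‖ Real.pi with h5 | h5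
  · rw [h5] at h4; exact sub_eq_zero.1 (norm_eq_zero.1 h4)
  · rw [h5] at h4; exact absurd h4 Real.pi_ne_zero

lemma exists_lift_norm {κ : ℝ} (hκ : 0 < κ) (ξ : AddCircle κ) :
    ∃ a : ℝ, (a : AddCircle κ) = ξ ∧ -(κ / 2) < a ∧ a ≤ κ / 2 ∧ ‖ξ‖ = |a| := by
  have : Fact (0 < κ) := ⟨hκ⟩
  obtain ⟨a, ha, rfl⟩ : ξ ∈ ((↑) : ℝ → AddCircle κ) '' Ioc (-(κ / 2)) (-(κ / 2) + κ) := by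
    rw [AddCircle.coe_image_Ioc_eq]; trivial
  have h2 : a ≤ κ / 2 := by linarith [ha.2]
  refine ⟨a, rfl, ha.1, h2, ?_⟩
  rw [AddCircle.norm_coe_eq_abs_iff κ hκ.ne', abs_of_pos hκ, abs_le]
  exact ⟨ha.1.le, h2⟩

lemma cos_norm_two_pi (a : ℝ) : Real.cos ‖(a : AddCircle (2 * Real.pi))‖ = Real.cos a := by
  rw [AddCircle.norm_eq, Real.cos_abs]
  exact Real.cos_sub_int_mul_two_pi _ _

lemma norm_two_pi_le (ξ : AddCircle (2 * Real.pi)) : ‖ξ‖ ≤ Real.pi := by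
  have := AddCircle.norm_le_half_period (p := 2 * Real.pi) (x := ξ) Real.two_pi_pos.ne'
  rw [abs_of_pos Real.two_pi_pos] at this
  linarith

/-- No angle on a circle of length `2π` exceeds `π`, so the truncation in `coneCosh` is void. -/
lemma coneCosh_two_pi (r a r' a' : ℝ) :
    coneCosh (2 * Real.pi) r a r' a' = mink (hpt r a) (hpt r' a') := by
  rw [coneCosh, mink_hpt, min_eq_left (norm_two_pi_le _), ← AddCircle.coe_sub, cos_norm_two_pi]

lemma coneCosh_coe {κ : ℝ} (hκ : 0 < κ) (r r' : ℝ) {a a' : ℝ} (h : |a - a'| ≤ κ / 2)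
    (hπ : |a - a'| ≤ Real.pi) : coneCosh κ r a r' a' = mink (hpt r a) (hpt r' a') := by
  rw [coneCosh, mink_hpt, ← AddCircle.coe_sub,
    (AddCircle.norm_coe_eq_abs_iff κ hκ.ne').2 (by rwa [abs_of_pos hκ]), min_eq_left hπ,
    Real.cos_abs]

/-- The triangle inequality in hyperbolic cones. -/
lemma coneCosh_triangle {κ r₁ r₂ r₃ : ℝ} (h₁ : 0 ≤ r₁) (h₃ : 0 ≤ r₃)
    (θ₁ θ₂ θ₃ : AddCircle κ) {a b : ℝ} (ha : 0 ≤ a) (hb : 0 ≤ b)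
    (hr₂ : 0 ≤ r₂) (h12 : coneCosh κ r₁ θ₁ r₂ θ₂ = Real.cosh a)
    (h23 : coneCosh κ r₂ θ₂ r₃ θ₃ = Real.cosh b) :
    coneCosh κ r₁ θ₁ r₃ θ₃ ≤ Real.cosh (a + b) := by
  set φ := min ‖θ₁ - θ₂‖ Real.pi with hφ
  set ψ := min ‖θ₂ - θ₃‖ Real.pi with hψ
  have hφ0 : 0 ≤ φ := le_min (norm_nonneg _) Real.pi_pos.le
  have hψ0 : 0 ≤ ψ := le_min (norm_nonneg _) Real.pi_pos.le
  have hφπ : φ ≤ Real.pi := min_le_right _ _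
  have hψπ : ψ ≤ Real.pi := min_le_right _ _
  have hs1 := Real.sinh_nonneg_iff.2 h₁
  have hs2 := Real.sinh_nonneg_iff.2 hr₂
  have hs3 := Real.sinh_nonneg_iff.2 h₃
  have m12 : mink (hpt r₁ (-φ)) (hpt r₂ 0) = Real.cosh a := by
    rw [← h12, coneCosh, mink_hpt, sub_zero, Real.cos_neg]
  -- If the two angles add up to at most `π`, the triangles unfold side by side in the hyperbolic
  -- plane. Otherwise `ψ` is lowered to `π - φ`: this only shortens the second side, and the third
  -- side now runs through the apex with length `r₁ + r₃`, the largest possible value.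
  rcases le_total (φ + ψ) Real.pi with h | h
  · have m23 : mink (hpt r₂ 0) (hpt r₃ ψ) = Real.cosh b := by
      rw [← h23, coneCosh, mink_hpt, zero_sub, Real.cos_neg]
    refine le_trans ?_ (mink_triangle (mink_hpt_self _ _) (mink_hpt_self _ _) (mink_hpt_self _ _)
      ha hb m12 m23)
    rw [coneCosh, mink_hpt, show -φ - ψ = -(φ + ψ) by ring, Real.cos_neg]
    have hle : min ‖θ₁ - θ₃‖ Real.pi ≤ φ + ψ := by
      rcases min_choice ‖θ₁ - θ₂‖ Real.pi with e | e
      · rcases min_choice ‖θ₂ - θ₃‖ Real.pi with e' | e'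
        · refine (min_le_left _ _).trans ?_
          rw [hφ, hψ, e, e']
          exact norm_sub_le_norm_sub_add_norm_sub _ _ _
        · exact (min_le_right _ _).trans (by rw [hψ, e']; linarith)
      · exact (min_le_right _ _).trans (by rw [hφ, e]; linarith)
    have hc := Real.cos_le_cos_of_nonneg_of_le_pi (le_min (norm_nonneg _) Real.pi_pos.le) h hle
    have := mul_le_mul_of_nonneg_left hc (mul_nonneg hs1 hs3)
    linarith
  · have hc := Real.cos_le_cos_of_nonneg_of_le_pi (sub_nonneg.2 hφπ) hψπ (by linarith : Real.pi - φ ≤ ψ)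
    have m23 : mink (hpt r₂ 0) (hpt r₃ (Real.pi - φ)) ≤ Real.cosh b := by
      rw [← h23, coneCosh, mink_hpt, zero_sub, Real.cos_neg, ← hψ]
      have := mul_le_mul_of_nonneg_left hc (mul_nonneg hs2 hs3)
      linarith
    have m23' : 1 ≤ mink (hpt r₂ 0) (hpt r₃ (Real.pi - φ)) := by
      rw [mink_hpt]
      have h1 := Real.one_le_cosh (r₂ - r₃)
      rw [Real.cosh_sub] at h1
      have := mul_le_mul_of_nonneg_left (Real.cos_le_one (0 - (Real.pi - φ))) (mul_nonneg hs2 hs3)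
      linarith
    have hb' : Real.arcosh (mink (hpt r₂ 0) (hpt r₃ (Real.pi - φ))) ≤ b := by
      rw [← Real.arcosh_cosh hb]
      exact (Real.arcosh_le_arcosh (by linarith) (Real.cosh_pos b)).2 m23
    have t := mink_triangle (mink_hpt_self _ _) (mink_hpt_self _ _) (mink_hpt_self _ _)
      ha (Real.arcosh_nonneg m23') m12 (Real.cosh_arcosh m23').symm
    have e : mink (hpt r₁ (-φ)) (hpt r₃ (Real.pi - φ)) = Real.cosh (r₁ + r₃) := by
      rw [mink_hpt, show -φ - (Real.pi - φ) = -Real.pi by ring, Real.cos_neg, Real.cos_pi,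
        Real.cosh_add]
      ring
    rw [e] at t
    refine (coneCosh_le_cosh_add h₁ h₃ _ _).trans (t.trans ?_)
    refine Real.cosh_le_cosh.2 ?_
    rw [abs_of_nonneg (add_nonneg ha (Real.arcosh_nonneg m23')), abs_of_nonneg (add_nonneg ha hb)]
    linarith

/-- A sector of angle less than `π` is a convex cone. This keeps the polar angle along a hyperbolic
segment between the angles of its end-points. -/
lemma arg_mem_of_sector {x y φ : ℝ} (hx : 0 ≤ x) (hy : 0 ≤ y) (h0 : 0 ≤ φ) (hπ : φ < Real.pi)
    {z : ℂ} (hre : z.re = x + y * Real.cos φ) (him : z.im = y * Real.sin φ) :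
    0 ≤ z.arg ∧ z.arg ≤ φ := by
  have hs := Real.sin_nonneg_of_nonneg_of_le_pi h0 hπ.le
  have h1 : 0 ≤ z.arg := Complex.arg_nonneg_iff.2 (by rw [him]; positivity)
  refine ⟨h1, ?_⟩
  by_contra hc
  push Not at hc
  have hz : z ≠ 0 := by rintro rfl; simp at hc; linarith
  have e1 := Complex.norm_mul_cos_arg z
  have e2 := Complex.norm_mul_sin_arg z
  have e3 : ‖z‖ * Real.sin (z.arg - φ) = - (x * Real.sin φ) := by
    rw [Real.sin_sub]
    linear_combination Real.cos φ * e2 - Real.sin φ * e1 + Real.cos φ * him - Real.sin φ * hre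
  have h3 : ‖z‖ * Real.sin (z.arg - φ) ≤ 0 := by
    rw [e3]; exact neg_nonpos.2 (mul_nonneg hx hs)
  have hn : 0 < ‖z‖ := norm_pos_iff.2 hz
  have h4 : Real.sin (z.arg - φ) ≤ 0 := by
    by_contra h; push Not at h; linarith [mul_pos hn h]
  rcases (Complex.arg_le_pi z).lt_or_eq with h5 | h5
  · linarith [Real.sin_pos_of_pos_of_lt_pi (sub_pos.2 hc) (by linarith)]
  · rcases h0.lt_or_eq with h6 | h6
    · linarith [Real.sin_pos_of_pos_of_lt_pi (sub_pos.2 hc) (by linarith)]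
    · subst h6
      have := Complex.arg_eq_pi_iff.1 h5
      simp at hre
      linarith [this.1]

/-- A point between `P` and `Q` on the hyperboloid. -/
lemma mink_segment {P Q : ℝ × ℂ} {L : ℝ} (hP : mink P P = 1) (hQ : mink Q Q = 1)
    (hPQ : mink P Q = Real.cosh L) (hL : 0 < L) (s t : ℝ) :
    mink ((Real.sinh (L - s) / Real.sinh L) • P + (Real.sinh s / Real.sinh L) • Q)
      ((Real.sinh (L - t) / Real.sinh L) • P + (Real.sinh t / Real.sinh L) • Q) =
      Real.cosh (s - t) := by
  have hs : Real.sinh L ≠ 0 := (Real.sinh_pos_iff.2 hL).ne'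
  simp only [mink_add_left, mink_add_right, mink_smul_left, mink_smul_right, hP, hQ, hPQ,
    mink_comm Q P]
  field_simp
  simp only [Real.sinh_sub, Real.cosh_sub]
  have h1 := Real.cosh_sq L
  have h2 := Real.cosh_sq s
  have h3 := Real.cosh_sq t
  generalize Real.cosh L = C at *
  generalize Real.sinh L = S at *
  generalize Real.cosh s = cs at *
  generalize Real.sinh s = ss at *
  generalize Real.cosh t = ct at *
  generalize Real.sinh t = st at *
  linear_combination (-(ss * st)) * h1

/-- Any two points of a hyperbolic cone are joined by a geodesic that is not farther from the apex
than its endpoints. -/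
lemma exists_cone_geodesic {κ ρ r r' : ℝ} (hκ : 0 < κ) (hr : r ∈ Ico 0 ρ) (hr' : r' ∈ Ico 0 ρ)
    (θ θ' : AddCircle κ) : ∃ (L : ℝ) (R : ℝ → ℝ) (Θ : ℝ → AddCircle κ), 0 ≤ L ∧
      R 0 = r ∧ Θ 0 = θ ∧ R L = r' ∧ (Θ L = θ' ∨ r' = 0) ∧ (∀ t ∈ Icc 0 L, R t ∈ Ico 0 ρ) ∧
      ∀ s ∈ Icc 0 L, ∀ t ∈ Icc 0 L, coneCosh κ (R s) (Θ s) (R t) (Θ t) = Real.cosh (s - t) := by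
  -- At an angle of at least `π` the geodesic passes through the apex. At a smaller angle the sector
  -- is laid out on the hyperboloid, and the segment there is read in polar coordinates, with `σ`
  -- recording the direction of rotation.
  rcases le_or_gt Real.pi ‖θ - θ'‖ with hang | hang
  · refine ⟨r + r', fun t => |r - t|, fun t => if t ≤ r then θ else θ', add_nonneg hr.1 hr'.1,
      by simp [hr.1], by simp [hr.1], by simp [abs_of_nonneg hr'.1], ?_, ?_, ?_⟩
    · rcases hr'.1.eq_or_lt with h | h
      · exact Or.inr h.symm
      · left; dsimp only; rw [if_neg (by linarith)]
    · intro t ht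
      refine ⟨abs_nonneg _, abs_lt.2 ⟨?_, ?_⟩⟩ <;> linarith [ht.1, ht.2, hr.2, hr'.2]
    · have hπ : ∀ s t, coneCosh κ s θ t θ' = Real.cosh (s + t) := by
        intro s t
        rw [coneCosh, min_eq_right hang, Real.cos_pi, Real.cosh_add]; ring
      intro s _ t _
      dsimp only
      split_ifs with h1 h2 h2
      · rw [coneCosh_self_angle, abs_of_nonneg (by linarith), abs_of_nonneg (by linarith),
          ← Real.cosh_neg]
        congr 1; ring
      · rw [hπ, abs_of_nonneg (by linarith), abs_of_nonpos (by linarith), ← Real.cosh_neg]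
        congr 1; ring
      · rw [coneCosh_comm, hπ, abs_of_nonneg (by linarith), abs_of_nonpos (by linarith)]
        congr 1; ring
      · rw [coneCosh_self_angle, abs_of_nonpos (by linarith), abs_of_nonpos (by linarith)]
        congr 1; ring
  · obtain ⟨a, ha, ha1, ha2, hn⟩ := exists_lift_norm hκ (θ' - θ)
    rw [norm_sub_rev] at hang
    obtain ⟨σ, φ, hσ, hφ0, hφ⟩ : ∃ σ φ : ℝ, (σ = 1 ∨ σ = -1) ∧ 0 ≤ φ ∧ a = σ * φ := by
      rcases le_total 0 a with h | h
      · exact ⟨1, a, Or.inl rfl, h, by ring⟩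
      · exact ⟨-1, -a, Or.inr rfl, by linarith, by ring⟩
    have hσabs : |σ| = 1 := by rcases hσ with rfl | rfl <;> simp
    have hnφ : ‖θ' - θ‖ = φ := by rw [hn, hφ, abs_mul, hσabs, one_mul, abs_of_nonneg hφ0]
    have hφκ : φ ≤ κ / 2 := by
      rw [← hnφ, hn]; exact abs_le.2 ⟨ha1.le, ha2⟩
    rw [hnφ] at hang
    have hθ' : θ' = θ + ((σ * φ : ℝ) : AddCircle κ) := by rw [← hφ, ha]; abel
    have hP := mink_hpt_self r 0
    have hQ := mink_hpt_self r' φ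
    have hPQ1 : 1 ≤ mink (hpt r 0) (hpt r' φ) := by
      have := one_le_coneCosh hr.1 hr'.1 θ θ'
      rwa [coneCosh, norm_sub_rev, hnφ, min_eq_left hang.le, ← Real.cos_neg, ← zero_sub,
        ← mink_hpt] at this
    rcases hPQ1.eq_or_lt with h1 | h1
    · have h2 := (mink_eq_one_iff hP hQ).1 h1.symm
      have h3 : coneCosh κ r θ r' θ' = 1 := by
        rw [coneCosh, norm_sub_rev, hnφ, min_eq_left hang.le, ← Real.cos_neg, ← zero_sub,
          ← mink_hpt, ← h1]
      obtain ⟨e1, e2⟩ := coneCosh_eq_one hr.1 hr'.1 h3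
      refine ⟨0, fun _ => r, fun _ => θ, le_rfl, rfl, rfl, e1, ?_, fun _ _ => hr, ?_⟩
      · rcases e2 with e2 | e2
        · exact Or.inr (e1 ▸ e2)
        · exact Or.inl e2
      · intro s hs t ht
        rw [coneCosh_self_angle, sub_self, le_antisymm hs.2 hs.1, le_antisymm ht.2 ht.1, sub_self]
    · set L := Real.arcosh (mink (hpt r 0) (hpt r' φ)) with hLdef
      have hL : 0 < L := Real.arcosh_pos h1
      have hPQ : mink (hpt r 0) (hpt r' φ) = Real.cosh L := (Real.cosh_arcosh h1.le).symm
      have hsL : 0 < Real.sinh L := Real.sinh_pos_iff.2 hL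
      set X : ℝ → ℝ × ℂ := fun t =>
        (Real.sinh (L - t) / Real.sinh L) • hpt r 0 + (Real.sinh t / Real.sinh L) • hpt r' φ
        with hX
      have hXX : ∀ s t, mink (X s) (X t) = Real.cosh (s - t) := mink_segment hP hQ hPQ hL
      have hX1 : ∀ t, (X t).1 =
          (Real.sinh (L - t) * Real.cosh r + Real.sinh t * Real.cosh r') / Real.sinh L := by
        intro t
        simp only [hX, hpt, Prod.fst_add, Prod.smul_fst, smul_eq_mul]; ring
      -- Because the coefficients are nonnegative with sum at most 1, the first coordinate `cosh (R
      -- t)` never exceeds that of the farther end-point: the segment stays in the ball.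
      have hco : ∀ t ∈ Icc 0 L, 0 ≤ Real.sinh (L - t) / Real.sinh L ∧
          0 ≤ Real.sinh t / Real.sinh L ∧
          Real.sinh (L - t) / Real.sinh L + Real.sinh t / Real.sinh L ≤ 1 := by
        intro t ht
        have h2 := Real.sinh_nonneg_iff.2 (sub_nonneg.2 ht.2)
        have h3 := Real.sinh_nonneg_iff.2 ht.1
        refine ⟨by positivity, by positivity, ?_⟩
        rw [← add_div, div_le_one hsL]
        have := Real.sinh_add (L - t) t
        rw [sub_add_cancel] at this
        nlinarith [Real.one_le_cosh t, Real.one_le_cosh (L - t)]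
      have hpos : ∀ t ∈ Icc 0 L, 0 < (X t).1 := by
        intro t ht
        rw [hX1]
        refine div_pos ?_ hsL
        rcases ht.2.lt_or_eq with h2 | h2
        · exact add_pos_of_pos_of_nonneg (mul_pos (Real.sinh_pos_iff.2 (sub_pos.2 h2))
            (Real.cosh_pos _)) (mul_nonneg (Real.sinh_nonneg_iff.2 ht.1) (Real.cosh_pos _).le)
        · rw [h2, sub_self, Real.sinh_zero, zero_mul, zero_add]
          exact mul_pos hsL (Real.cosh_pos _)
      have hpol : ∀ t ∈ Icc 0 L, 1 ≤ (X t).1 ∧ X t = hpt (Real.arcosh (X t).1) (X t).2.arg := by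
        intro t ht
        exact exists_hpt (by rw [hXX, sub_self, Real.cosh_zero]) (hpos t ht)
      have harg : ∀ t ∈ Icc 0 L, 0 ≤ (X t).2.arg ∧ (X t).2.arg ≤ φ := by
        intro t ht
        obtain ⟨c1, c2, -⟩ := hco t ht
        refine arg_mem_of_sector (mul_nonneg c1 (Real.sinh_nonneg_iff.2 hr.1))
          (mul_nonneg c2 (Real.sinh_nonneg_iff.2 hr'.1)) hφ0 hang ?_ ?_
        · simp only [hX, hpt, Prod.snd_add, Prod.smul_snd, Complex.add_re, Complex.smul_re,
            smul_eq_mul, Real.cos_zero]; ring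
        · simp only [hX, hpt, Prod.snd_add, Prod.smul_snd, Complex.add_im, Complex.smul_im,
            smul_eq_mul, Real.sin_zero]; ring
      have hX0 : X 0 = hpt r 0 := by
        simp [hX, div_self hsL.ne']
      have hXL : X L = hpt r' φ := by
        simp [hX, div_self hsL.ne']
      refine ⟨L, fun t => Real.arcosh (X t).1,
        fun t => θ + ((σ * (X t).2.arg : ℝ) : AddCircle κ), hL.le, ?_, ?_, ?_, ?_, ?_, ?_⟩
      · simp only [hX0, hpt, Real.arcosh_cosh hr.1]
      · have : (X 0).2 = ((Real.sinh r : ℝ) : ℂ) := by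
          rw [hX0]; exact Complex.ext (by simp only [hpt, Real.cos_zero, mul_one, Complex.ofReal_re])
            (by simp only [hpt, Real.sin_zero, mul_zero, Complex.ofReal_im])
        simp only [this, Complex.arg_ofReal_of_nonneg (Real.sinh_nonneg_iff.2 hr.1), mul_zero,
          AddCircle.coe_zero, add_zero]
      · simp only [hXL, hpt, Real.arcosh_cosh hr'.1]
      · rcases hr'.1.eq_or_lt with h | h
        · exact Or.inr h.symm
        · left
          have : (X L).2 = ((Real.sinh r' : ℝ) : ℂ) *
              (Complex.cos (φ : ℝ) + Complex.sin (φ : ℝ) * Complex.I) := by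
            rw [hXL, ← Complex.ofReal_cos, ← Complex.ofReal_sin]
            refine Complex.ext ?_ ?_ <;>
              simp only [hpt, Complex.mul_re, Complex.mul_im, Complex.add_re, Complex.add_im,
                Complex.ofReal_re, Complex.ofReal_im, Complex.I_re, Complex.I_im] <;> ring
          simp only [this]
          rw [Complex.arg_mul_cos_add_sin_mul_I (Real.sinh_pos_iff.2 h)
            ⟨by linarith [Real.pi_pos], hang.le⟩, hθ']
      · intro t ht
        refine ⟨Real.arcosh_nonneg (hpol t ht).1, ?_⟩
        obtain ⟨c1, c2, c3⟩ := hco t ht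
        have hM : (X t).1 ≤ Real.cosh (max r r') := by
          have e : (X t).1 = Real.sinh (L - t) / Real.sinh L * Real.cosh r +
              Real.sinh t / Real.sinh L * Real.cosh r' := by rw [hX1]; ring
          have g1 : Real.cosh r ≤ Real.cosh (max r r') := Real.cosh_le_cosh.2 (by
            rw [abs_of_nonneg hr.1, abs_of_nonneg (hr.1.trans (le_max_left _ _))]
            exact le_max_left _ _)
          have g2 : Real.cosh r' ≤ Real.cosh (max r r') := Real.cosh_le_cosh.2 (by
            rw [abs_of_nonneg hr'.1, abs_of_nonneg (hr.1.trans (le_max_left _ _))]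
            exact le_max_right _ _)
          have g3 := mul_le_mul_of_nonneg_left g1 c1
          have g4 := mul_le_mul_of_nonneg_left g2 c2
          have g5 := mul_le_mul_of_nonneg_right c3 (Real.cosh_pos (max r r')).le
          rw [e]
          linarith
        have := (Real.arcosh_le_arcosh (hpos t ht) (Real.cosh_pos _)).2 hM
        rw [Real.arcosh_cosh (hr.1.trans (le_max_left _ _))] at this
        exact this.trans_lt (max_lt hr.2 hr'.2)
      · intro s hs t ht
        have e : ‖(θ + ((σ * (X s).2.arg : ℝ) : AddCircle κ)) -
            (θ + ((σ * (X t).2.arg : ℝ) : AddCircle κ))‖ = |(X s).2.arg - (X t).2.arg| := by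
          rw [add_sub_add_left_eq_sub, ← AddCircle.coe_sub, ← mul_sub,
            (AddCircle.norm_coe_eq_abs_iff _ hκ.ne').2, abs_mul, hσabs, one_mul]
          rw [abs_mul, hσabs, one_mul, abs_of_pos hκ]
          refine (abs_le.2 ⟨?_, ?_⟩).trans hφκ <;>
            linarith [(harg s hs).1, (harg s hs).2, (harg t ht).1, (harg t ht).2]
        have e2 : |(X s).2.arg - (X t).2.arg| ≤ Real.pi := by
          refine (abs_le.2 ⟨?_, ?_⟩).trans hang.le <;>
            linarith [(harg s hs).1, (harg s hs).2, (harg t ht).1, (harg t ht).2]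
        rw [coneCosh, e, min_eq_left e2, Real.cos_abs, ← mink_hpt, ← (hpol s hs).2,
          ← (hpol t ht).2, hXX]

/-! ### Polar coordinates around a point of a cone-surface -/

section Charts

variable {X : Type*} [MetricSpace X]

/-- `e` gives polar coordinates on the ball of radius `ρ` around `p`, which is a cone. -/
def IsConeChart (p : X) (κ ρ : ℝ) (e : ℝ → AddCircle κ → X) : Prop :=
  0 < κ ∧ 0 < ρ ∧ (∀ θ, e 0 θ = p) ∧
    {x | ∃ r ∈ Ico 0 ρ, ∃ θ, e r θ = x} = Metric.ball p ρ ∧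
    ∀ r ∈ Ico 0 ρ, ∀ r' ∈ Ico 0 ρ, ∀ θ θ',
      Real.cosh (dist (e r θ) (e r' θ')) = coneCosh κ r θ r' θ'

lemma hasConeAngle_iff {p : X} {κ : ℝ} : HasConeAngle p κ ↔ ∃ ρ e, IsConeChart p κ ρ e := by
  constructor
  · rintro ⟨h0, ρ, hρ, e, h⟩; exact ⟨ρ, e, h0, hρ, h⟩
  · rintro ⟨ρ, e, h0, hρ, h⟩; exact ⟨h0, ρ, hρ, e, h⟩

lemma cosh_inj_of_nonneg {a b : ℝ} (ha : 0 ≤ a) (hb : 0 ≤ b) (h : Real.cosh a = Real.cosh b) :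
    a = b := by
  rw [← Real.arcosh_cosh ha, h, Real.arcosh_cosh hb]

lemma cosh_le_iff_of_nonneg {a b : ℝ} (ha : 0 ≤ a) (hb : 0 ≤ b) :
    Real.cosh a ≤ Real.cosh b ↔ a ≤ b := by
  rw [Real.cosh_le_cosh, abs_of_nonneg ha, abs_of_nonneg hb]

namespace IsConeChart

variable {p : X} {κ ρ : ℝ} {e : ℝ → AddCircle κ → X}

lemma cosh_dist (h : IsConeChart p κ ρ e) {r r' : ℝ} (hr : r ∈ Ico 0 ρ) (hr' : r' ∈ Ico 0 ρ)
    (θ θ' : AddCircle κ) : Real.cosh (dist (e r θ) (e r' θ')) = coneCosh κ r θ r' θ' :=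
  h.2.2.2.2 r hr r' hr' θ θ'

lemma zero_mem (h : IsConeChart p κ ρ e) : (0 : ℝ) ∈ Ico 0 ρ := ⟨le_rfl, h.2.1⟩

lemma dist_apex (h : IsConeChart p κ ρ e) {r : ℝ} (hr : r ∈ Ico 0 ρ) (θ : AddCircle κ) :
    dist (e r θ) p = r := by
  refine cosh_inj_of_nonneg dist_nonneg hr.1 ?_
  rw [← h.2.2.1 θ, h.cosh_dist hr h.zero_mem, coneCosh_zero_right]

lemma mem_ball (h : IsConeChart p κ ρ e) {r : ℝ} (hr : r ∈ Ico 0 ρ) (θ : AddCircle κ) :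
    e r θ ∈ Metric.ball p ρ := by
  rw [Metric.mem_ball, h.dist_apex hr]; exact hr.2

lemma exists_polar (h : IsConeChart p κ ρ e) {x : X} (hx : x ∈ Metric.ball p ρ) :
    ∃ θ, e (dist x p) θ = x := by
  rw [← h.2.2.2.1] at hx
  obtain ⟨r, hr, θ, rfl⟩ := hx
  exact ⟨θ, by rw [h.dist_apex hr]⟩

lemma mono (h : IsConeChart p κ ρ e) {ρ' : ℝ} (h0 : 0 < ρ') (hle : ρ' ≤ ρ) :
    IsConeChart p κ ρ' e := by
  refine ⟨h.1, h0, h.2.2.1, ?_, fun r hr r' hr' => h.2.2.2.2 r ⟨hr.1, hr.2.trans_le hle⟩ r'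
    ⟨hr'.1, hr'.2.trans_le hle⟩⟩
  ext x
  constructor
  · rintro ⟨r, hr, θ, rfl⟩
    rw [Metric.mem_ball, h.dist_apex ⟨hr.1, hr.2.trans_le hle⟩]; exact hr.2
  · intro hx
    obtain ⟨θ, hθ⟩ := h.exists_polar (Metric.ball_subset_ball hle hx)
    exact ⟨_, ⟨dist_nonneg, hx⟩, θ, hθ⟩

/-- Lifted angles at most `κ / 2` apart realize the distance on the circle, and `κ ≤ 2π` makes the
truncation at `π` harmless. For `κ = 2π` any lifts will do. -/
lemma cosh_dist_lift (h : IsConeChart p κ ρ e) (hκ : κ ≤ 2 * Real.pi) {r r' : ℝ}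
    (hr : r ∈ Ico 0 ρ) (hr' : r' ∈ Ico 0 ρ) (α : AddCircle κ) {a a' : ℝ}
    (ha : κ = 2 * Real.pi ∨ |a - a'| ≤ κ / 2) :
    Real.cosh (dist (e r (α + a)) (e r' (α + a'))) = mink (hpt r a) (hpt r' a') := by
  rw [h.cosh_dist hr hr']
  have e1 : coneCosh κ r (α + a) r' (α + a') = coneCosh κ r a r' a' := by
    rw [coneCosh, coneCosh, add_sub_add_left_eq_sub]
  rw [e1]
  rcases ha with rfl | ha
  · exact coneCosh_two_pi _ _ _ _
  · exact coneCosh_coe h.1 _ _ ha (ha.trans (by linarith))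

end IsConeChart

/-- The origin boosted by `t > 0` lies in the direction 0, where `Complex.arg` is continuous. Hence
a small disc around a point other than the apex is seen from the apex under a small angle and does
not wrap around the cone. -/
lemma exists_boost_arg_lt {t ε : ℝ} (ht : 0 < t) (hε : 0 < ε) :
    ∃ r₀ > 0, ∀ r ∈ Ico 0 r₀, ∀ θ : ℝ, |(boost t (hpt r θ)).2.arg| < ε := by
  have hs : 0 < Real.sinh t := Real.sinh_pos_iff.2 ht
  have hc : ContinuousAt Complex.arg ((Real.sinh t : ℝ) : ℂ) :=
    Complex.continuousAt_arg (Complex.ofReal_mem_slitPlane.2 hs)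
  obtain ⟨δ, hδ, H⟩ := Metric.continuousAt_iff.1 hc ε hε
  have hf : ContinuousAt (fun r : ℝ => Real.sinh t * (Real.cosh r - 1) +
      Real.cosh t * Real.sinh r + Real.sinh r) 0 := by fun_prop
  obtain ⟨r₀, hr₀, H2⟩ := Metric.continuousAt_iff.1 hf δ hδ
  refine ⟨r₀, hr₀, fun r hr θ => ?_⟩
  have h1 := H2 (show dist r 0 < r₀ by rw [Real.dist_eq, sub_zero, abs_of_nonneg hr.1]; exact hr.2)
  simp only [Real.sinh_zero, Real.cosh_zero, sub_self, mul_zero, add_zero, dist_zero_right] at h1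
  have h2 := H (x := (boost t (hpt r θ)).2) ?_
  · rwa [Complex.arg_ofReal_of_nonneg hs.le, Real.dist_eq, sub_zero] at h2
  · rw [dist_eq_norm]
    refine (Complex.norm_le_abs_re_add_abs_im _).trans_lt
      (lt_of_le_of_lt ?_ ((le_abs_self _).trans_lt h1))
    have e1 : ((boost t (hpt r θ)).2 - ((Real.sinh t : ℝ) : ℂ)).re =
        Real.sinh t * (Real.cosh r - 1) + Real.cosh t * (Real.sinh r * Real.cos θ) := by
      simp only [boost, hpt, Complex.sub_re, Complex.ofReal_re]; ring
    have e2 : ((boost t (hpt r θ)).2 - ((Real.sinh t : ℝ) : ℂ)).im = Real.sinh r * Real.sin θ := by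
      simp only [boost, hpt, Complex.sub_im, Complex.ofReal_im]; ring
    have hr0 := Real.sinh_nonneg_iff.2 hr.1
    rw [e1, e2]
    have g1 : |Real.sinh r * Real.cos θ| ≤ Real.sinh r := by
      rw [abs_mul, abs_of_nonneg hr0]
      exact mul_le_of_le_one_right hr0 (Real.abs_cos_le_one θ)
    have g2 : |Real.sinh r * Real.sin θ| ≤ Real.sinh r := by
      rw [abs_mul, abs_of_nonneg hr0]
      exact mul_le_of_le_one_right hr0 (Real.abs_sin_le_one θ)
    have g3 : 0 ≤ Real.sinh t * (Real.cosh r - 1) :=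
      mul_nonneg hs.le (sub_nonneg.2 (Real.one_le_cosh r))
    have g4 := abs_add_le (Real.sinh t * (Real.cosh r - 1)) (Real.cosh t * (Real.sinh r * Real.cos θ))
    rw [abs_of_nonneg g3, abs_mul (Real.cosh t), abs_of_pos (Real.cosh_pos t)] at g4
    have g5 := mul_le_mul_of_nonneg_left g1 (Real.cosh_pos t).le
    linarith

lemma mink_hpt_lift (r r' a : ℝ) (θ : AddCircle (2 * Real.pi)) (s : ℝ)
    (hs : (s : AddCircle (2 * Real.pi)) = θ) :
    mink (hpt r s) (hpt r' a) = Real.cosh r' * Real.cosh r -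
      Real.sinh r' * Real.sinh r * Real.cos ‖θ - (a : AddCircle (2 * Real.pi))‖ := by
  rw [mink_hpt, ← hs, ← AddCircle.coe_sub, cos_norm_two_pi]; ring

/-- Points of a cone other than the apex are hyperbolic: polar coordinates around such a point,
in which the distances to points that are not opposite are given by the law of cosines. -/
lemma IsConeChart.recenter {p : X} {κ ρ : ℝ} {e : ℝ → AddCircle κ → X} (h : IsConeChart p κ ρ e)
    (hκ : κ ≤ 2 * Real.pi) {t : ℝ} (ht : t ∈ Ico 0 ρ) (α : AddCircle κ)
    (h0 : t = 0 → κ = 2 * Real.pi) :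
    ∃ r₀, ∃ e', IsConeChart (e t α) (2 * Real.pi) r₀ e' ∧ ∀ t' ∈ Ico 0 ρ, ∀ α',
      (κ = 2 * Real.pi ∨ ‖α' - α‖ < κ / 2) → ∃ θy : AddCircle (2 * Real.pi), ∃ r₁ > 0,
        ∀ r ∈ Ico 0 r₁, ∀ θ, Real.cosh (dist (e' r θ) (e t' α')) =
          Real.cosh (dist (e t α) (e t' α')) * Real.cosh r -
            Real.sinh (dist (e t α) (e t' α')) * Real.sinh r * Real.cos ‖θ - θy‖ := by
  have hκ0 := h.1
  choose rep hrep using fun θ : AddCircle (2 * Real.pi) => QuotientAddGroup.mk_surjective θ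
  -- `Z r θ` has polar coordinates `(r, θ)` around the point at distance `t` from the origin in
  -- direction 0. The new chart reads it in polar coordinates around the origin and then applies
  -- `e`.
  set Z : ℝ → AddCircle (2 * Real.pi) → ℝ × ℂ := fun r θ => boost t (hpt r (rep θ)) with hZ
  have hZ1 : ∀ r θ, mink (Z r θ) (Z r θ) = 1 := fun r θ => by
    rw [hZ, mink_boost, mink_hpt_self]
  have hZpos : ∀ r θ, 0 < (Z r θ).1 := fun r θ =>
    boost_fst_pos t (mink_hpt_self _ _) (Real.cosh_pos r)
  have hZt : ∀ r θ, mink (Z r θ) (hpt t 0) = Real.cosh r := fun r θ => by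
    rw [← boost_hpt_zero t 0, hZ, mink_boost, mink_hpt]; simp
  have hpol : ∀ r θ, 1 ≤ (Z r θ).1 ∧ Z r θ = hpt (Real.arcosh (Z r θ).1) (Z r θ).2.arg :=
    fun r θ => exists_hpt (hZ1 r θ) (hZpos r θ)
  have hrad : ∀ r ∈ Ico 0 (ρ - t), ∀ θ, Real.arcosh (Z r θ).1 ∈ Ico 0 ρ := by
    intro r hr θ
    refine ⟨Real.arcosh_nonneg (hpol r θ).1, ?_⟩
    have h1 : (Z r θ).1 = mink (Z r θ) (hpt 0 0) := by simp [mink, hpt]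
    have h2 := mink_triangle (hZ1 r θ) (mink_hpt_self t 0) (mink_hpt_self 0 0) hr.1 ht.1 (hZt r θ)
      (by rw [mink_hpt]; simp)
    rw [← h1] at h2
    have h3 := (Real.arcosh_le_arcosh (hZpos r θ) (Real.cosh_pos _)).2 h2
    rw [Real.arcosh_cosh (add_nonneg hr.1 ht.1)] at h3
    linarith [hr.2]
  have hsmall : ∀ ε > 0, κ = 2 * Real.pi ∨ ∃ r₁ > 0, ∀ r ∈ Ico 0 r₁, ∀ θ, |(Z r θ).2.arg| < ε := by
    intro ε hε
    rcases ht.1.eq_or_lt with h1 | h1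
    · exact Or.inl (h0 h1.symm)
    · obtain ⟨r₁, hr₁, H⟩ := exists_boost_arg_lt h1 hε
      exact Or.inr ⟨r₁, hr₁, fun r hr θ => H r hr _⟩
  have hpos : 0 < ρ - t := sub_pos.2 ht.2
  -- With angles below `κ / 4`, any two points of the new ball differ in angle by at most `κ / 2`,
  -- as `cosh_dist_lift` requires.
  obtain ⟨r₀, hr₀, hr₀ρ, hang⟩ : ∃ r₀ > 0, r₀ ≤ ρ - t ∧ (κ = 2 * Real.pi ∨
      ∀ r ∈ Ico 0 r₀, ∀ θ, |(Z r θ).2.arg| < κ / 4) := by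
    rcases hsmall (κ / 4) (by positivity) with h1 | ⟨r₁, hr₁, H⟩
    · exact ⟨_, hpos, le_rfl, Or.inl h1⟩
    · exact ⟨min r₁ (ρ - t), lt_min hr₁ hpos, min_le_right _ _, Or.inr fun r hr θ =>
        H r ⟨hr.1, hr.2.trans_le (min_le_left _ _)⟩ θ⟩
  have hrad' : ∀ r ∈ Ico 0 r₀, ∀ θ, Real.arcosh (Z r θ).1 ∈ Ico 0 ρ := fun r hr θ =>
    hrad r ⟨hr.1, hr.2.trans_le hr₀ρ⟩ θ
  refine ⟨r₀, fun r θ => e (Real.arcosh (Z r θ).1) (α + ((Z r θ).2.arg : ℝ)),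
    ⟨Real.two_pi_pos, hr₀, ?_, ?_, ?_⟩, ?_⟩
  · intro θ
    have h1 : Z 0 θ = hpt t 0 := boost_hpt_zero t _
    have h2 : (hpt t 0).2 = ((Real.sinh t : ℝ) : ℂ) :=
      Complex.ext (by simp only [hpt, Real.cos_zero, mul_one, Complex.ofReal_re])
        (by simp only [hpt, Real.sin_zero, mul_zero, Complex.ofReal_im])
    dsimp only
    rw [h1, h2, Complex.arg_ofReal_of_nonneg (Real.sinh_nonneg_iff.2 ht.1), hpt,
      Real.arcosh_cosh ht.1, AddCircle.coe_zero, add_zero]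
  · have hdist : ∀ r ∈ Ico 0 r₀, ∀ θ,
        dist (e (Real.arcosh (Z r θ).1) (α + ((Z r θ).2.arg : ℝ))) (e t α) = r := by
      intro r hr θ
      refine cosh_inj_of_nonneg dist_nonneg hr.1 ?_
      have h1 := h.cosh_dist_lift hκ (hrad' r hr θ) ht α (a := (Z r θ).2.arg) (a' := 0) (by
        rcases hang with h1 | h1
        · exact Or.inl h1
        · right; rw [sub_zero]; linarith [h1 r hr θ])
      rw [AddCircle.coe_zero, add_zero] at h1
      rw [h1, ← (hpol r θ).2, hZt]
    ext x
    constructor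
    · rintro ⟨r, hr, θ, rfl⟩
      rw [Metric.mem_ball, hdist r hr θ]; exact hr.2
    · intro hx
      have hxρ : x ∈ Metric.ball p ρ := by
        have := dist_triangle x (e t α) p
        rw [h.dist_apex ht] at this
        rw [Metric.mem_ball] at hx ⊢
        linarith
      obtain ⟨θx, hθx⟩ := h.exists_polar hxρ
      obtain ⟨a, ha, ha1, ha2, hn⟩ := exists_lift_norm hκ0 (θx - α)
      have hθa : θx = α + (a : AddCircle κ) := by rw [ha]; abel
      set t' := dist x p with ht'
      have ht'm : t' ∈ Ico 0 ρ := ⟨dist_nonneg, hxρ⟩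
      have hd : Real.cosh (dist x (e t α)) = mink (hpt t' a) (hpt t 0) := by
        have h1 := h.cosh_dist_lift hκ ht'm ht α (a := a) (a' := 0) (by
          right; rw [sub_zero]; exact abs_le.2 ⟨ha1.le, ha2⟩)
        rwa [AddCircle.coe_zero, add_zero, ← hθa, hθx] at h1
      set U := boost (-t) (hpt t' a) with hU
      have hU1 : mink U U = 1 := by rw [hU, mink_boost, mink_hpt_self]
      have hUf : U.1 = Real.cosh (dist x (e t α)) := by
        rw [hd, ← boost_neg t (hpt t' a), ← boost_hpt_zero t 0, mink_boost, ← hU]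
        simp [mink, hpt]
      obtain ⟨-, hUp⟩ := exists_hpt hU1 (by rw [hUf]; exact Real.cosh_pos _)
      rw [hUf, Real.arcosh_cosh dist_nonneg] at hUp
      refine ⟨dist x (e t α), ⟨dist_nonneg, hx⟩, (U.2.arg : ℝ), ?_⟩
      have hZx : Z (dist x (e t α)) (U.2.arg : ℝ) = hpt t' a := by
        rw [← boost_neg t (hpt t' a), ← hU, hZ]
        dsimp only
        congr 1
        obtain ⟨n, hn⟩ := AddCircle.coe_eq_zero_iff (2 * Real.pi) |>.1
          (show ((rep (U.2.arg : ℝ) - U.2.arg : ℝ) : AddCircle (2 * Real.pi)) = 0 by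
            rw [AddCircle.coe_sub, sub_eq_zero]; exact hrep _)
        have h3 : rep (U.2.arg : ℝ) = U.2.arg + n * (2 * Real.pi) := by
          rw [zsmul_eq_mul] at hn; linarith
        rw [h3]
        refine Eq.trans ?_ hUp.symm
        simp only [hpt, Real.cos_add_int_mul_two_pi, Real.sin_add_int_mul_two_pi]
      dsimp only
      rw [hZx]
      have h4 : Real.arcosh (hpt t' a).1 = t' := Real.arcosh_cosh dist_nonneg
      rw [h4]
      rcases (dist_nonneg (x := x) (y := p)).eq_or_lt with h5 | h5
      · have : t' = 0 := h5.symm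
        rw [this, h.2.2.1, eq_comm, ← dist_eq_zero]; exact this
      · have h6 : (hpt t' a).2.arg = a := by
          have : (hpt t' a).2 = ((Real.sinh t' : ℝ) : ℂ) *
              (Complex.cos (a : ℝ) + Complex.sin (a : ℝ) * Complex.I) := by
            rw [← Complex.ofReal_cos, ← Complex.ofReal_sin]
            refine Complex.ext ?_ ?_ <;>
              simp only [hpt, Complex.mul_re, Complex.mul_im, Complex.add_re, Complex.add_im,
                Complex.ofReal_re, Complex.ofReal_im, Complex.I_re, Complex.I_im] <;> ring
          rw [this, Complex.arg_mul_cos_add_sin_mul_I (Real.sinh_pos_iff.2 h5)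
            ⟨by linarith, by linarith⟩]
        rw [h6, ← hθa, hθx]
  · intro r hr r' hr' θ θ'
    rw [h.cosh_dist_lift hκ (hrad' r hr θ) (hrad' r' hr' θ') α (by
        rcases hang with h1 | h1
        · exact Or.inl h1
        · right
          refine (abs_sub _ _).trans ?_
          linarith [h1 r hr θ, h1 r' hr' θ']),
      ← (hpol r θ).2, ← (hpol r' θ').2, hZ, mink_boost, ← coneCosh_two_pi]
    congr 1 <;> exact hrep _
  · intro t' ht' α' hα'
    obtain ⟨a, ha, ha1, ha2, hn⟩ := exists_lift_norm hκ0 (α' - α)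
    have hθa : α' = α + (a : AddCircle κ) := by rw [ha]; abel
    have hd : Real.cosh (dist (e t α) (e t' α')) = mink (hpt t 0) (hpt t' a) := by
      have h1 := h.cosh_dist_lift hκ ht ht' α (a := 0) (a' := a) (by
        right; rw [zero_sub, abs_neg]; exact abs_le.2 ⟨ha1.le, ha2⟩)
      rwa [AddCircle.coe_zero, add_zero, ← hθa] at h1
    set U := boost (-t) (hpt t' a) with hU
    have hU1 : mink U U = 1 := by rw [hU, mink_boost, mink_hpt_self]
    have hUf : U.1 = Real.cosh (dist (e t α) (e t' α')) := by
      rw [hd, ← boost_neg t (hpt t' a), ← boost_hpt_zero t 0, mink_boost, ← hU]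
      simp [mink, hpt]
    obtain ⟨-, hUp⟩ := exists_hpt hU1 (by rw [hUf]; exact Real.cosh_pos _)
    rw [hUf, Real.arcosh_cosh dist_nonneg] at hUp
    -- A point that is not opposite leaves the margin `κ / 2 - |a|` for the moving point, before the
    -- shorter way around the apex could change sides.
    obtain ⟨r₁, hr₁, H⟩ : ∃ r₁ > 0, ∀ r ∈ Ico 0 r₁, ∀ θ,
        κ = 2 * Real.pi ∨ |(Z r θ).2.arg - a| ≤ κ / 2 := by
      rcases hα' with h1 | h1
      · exact ⟨1, one_pos, fun _ _ _ => Or.inl h1⟩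
      · rw [hn] at h1
        rcases hsmall (κ / 2 - |a|) (by linarith) with h2 | ⟨r₁, hr₁, H⟩
        · exact ⟨1, one_pos, fun _ _ _ => Or.inl h2⟩
        · refine ⟨r₁, hr₁, fun r hr θ => Or.inr ((abs_sub _ _).trans ?_)⟩
          linarith [H r hr θ]
    refine ⟨(U.2.arg : ℝ), min r₀ r₁, lt_min hr₀ hr₁, fun r hr θ => ?_⟩
    have hr1 : r ∈ Ico 0 r₀ := ⟨hr.1, hr.2.trans_le (min_le_left _ _)⟩
    have hr2 : r ∈ Ico 0 r₁ := ⟨hr.1, hr.2.trans_le (min_le_right _ _)⟩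
    rw [← mink_hpt_lift r _ _ θ (rep θ) (hrep θ), ← hUp]
    dsimp only
    nth_rewrite 1 [hθa]
    rw [h.cosh_dist_lift hκ (hrad' r hr1 θ) ht' α (H r hr2 θ), ← (hpol r θ).2,
      ← mink_boost t (hpt r (rep θ)), hU, boost_neg]

/-- A point with cone angle `κ₁` has no cone angle larger than `κ₁`. -/
lemma IsConeChart.angle_le {p : X} {κ₁ κ₂ ρ₁ ρ₂ : ℝ} {e₁ : ℝ → AddCircle κ₁ → X}
    {e₂ : ℝ → AddCircle κ₂ → X} (h₁ : IsConeChart p κ₁ ρ₁ e₁) (h₂ : IsConeChart p κ₂ ρ₂ e₂) :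
    κ₂ ≤ κ₁ := by
  have hκ₁ := h₁.1
  have hκ₂ := h₂.1
  have : Fact (0 < κ₁) := ⟨hκ₁⟩
  set r := min ρ₁ ρ₂ / 2 with hr
  have hm : 0 < min ρ₁ ρ₂ := lt_min h₁.2.1 h₂.2.1
  have hr1 : r ∈ Ico 0 ρ₁ := ⟨by positivity, by linarith [min_le_left ρ₁ ρ₂]⟩
  have hr2 : r ∈ Ico 0 ρ₂ := ⟨by positivity, by linarith [min_le_right ρ₁ ρ₂]⟩
  have hsr : 0 < Real.sinh r := Real.sinh_pos_iff.2 (by positivity)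
  -- Packing argument: `n` equally spaced points on a circle around `p` in the second chart have
  -- pairwise angles at least `a = κ₂ / n`. The cosine sees these angles because `a ≤ π`, so the
  -- points are `a`-separated in the first chart too, and disjoint arcs around them must fit into
  -- the length `κ₁`.
  obtain ⟨n, hn'⟩ := exists_nat_gt (max (κ₂ / Real.pi) 1)
  have hn : κ₂ / Real.pi < n := (le_max_left _ _).trans_lt hn'
  have hn1 : (1 : ℝ) < n := (le_max_right _ _).trans_lt hn'
  have hn0 : 0 < n := by exact_mod_cast one_pos.trans hn1
  have hnR : (0 : ℝ) < n := by exact_mod_cast hn0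
  set a := κ₂ / n with ha
  have ha0 : 0 < a := div_pos hκ₂ hnR
  have haπ : a ≤ Real.pi := by
    rw [div_lt_iff₀ Real.pi_pos] at hn
    rw [ha, div_le_iff₀ hnR]; linarith
  have hpt : ∀ j : Fin n, ∃ θ : AddCircle κ₁, e₁ r θ = e₂ r ((j * a : ℝ) : AddCircle κ₂) := by
    intro j
    have h3 := h₂.dist_apex hr2 ((j * a : ℝ) : AddCircle κ₂)
    obtain ⟨θ, hθ⟩ := h₁.exists_polar (x := e₂ r ((j * a : ℝ) : AddCircle κ₂))
      (by rw [Metric.mem_ball, h3]; exact hr1.2)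
    rw [h3] at hθ
    exact ⟨θ, hθ⟩
  choose θ hθ using hpt
  have hsep : ∀ i j : Fin n, i ≠ j → a ≤ ‖θ i - θ j‖ := by
    intro i j hij
    have e1 := h₁.cosh_dist hr1 hr1 (θ i) (θ j)
    rw [hθ, hθ, h₂.cosh_dist hr2 hr2] at e1
    rw [coneCosh, coneCosh, sub_right_inj, mul_right_inj' (mul_pos hsr hsr).ne'] at e1
    have e2 := Real.injOn_cos ⟨le_min (norm_nonneg _) Real.pi_pos.le, min_le_right _ _⟩
      ⟨le_min (norm_nonneg _) Real.pi_pos.le, min_le_right _ _⟩ e1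
    have e3 : a ≤ ‖((i * a : ℝ) : AddCircle κ₂) - ((j * a : ℝ) : AddCircle κ₂)‖ := by
      rw [← AddCircle.coe_sub, AddCircle.norm_eq]
      set k := round (κ₂⁻¹ * ((i : ℝ) * a - j * a))
      have e4 : (i : ℝ) * a - j * a - k * κ₂ = (((i : ℤ) - j - k * n : ℤ) : ℝ) * a := by
        push_cast; rw [ha]; field_simp
      rw [e4, abs_mul, abs_of_pos ha0]
      refine le_mul_of_one_le_left ha0.le ?_
      rw [← Int.cast_abs]
      have : (i : ℤ) - j - k * n ≠ 0 := by
        intro h0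
        apply hij
        have h5 : (i : ℤ) % n = j % n := by
          rw [show (i : ℤ) = j + n * k by linarith, Int.add_mul_emod_self_left]
        rw [Int.emod_eq_of_lt (by positivity) (by exact_mod_cast i.2),
          Int.emod_eq_of_lt (by positivity) (by exact_mod_cast j.2)] at h5
        exact Fin.ext (by exact_mod_cast h5)
      exact_mod_cast Int.one_le_abs this
    have e5 : a ≤ min ‖θ i - θ j‖ Real.pi := by
      rw [← e2]; exact le_min e3 haπ
    exact e5.trans (min_le_left _ _)
  by_contra hlt
  push Not at hlt
  have hvol : ∀ b : ℝ, b < a / 2 → 2 * b * n ≤ κ₁ := by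
    intro b hb
    rcases le_or_gt b 0 with hb0 | hb0
    · have : b * n ≤ 0 := mul_nonpos_of_nonpos_of_nonneg hb0 hnR.le
      linarith
    have hdisj : Pairwise (Function.onFun Disjoint fun j : Fin n => Metric.closedBall (θ j) b) := by
      intro i j hij
      refine Metric.closedBall_disjoint_closedBall ?_
      rw [dist_eq_norm]; linarith [hsep i j hij]
    have h6 := MeasureTheory.measure_iUnion (μ := MeasureTheory.volume) hdisj
      (fun j => Metric.isClosed_closedBall.measurableSet)
    have h7 : MeasureTheory.volume (⋃ j : Fin n, Metric.closedBall (θ j) b) ≤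
        ENNReal.ofReal κ₁ := by
      rw [← AddCircle.measure_univ κ₁]; exact MeasureTheory.measure_mono (subset_univ _)
    rw [h6, tsum_fintype] at h7
    simp only [AddCircle.volume_closedBall, Finset.sum_const, Finset.card_univ, Fintype.card_fin,
      nsmul_eq_mul] at h7
    rw [← ENNReal.ofReal_natCast, ← ENNReal.ofReal_mul hnR.le,
      ENNReal.ofReal_le_ofReal_iff hκ₁.le] at h7
    -- An arc of radius `b` has measure `min κ₁ (2 * b)`; the value `κ₁` is impossible since `n > 1`
    -- such arcs are disjoint.
    rcases min_choice κ₁ (2 * b) with h8 | h8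
    · rw [h8] at h7
      nlinarith
    · rw [h8] at h7; linarith
  -- This `b` is midway between `κ₁ / (2 * n)` and `a / 2 = κ₂ / (2 * n)`.
  have h11 := hvol (κ₁ / (2 * n) + (κ₂ - κ₁) / (4 * n)) (by
    rw [ha]; rw [div_add_div _ _ (by positivity) (by positivity), div_div, div_lt_div_iff₀ (by positivity) (by positivity)]
    nlinarith [mul_pos hnR hnR, mul_pos (mul_pos hnR hnR) (sub_pos.2 hlt), mul_pos (mul_pos (mul_pos hnR hnR) hnR) (sub_pos.2 hlt)])
  have h12 : 2 * (κ₁ / (2 * n) + (κ₂ - κ₁) / (4 * n)) * n = κ₁ + (κ₂ - κ₁) / 2 := by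
    field_simp; ring
  linarith

end Charts

section PathLength

variable {X : Type*} [MetricSpace X]

/-! ### Lengths of paths -/

lemma eVariationOn_unitInterval_val : eVariationOn (Subtype.val : unitInterval → ℝ) univ ≤ 1 := by
  have h2 := eVariationOn.comp_le_of_monotoneOn (id : ℝ → ℝ) (s := Icc 0 1) (t := univ)
    (Subtype.val : unitInterval → ℝ) (fun _ _ _ _ h => h) (fun t _ => t.2)
  refine h2.trans ?_
  simp

lemma pathLength_le_of_lipschitz {x y : X} (γ : Path x y) {C : NNReal}
    (h : ∀ s t, dist (γ s) (γ t) ≤ C * |(s : ℝ) - t|) : pathLength γ ≤ C := by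
  have hl : LipschitzOnWith C γ univ := by
    refine LipschitzOnWith.of_dist_le_mul fun s _ t _ => ?_
    exact h s t
  have h1 : eVariationOn (id : unitInterval → unitInterval) univ ≤ 1 := by
    refine le_trans (le_of_eq ?_) eVariationOn_unitInterval_val
    simp only [eVariationOn, id, Subtype.edist_eq]
  have h2 := hl.comp_eVariationOn_le (g := (id : unitInterval → unitInterval)) (s := univ)
    (mapsTo_univ _ _)
  rw [pathLength]
  refine h2.trans ?_
  calc (C : ℝ≥0∞) * eVariationOn (id : unitInterval → unitInterval) univ ≤ C * 1 := by gcongr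
    _ = C := mul_one _

lemma pathLength_map_le {Y : Type*} [MetricSpace Y] {x y : X} (γ : Path x y) {f : X → Y}
    (hf : Continuous f) {C : NNReal} (h : LipschitzWith C f) :
    pathLength (γ.map hf) ≤ C * pathLength γ :=
  (h.lipschitzOnWith (s := univ)).comp_eVariationOn_le (mapsTo_univ _ _)

lemma edist_le_pathLength {x y : X} (γ : Path x y) (s t : unitInterval) :
    edist (γ s) (γ t) ≤ pathLength γ :=
  eVariationOn.edist_le _ (mem_univ _) (mem_univ _)

lemma edist_add_edist_le_pathLength {x y : X} (γ : Path x y) (t : unitInterval) :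
    edist x (γ t) + edist (γ t) y ≤ pathLength γ := by
  have h1 := eVariationOn.Icc_add_Icc γ (s := univ) (a := 0) (b := t) (c := 1) t.2.1 t.2.2
    (mem_univ _)
  have h2 : eVariationOn γ (univ ∩ Icc 0 1) ≤ pathLength γ := eVariationOn.mono _ (subset_univ _)
  refine le_trans ?_ (h1.le.trans h2)
  refine add_le_add ?_ ?_
  · have := eVariationOn.edist_le γ (s := univ ∩ Icc 0 t) (x := 0) (y := t)
      ⟨mem_univ _, left_mem_Icc.2 t.2.1⟩ ⟨mem_univ _, right_mem_Icc.2 t.2.1⟩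
    rwa [γ.source] at this
  · have := eVariationOn.edist_le γ (s := univ ∩ Icc t 1) (x := t) (y := 1)
      ⟨mem_univ _, left_mem_Icc.2 t.2.2⟩ ⟨mem_univ _, right_mem_Icc.2 t.2.2⟩
    rwa [γ.target] at this

lemma pathLength_trans_le {x y z : X} (γ : Path x y) (γ' : Path y z) :
    pathLength (γ.trans γ') ≤ pathLength γ + pathLength γ' := by
  set h : unitInterval := ⟨1 / 2, by norm_num, by norm_num⟩
  have h1 := eVariationOn.Icc_add_Icc (γ.trans γ') (s := univ) (a := 0) (b := h) (c := 1) h.2.1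
    h.2.2 (mem_univ _)
  have hu : (univ : Set unitInterval) ∩ Icc 0 1 = univ := by
    ext t; simp only [univ_inter, mem_univ, iff_true]; exact ⟨t.2.1, t.2.2⟩
  rw [hu] at h1
  rw [pathLength, ← h1]
  refine add_le_add ?_ ?_
  · set φ : unitInterval → unitInterval := fun t => projIcc 0 1 zero_le_one (2 * (t : ℝ))
    have e : EqOn (γ.trans γ') (γ ∘ φ) (univ ∩ Icc 0 h) := by
      rintro t ⟨-, -, ht⟩
      have ht' : (t : ℝ) ≤ 1 / 2 := ht
      rw [Path.trans_apply, dif_pos ht']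
      simp only [Function.comp, φ]
      rw [projIcc_of_mem]
    rw [eVariationOn.congr e]
    refine eVariationOn.comp_le_of_monotoneOn _ _ ?_ (mapsTo_univ _ _)
    intro s _ t _ hst
    exact monotone_projIcc _ (by have : (s : ℝ) ≤ t := hst; linarith)
  · set φ : unitInterval → unitInterval := fun t => projIcc 0 1 zero_le_one (2 * (t : ℝ) - 1)
    have e : EqOn (γ.trans γ') (γ' ∘ φ) (univ ∩ Icc h 1) := by
      rintro t ⟨-, ht, -⟩
      have ht' : 1 / 2 ≤ (t : ℝ) := ht
      simp only [Function.comp, φ]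
      rcases ht'.eq_or_lt with h2 | h2
      · rw [Path.trans_apply, dif_pos h2.symm.le]
        have e1 : projIcc (0 : ℝ) 1 zero_le_one (2 * (t : ℝ) - 1) = 0 :=
          projIcc_of_le_left _ (by linarith)
        rw [e1, γ'.source]
        have e2 : (⟨2 * (t : ℝ), (unitInterval.mul_pos_mem_iff zero_lt_two).2
            ⟨t.2.1, h2.symm.le⟩⟩ : unitInterval) = 1 := Subtype.ext (by
          change 2 * (t : ℝ) = 1
          linarith)
        exact (congrArg γ e2).trans γ.target
      · rw [Path.trans_apply, dif_neg (not_le.2 h2)]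
        rw [projIcc_of_mem]
    rw [eVariationOn.congr e]
    refine eVariationOn.comp_le_of_monotoneOn _ _ ?_ (mapsTo_univ _ _)
    intro s _ t _ hst
    exact monotone_projIcc _ (by have : (s : ℝ) ≤ t := hst; linarith)

end PathLength

section Systole

variable {X : Type*} [MetricSpace X]

/-! ### Smooth points and contractible balls -/

lemma IsConeChart.hasConeAngle_two_pi {p : X} {κ ρ : ℝ} {e : ℝ → AddCircle κ → X}
    (h : IsConeChart p κ ρ e) (hκ : κ ≤ 2 * Real.pi) {x : X} (hx : x ∈ Metric.ball p ρ)
    (hne : x ≠ p) : HasConeAngle x (2 * Real.pi) := by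
  obtain ⟨θ, hθ⟩ := h.exists_polar hx
  obtain ⟨r₀, e', h', -⟩ := h.recenter hκ (t := dist x p) ⟨dist_nonneg, hx⟩ θ
    (fun h0 => absurd (dist_eq_zero.1 h0) hne)
  rw [hθ] at h'
  exact hasConeAngle_iff.2 ⟨r₀, e', h'⟩

/-- In a compact space where all points have cone angles at most `2π`, cone-points are isolated,
hence finite in number. -/
lemma finite_conePoints [CompactSpace X] (h : ∀ p : X, ∃ κ ≤ 2 * Real.pi, HasConeAngle p κ) :
    (conePoints X).Finite := by
  have key : ∀ p : X, ∃ U ∈ nhds p, (U ∩ conePoints X).Finite := by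
    intro p
    obtain ⟨κ, hκ, hp⟩ := h p
    obtain ⟨ρ, e, hc⟩ := hasConeAngle_iff.1 hp
    refine ⟨_, Metric.ball_mem_nhds p hc.2.1, (finite_singleton p).subset ?_⟩
    rintro x ⟨hx, hx'⟩
    by_contra hne
    exact hx' (hc.hasConeAngle_two_pi hκ hx hne)
  choose U hU hf using key
  obtain ⟨t, ht⟩ := isCompact_univ.elim_nhds_subcover U fun p _ => hU p
  refine (t.finite_toSet.biUnion fun p _ => hf p).subset fun x hx => ?_
  obtain ⟨p, hp, hxp⟩ := mem_iUnion₂.1 (ht.2 (mem_univ x))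
  exact mem_iUnion₂.2 ⟨p, hp, hxp, hx⟩

/-- Scaling both radii by `s ≤ 1` shrinks both the radial difference and the factor of the angular
term. The Lipschitz bound for the radial contraction rests on this. -/
lemma coneCosh_mul_le {κ r r' : ℝ} (hr : 0 ≤ r) (hr' : 0 ≤ r') (θ θ' : AddCircle κ) {s : ℝ}
    (hs : s ∈ Icc 0 1) : coneCosh κ (s * r) θ (s * r') θ' ≤ coneCosh κ r θ r' θ' := by
  rw [coneCosh_eq, coneCosh_eq]
  have h1 : Real.cosh (s * r - s * r') ≤ Real.cosh (r - r') := by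
    rw [Real.cosh_le_cosh, ← mul_sub, abs_mul, abs_of_nonneg hs.1]
    exact mul_le_of_le_one_left (abs_nonneg _) hs.2
  have h2 : ∀ u, 0 ≤ u → 0 ≤ Real.sinh (s * u) ∧ Real.sinh (s * u) ≤ Real.sinh u := fun u hu =>
    ⟨Real.sinh_nonneg_iff.2 (mul_nonneg hs.1 hu),
      Real.sinh_le_sinh.2 (mul_le_of_le_one_left hu hs.2)⟩
  have h3 : Real.sinh (s * r) * Real.sinh (s * r') ≤ Real.sinh r * Real.sinh r' :=
    mul_le_mul (h2 r hr).2 (h2 r' hr').2 (h2 r' hr').1 (Real.sinh_nonneg_iff.2 hr)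
  have h4 := mul_le_mul_of_nonneg_right h3
    (sub_nonneg.2 (Real.cos_le_one (min ‖θ - θ'‖ Real.pi)))
  linarith

/-- The radial contraction of a cone. -/
lemma IsConeChart.exists_contraction {p : X} {κ ρ : ℝ} {e : ℝ → AddCircle κ → X}
    (h : IsConeChart p κ ρ e) : ∃ H : ℝ → X → X, (∀ x ∈ Metric.ball p ρ, H 1 x = x ∧ H 0 x = p) ∧
      (∀ x ∈ Metric.ball p ρ, ∀ s ∈ Icc (0 : ℝ) 1, H s x ∈ Metric.ball p ρ) ∧
      ∀ x ∈ Metric.ball p ρ, ∀ y ∈ Metric.ball p ρ, ∀ s ∈ Icc (0 : ℝ) 1, ∀ t ∈ Icc (0 : ℝ) 1,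
        dist (H s x) (H t y) ≤ ρ * |s - t| + dist x y := by
  classical
  choose! θ hθ using fun x (hx : x ∈ Metric.ball p ρ) => h.exists_polar hx
  have hmem : ∀ x ∈ Metric.ball p ρ, ∀ s ∈ Icc (0 : ℝ) 1, s * dist x p ∈ Ico 0 ρ :=
    fun x hx s hs => ⟨mul_nonneg hs.1 dist_nonneg,
      (mul_le_of_le_one_left dist_nonneg hs.2).trans_lt hx⟩
  refine ⟨fun s x => e (s * dist x p) (θ x), ?_, ?_, ?_⟩
  · intro x hx
    refine ⟨?_, ?_⟩
    · simp only [one_mul, hθ x hx]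
    · simp only [zero_mul, h.2.2.1]
  · intro x hx s hs
    exact h.mem_ball (hmem x hx s hs) _
  · intro x hx y hy s hs t ht
    have h1 : dist (e (s * dist x p) (θ x)) (e (t * dist x p) (θ x)) ≤ ρ * |s - t| := by
      have : dist (e (s * dist x p) (θ x)) (e (t * dist x p) (θ x)) = |s * dist x p - t * dist x p| := by
        refine cosh_inj_of_nonneg dist_nonneg (abs_nonneg _) ?_
        rw [h.cosh_dist (hmem x hx s hs) (hmem x hx t ht), coneCosh_self_angle, Real.cosh_abs]
      rw [this, ← sub_mul, abs_mul, abs_of_nonneg dist_nonneg, mul_comm]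
      exact mul_le_mul_of_nonneg_right (le_of_lt hx) (abs_nonneg _)
    have h2 : dist (e (t * dist x p) (θ x)) (e (t * dist y p) (θ y)) ≤ dist x y := by
      rw [← cosh_le_iff_of_nonneg dist_nonneg dist_nonneg,
        h.cosh_dist (hmem x hx t ht) (hmem y hy t ht)]
      refine (coneCosh_mul_le dist_nonneg dist_nonneg _ _ ht).trans (le_of_eq ?_)
      rw [← h.cosh_dist ⟨dist_nonneg, hx⟩ ⟨dist_nonneg, hy⟩, hθ x hx, hθ y hy]
    exact (dist_triangle _ _ _).trans (add_le_add h1 h2)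

lemma IsConeChart.contractibleSpace_ball {p : X} {κ ρ : ℝ} {e : ℝ → AddCircle κ → X}
    (h : IsConeChart p κ ρ e) : ContractibleSpace (Metric.ball p ρ) := by
  obtain ⟨H, H1, H2, H3⟩ := h.exists_contraction
  rw [contractible_iff_id_nullhomotopic]
  refine ⟨⟨p, Metric.mem_ball_self h.2.1⟩, ⟨⟨⟨fun q => ⟨H (unitInterval.symm q.1) q.2,
    H2 _ q.2.2 _ (unitInterval.symm q.1).2⟩, ?_⟩, ?_, ?_⟩⟩⟩
  · refine Continuous.subtype_mk ?_ _
    rw [continuous_iff_continuousAt]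
    rintro ⟨s₀, x₀⟩
    rw [ContinuousAt, tendsto_iff_dist_tendsto_zero]
    refine squeeze_zero (fun _ => dist_nonneg) (fun q => H3 q.2 q.2.2 x₀ x₀.2 _
      (unitInterval.symm q.1).2 _ (unitInterval.symm s₀).2) ?_
    have : Continuous fun q : unitInterval × Metric.ball p ρ =>
        ρ * |((unitInterval.symm q.1 : unitInterval) : ℝ) - (unitInterval.symm s₀ : unitInterval)| +
          dist (q.2 : X) x₀ := by fun_prop
    have h2 := this.tendsto (s₀, x₀)
    simpa using h2
  · intro x
    apply Subtype.ext
    simpa using (H1 x x.2).1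
  · intro x
    apply Subtype.ext
    simpa using (H1 x x.2).2

lemma IsConeChart.homotopic_of_mem_ball {p : X} {κ ρ : ℝ} {e : ℝ → AddCircle κ → X}
    (h : IsConeChart p κ ρ e) {x y : X} (γ γ' : Path x y) (hγ : ∀ t, γ t ∈ Metric.ball p ρ)
    (hγ' : ∀ t, γ' t ∈ Metric.ball p ρ) : γ.Homotopic γ' := by
  have := h.contractibleSpace_ball
  have hx : x ∈ Metric.ball p ρ := by simpa using hγ 0
  have hy : y ∈ Metric.ball p ρ := by simpa using hγ 1
  let lift : ∀ σ : Path x y, (∀ t, σ t ∈ Metric.ball p ρ) →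
      Path (⟨x, hx⟩ : Metric.ball p ρ) ⟨y, hy⟩ := fun σ hσ =>
    { toFun := fun t => ⟨σ t, hσ t⟩
      continuous_toFun := σ.continuous.subtype_mk _
      source' := Subtype.ext σ.source
      target' := Subtype.ext σ.target }
  have h1 := SimplyConnectedSpace.paths_homotopic (lift γ hγ) (lift γ' hγ')
  exact h1.map ⟨Subtype.val, continuous_subtype_val⟩

lemma IsConeChart.exists_path {p : X} {κ ρ : ℝ} {e : ℝ → AddCircle κ → X}
    (h : IsConeChart p κ ρ e) {x : X} (hx : x ∈ Metric.ball p ρ) :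
    ∃ γ : Path p x, (∀ t, γ t ∈ Metric.ball p ρ) ∧ pathLength γ < ∞ ∧ pathLength γ.symm < ∞ := by
  obtain ⟨H, H1, H2, H3⟩ := h.exists_contraction
  have hl : ∀ s t : unitInterval, dist (H s x) (H t x) ≤ ρ.toNNReal * |(s : ℝ) - t| := by
    intro s t
    have := H3 x hx x hx s s.2 t t.2
    rwa [dist_self, add_zero, ← Real.coe_toNNReal ρ h.2.1.le] at this
  have hc : Continuous fun t : unitInterval => H t x := by
    have : LipschitzWith ρ.toNNReal fun t : unitInterval => H t x :=
      LipschitzWith.of_dist_le_mul fun s t => hl s t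
    exact this.continuous
  refine ⟨⟨⟨fun t => H t x, hc⟩, by simpa using (H1 x hx).2, by simpa using (H1 x hx).1⟩,
    fun t => H2 x hx t t.2, ?_, ?_⟩
  · exact (pathLength_le_of_lipschitz (C := ρ.toNNReal) _ hl).trans_lt ENNReal.coe_lt_top
  · refine (pathLength_le_of_lipschitz (C := ρ.toNNReal) _ fun s t => ?_).trans_lt
      ENNReal.coe_lt_top
    have := hl (unitInterval.symm s) (unitInterval.symm t)
    simpa [abs_sub_comm] using this

lemma IsConeChart.exists_rectifiable {p : X} {κ ρ : ℝ} {e : ℝ → AddCircle κ → X}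
    (h : IsConeChart p κ ρ e) {x y : X} (γ : Path x y) (hγ : ∀ t, γ t ∈ Metric.ball p ρ) :
    ∃ γ' : Path x y, γ.Homotopic γ' ∧ pathLength γ' < ∞ := by
  obtain ⟨γ₁, h1, -, h1'⟩ := h.exists_path (by simpa using hγ 0 : x ∈ Metric.ball p ρ)
  obtain ⟨γ₂, h2, h2', -⟩ := h.exists_path (by simpa using hγ 1 : y ∈ Metric.ball p ρ)
  refine ⟨γ₁.symm.trans γ₂, h.homotopic_of_mem_ball _ _ hγ ?_,
    (pathLength_trans_le _ _).trans_lt (ENNReal.add_lt_top.2 ⟨h1', h2'⟩)⟩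
  intro t
  have : γ₁.symm.trans γ₂ t ∈ range (γ₁.symm.trans γ₂) := mem_range_self t
  rw [Path.trans_range, Path.symm_range] at this
  rcases this with ⟨s, hs⟩ | ⟨s, hs⟩
  · rw [← hs]; exact h1 s
  · rw [← hs]; exact h2 s

lemma pathConnectedSpace_of_hasConeAngle [ConnectedSpace X]
    (h : ∀ p : X, ∃ κ, HasConeAngle p κ) : PathConnectedSpace X := by
  have key : ∀ p : X, ∀ᶠ x in nhds p, Joined p x := by
    intro p
    obtain ⟨κ, hp⟩ := h p
    obtain ⟨ρ, e, hc⟩ := hasConeAngle_iff.1 hp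
    filter_upwards [Metric.ball_mem_nhds p hc.2.1] with x hx
    obtain ⟨γ, -⟩ := hc.exists_path hx
    exact ⟨γ⟩
  refine ⟨inferInstance, fun x y => ?_⟩
  have hcl : IsClopen {y | Joined x y} := by
    refine ⟨⟨isOpen_iff_eventually.2 fun z hz => ?_⟩, isOpen_iff_eventually.2 fun z hz => ?_⟩
    · filter_upwards [key z] with w hw hxw
      exact hz (hxw.trans hw.symm)
    · filter_upwards [key z] with w hw
      exact Joined.trans hz hw
  have hu := hcl.eq_univ ⟨x, Joined.refl x⟩
  exact hu.symm.subset (mem_univ y)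

/-- Every path is homotopic to a path of finite length. -/
lemma exists_rectifiable_homotopic (h : ∀ p : X, ∃ κ, HasConeAngle p κ) {x y : X}
    (γ : Path x y) : ∃ γ' : Path x y, γ.Homotopic γ' ∧ pathLength γ' < ∞ := by
  choose κ hκ using h
  choose ρ e hc using fun p => hasConeAngle_iff.1 (hκ p)
  obtain ⟨t, h0, hmono, ⟨n, hn⟩, hsub⟩ := exists_monotone_Icc_subset_open_cover_unitInterval
    (c := fun p => γ ⁻¹' Metric.ball p (ρ p)) (fun p => Metric.isOpen_ball.preimage γ.continuous)
    (fun s _ => mem_iUnion.2 ⟨γ s, Metric.mem_ball_self (hc _).2.1⟩)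
  have key : ∀ m, ∃ γ' : Path (γ 0) (γ (t m)), (γ.subpath 0 (t m)).Homotopic γ' ∧
      pathLength γ' < ∞ := by
    intro m
    induction m with
    | zero =>
      rw [h0, Path.subpath_self]
      exact ⟨Path.refl _, Path.Homotopic.refl _,
        (pathLength_le_of_lipschitz (C := 0) _ (by simp)).trans_lt (by simp)⟩
    | succ m ih =>
      obtain ⟨γ₁, h1, h1'⟩ := ih
      obtain ⟨p, hp⟩ := hsub m
      obtain ⟨γ₂, h2, h2'⟩ := (hc p).exists_rectifiable (γ.subpath (t m) (t (m + 1))) (by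
        intro s
        have hs : γ.subpath (t m) (t (m + 1)) s ∈ range (γ.subpath (t m) (t (m + 1))) :=
          mem_range_self s
        rw [Path.range_subpath_of_le _ _ _ (hmono (Nat.le_succ m))] at hs
        obtain ⟨s', hs', e'⟩ := hs
        rw [← e']
        exact hp hs')
      refine ⟨γ₁.trans γ₂, ?_, (pathLength_trans_le _ _).trans_lt (ENNReal.add_lt_top.2 ⟨h1', h2'⟩)⟩
      exact (Path.Homotopic.symm ⟨Path.Homotopy.subpathTransSubpath γ 0 (t m) (t (m + 1))⟩).trans
        (h1.hcomp h2)
  obtain ⟨γ', h1, h2⟩ := key n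
  have e1 : t n = 1 := hn n le_rfl
  revert γ'
  rw [e1, Path.subpath_zero_one]
  intro γ' h1 h2
  refine ⟨γ'.cast γ.source.symm γ.target.symm, ?_, h2⟩
  have := h1.pathCast γ.source.symm γ.target.symm
  exact this

/-- Some loop is not contractible, and within contractible cone balls it can be replaced piece by
piece by rectifiable paths. Finiteness matters because `toReal` sends `∞` to 0, where `δ` is not
controlled. -/
lemma systole_lt_top [ConnectedSpace X] (hS : ¬ SimplyConnectedSpace X)
    (h : ∀ p : X, ∃ κ, HasConeAngle p κ) : systole X < ∞ := by
  have := pathConnectedSpace_of_hasConeAngle h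
  rw [simply_connected_iff_loops_nullhomotopic] at hS
  push Not at hS
  obtain ⟨x, γ, hγ⟩ := hS this
  obtain ⟨γ', h1, h2⟩ := exists_rectifiable_homotopic h γ
  have h3 : ¬ γ'.Homotopic (Path.refl x) := fun h4 => hγ (h1.trans h4)
  exact (iInf_le_of_le x (iInf_le_of_le γ' (iInf_le _ h3))).trans_lt h2

/-- A loop shorter than a Lebesgue number of the cover by cone balls lies in one of them, and these
are contractible. -/
lemma systole_pos [CompactSpace X] (h : ∀ p : X, ∃ κ, HasConeAngle p κ) : 0 < systole X := by
  choose κ hκ using h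
  choose ρ e hc using fun p => hasConeAngle_iff.1 (hκ p)
  obtain ⟨ε, hε, H⟩ := lebesgue_number_lemma_of_metric (isCompact_univ (X := X))
    (c := fun p => Metric.ball p (ρ p)) (fun p => Metric.isOpen_ball)
    (fun x _ => mem_iUnion.2 ⟨x, Metric.mem_ball_self (hc _).2.1⟩)
  refine lt_of_lt_of_le (ENNReal.ofReal_pos.2 hε) ?_
  refine le_iInf fun x => le_iInf fun γ => le_iInf fun hγ => ?_
  by_contra hlt
  push Not at hlt
  obtain ⟨p, hp⟩ := H x (mem_univ x)
  refine hγ ((hc p).homotopic_of_mem_ball _ _ (fun t => hp ?_) fun t => hp ?_)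
  · have h1 := (edist_le_pathLength γ t 0).trans_lt hlt
    rw [γ.source, edist_dist, ENNReal.ofReal_lt_ofReal_iff hε] at h1
    exact h1
  · simpa using hε

/-- A homeomorphism carries non-contractible loops to non-contractible loops, and a `C`-Lipschitz
map multiplies lengths by at most `C`. -/
lemma systole_le_of_homeomorph {Y : Type*} [MetricSpace Y] (f : X ≃ₜ Y) {C : NNReal} (hC : C ≠ 0)
    (hf : LipschitzWith C f) : systole Y ≤ C * systole X := by
  rw [systole, systole]
  simp only [ENNReal.mul_iInf_of_ne (ENNReal.coe_ne_zero.2 hC) ENNReal.coe_ne_top]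
  refine le_iInf fun x => le_iInf fun γ => le_iInf fun hγ => ?_
  refine iInf_le_of_le (f x) (iInf_le_of_le (γ.map f.continuous) (iInf_le_of_le ?_
    (pathLength_map_le γ f.continuous hf)))
  intro h
  apply hγ
  have h1 := h.map ⟨f.symm, f.symm.continuous⟩
  have h2 := h1.pathCast (f.symm_apply_apply x).symm (f.symm_apply_apply x).symm
  convert h2 using 1
  · ext t; simp
  · ext t; simp

end Systole

/-! ### Geodesic chains in compact intrinsic spaces -/

section Chains

variable {Y : Type*} [MetricSpace Y]

/-- A nearly shortest path crosses the sphere of radius `dist x y / 2` around `x` at a point nearly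
as close to `y`. Minimizing the distance to `y` on this compact sphere removes the error. -/
lemma exists_midpoint [CompactSpace Y] (hI : IsIntrinsic Y) (x y : Y) :
    ∃ m, dist x m ≤ dist x y / 2 ∧ dist m y ≤ dist x y / 2 := by
  have key : ∀ ε > 0, ∃ m, dist x m = dist x y / 2 ∧ dist m y ≤ dist x y / 2 + ε := by
    intro ε hε
    have h1 : (⨅ γ : Path x y, pathLength γ) < edist x y + ENNReal.ofReal ε := by
      rw [← hI]
      exact ENNReal.lt_add_right (edist_ne_top x y) (ENNReal.ofReal_pos.2 hε).ne'
    obtain ⟨γ, hγ⟩ := iInf_lt_iff.1 h1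
    have hc : Continuous fun t : unitInterval => dist x (γ t) := by fun_prop
    have hmem : dist x y / 2 ∈ Icc (dist x (γ 0)) (dist x (γ 1)) := by
      rw [γ.source, γ.target, dist_self]
      constructor <;> linarith [dist_nonneg (x := x) (y := y)]
    obtain ⟨t, ht⟩ := intermediate_value_univ (0 : unitInterval) 1 hc hmem
    refine ⟨γ t, ht, ?_⟩
    have h2 := (edist_add_edist_le_pathLength γ t).trans hγ.le
    rw [edist_dist, edist_dist, edist_dist, ← ENNReal.ofReal_add dist_nonneg dist_nonneg,
      ← ENNReal.ofReal_add dist_nonneg hε.le,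
      ENNReal.ofReal_le_ofReal_iff (add_nonneg dist_nonneg hε.le)] at h2
    have ht' : dist x (γ t) = dist x y / 2 := ht
    linarith
  have hcomp : IsCompact {m | dist x m = dist x y / 2} :=
    (isClosed_eq (by fun_prop) continuous_const).isCompact
  obtain ⟨m₁, hm₁, -⟩ := key 1 one_pos
  obtain ⟨m, hm, hmin⟩ := hcomp.exists_isMinOn ⟨m₁, hm₁⟩
    (f := fun m => dist m y) (by fun_prop)
  refine ⟨m, le_of_eq hm, le_of_forall_pos_le_add fun ε hε => ?_⟩
  obtain ⟨m₂, hm₂, h2⟩ := key ε hε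
  exact (hmin hm₂).trans h2

/-- Repeated bisection. A dyadic chain takes the place of a geodesic, since only finitely many of
its points are needed to develop it. -/
lemma exists_geodesic_chain [CompactSpace Y] (hI : IsIntrinsic Y) (k : ℕ) : ∀ x y : Y,
    ∃ z : ℕ → Y, z 0 = x ∧ z (2 ^ k) = y ∧
      ∀ i < 2 ^ k, dist (z i) (z (i + 1)) ≤ dist x y / 2 ^ k := by
  induction k with
  | zero =>
    intro x y
    refine ⟨fun i => if i = 0 then x else y, by simp, by simp, ?_⟩
    intro i hi
    have : i = 0 := by simpa using hi
    subst this
    simp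
  | succ k ih =>
    intro x y
    obtain ⟨m, h1, h2⟩ := exists_midpoint hI x y
    obtain ⟨z, z0, z1, hz⟩ := ih x m
    obtain ⟨w, w0, w1, hw⟩ := ih m y
    have hp : (0 : ℝ) < 2 ^ k := by positivity
    refine ⟨fun i => if i ≤ 2 ^ k then z i else w (i - 2 ^ k), by simp [z0], ?_, ?_⟩
    · have : ¬ (2 ^ (k + 1) ≤ 2 ^ k) := by
        have := Nat.one_le_two_pow (n := k)
        rw [pow_succ]; omega
      simp only [this, if_false]
      rw [pow_succ, show 2 ^ k * 2 - 2 ^ k = 2 ^ k by omega, w1]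
    · intro i hi
      have e1 : dist x m / 2 ^ k ≤ dist x y / 2 ^ (k + 1) := by
        rw [pow_succ, mul_comm, ← div_div]; gcongr
      have e2 : dist m y / 2 ^ k ≤ dist x y / 2 ^ (k + 1) := by
        rw [pow_succ, mul_comm, ← div_div]; gcongr
      rw [pow_succ] at hi
      rcases lt_trichotomy i (2 ^ k) with h | h | h
      · simp only [h.le, show i + 1 ≤ 2 ^ k from h, if_true]
        exact (hz i h).trans e1
      · subst h
        simp only [le_refl, if_true, show ¬ (2 ^ k + 1 ≤ 2 ^ k) by omega, if_false,
          Nat.add_sub_cancel_left, z1]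
        have := hw 0 (by positivity)
        rw [w0, zero_add] at this
        exact this.trans e2
      · simp only [not_le.2 h, if_false, show ¬ (i + 1 ≤ 2 ^ k) by omega]
        have := hw (i - 2 ^ k) (by omega)
        rw [show i + 1 - 2 ^ k = i - 2 ^ k + 1 by omega]
        exact this.trans e2

lemma dist_chain_le {z : ℕ → Y} {δ : ℝ} {N : ℕ} (h : ∀ i < N, dist (z i) (z (i + 1)) ≤ δ)
    {i j : ℕ} (hij : i ≤ j) (hj : j ≤ N) : dist (z i) (z j) ≤ (j - i) * δ := by
  induction j, hij using Nat.le_induction with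
  | base => simp
  | succ j hj' ih =>
    have h1 := ih (by omega)
    have h2 := h j (by omega)
    have h3 := dist_triangle (z i) (z j) (z (j + 1))
    push_cast
    linarith

end Chains

/-! ### Developing maps -/

section Development

variable {Y : Type*} [MetricSpace Y]

/-- `D` maps `N` isometrically into the hyperboloid. -/
def IsometricOn (D : Y → ℝ × ℂ) (N : Set Y) : Prop :=
  ∀ a ∈ N, ∀ b ∈ N, mink (D a) (D b) = Real.cosh (dist a b)

/-- `D` is locally isometric on `A`. -/
def IsDevelopment (D : Y → ℝ × ℂ) (A : Set Y) : Prop :=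
  ∀ y ∈ A, ∃ N ∈ nhds y, IsometricOn D N

lemma IsometricOn.mono {D : Y → ℝ × ℂ} {N N' : Set Y} (h : IsometricOn D N) (hN : N' ⊆ N) :
    IsometricOn D N' := fun a ha b hb => h a (hN ha) b (hN hb)

lemma IsDevelopment.mono {D : Y → ℝ × ℂ} {A A' : Set Y} (h : IsDevelopment D A) (hA : A' ⊆ A) :
    IsDevelopment D A' := fun y hy => h y (hA hy)

lemma exists_isDevelopment {y : Y} (h : HasConeAngle y (2 * Real.pi)) :
    ∃ A, IsOpen A ∧ y ∈ A ∧ ∃ D, IsDevelopment D A := by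
  obtain ⟨ρ, e, hc⟩ := hasConeAngle_iff.1 h
  choose rep hrep using fun θ : AddCircle (2 * Real.pi) => QuotientAddGroup.mk_surjective θ
  choose! θ hθ using fun x (hx : x ∈ Metric.ball y ρ) => hc.exists_polar hx
  refine ⟨Metric.ball y ρ, Metric.isOpen_ball, Metric.mem_ball_self hc.2.1,
    fun x => hpt (dist x y) (rep (θ x)), fun x hx => ⟨_, Metric.isOpen_ball.mem_nhds hx, ?_⟩⟩
  intro a ha b hb
  rw [← coneCosh_two_pi]
  have h1 := hc.cosh_dist ⟨dist_nonneg, ha⟩ ⟨dist_nonneg, hb⟩ (θ a) (θ b)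
  rw [hθ a ha, hθ b hb] at h1
  rw [h1]
  congr 1 <;> exact hrep _

/-- Three points around a smooth point that are mapped to a basis. -/
lemma IsometricOn.exists_basis {D : Y → ℝ × ℂ} {N : Set Y} {y : Y} (h : IsometricOn D N)
    (hN : N ∈ nhds y) (hy : HasConeAngle y (2 * Real.pi)) :
    ∃ (a : Fin 3 → Y) (b : Module.Basis (Fin 3) ℝ (ℝ × ℂ)), (∀ i, a i ∈ N) ∧
      ∀ i, b i = D (a i) := by
  obtain ⟨ρ, e, hc⟩ := hasConeAngle_iff.1 hy
  obtain ⟨ε, hε, hball⟩ := Metric.mem_nhds_iff.1 hN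
  set r := min ρ ε / 2 with hr
  have hm : 0 < min ρ ε := lt_min hc.2.1 hε
  have hr0 : 0 < r := by positivity
  have hrρ : r ∈ Ico 0 ρ := ⟨hr0.le, by linarith [min_le_left ρ ε]⟩
  have hrN : ∀ θ, e r θ ∈ N := fun θ => hball (by
    rw [Metric.mem_ball, hc.dist_apex hrρ]; linarith [min_le_right ρ ε])
  have hyN : y ∈ N := mem_of_mem_nhds hN
  -- The point `y` and two points at distance `r` from it in perpendicular directions. With `C =
  -- cosh r > 1` the Gram matrix has entries `C`, `C` and `C ^ 2` off the diagonal and is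
  -- nonsingular.
  set a : Fin 3 → Y := ![y, e r ((0 : ℝ) : AddCircle (2 * Real.pi)),
    e r ((Real.pi / 2 : ℝ) : AddCircle (2 * Real.pi))] with ha
  have haN : ∀ i, a i ∈ N := by
    intro i; fin_cases i
    · exact hyN
    · exact hrN _
    · exact hrN _
  have hC : 1 < Real.cosh r := Real.one_lt_cosh.2 hr0.ne'
  have h01 : ∀ θ, mink (D y) (D (e r θ)) = Real.cosh r := fun θ => by
    rw [h y hyN _ (hrN θ), dist_comm, hc.dist_apex hrρ]
  have h12 : mink (D (a 1)) (D (a 2)) = Real.cosh r ^ 2 := by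
    rw [h _ (haN 1) _ (haN 2)]
    change Real.cosh (dist (e r _) (e r _)) = _
    rw [hc.cosh_dist hrρ hrρ, coneCosh_two_pi, mink_hpt]
    simp [sq]
  have hself : ∀ x ∈ N, mink (D x) (D x) = 1 := fun x hx => by rw [h x hx x hx]; simp
  have hli : LinearIndependent ℝ fun i => D (a i) := by
    rw [Fintype.linearIndependent_iff]
    intro g hg
    rw [Fin.sum_univ_three] at hg
    have e0 : mink (D (a 0)) (g 0 • D (a 0) + g 1 • D (a 1) + g 2 • D (a 2)) = 0 := by
      rw [hg]; simp [mink]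
    have e1 : mink (D (a 1)) (g 0 • D (a 0) + g 1 • D (a 1) + g 2 • D (a 2)) = 0 := by
      rw [hg]; simp [mink]
    have e2 : mink (D (a 2)) (g 0 • D (a 0) + g 1 • D (a 1) + g 2 • D (a 2)) = 0 := by
      rw [hg]; simp [mink]
    have m01 : mink (D (a 0)) (D (a 1)) = Real.cosh r := h01 _
    have m02 : mink (D (a 0)) (D (a 2)) = Real.cosh r := h01 _
    simp only [mink_add_right, mink_smul_right, hself _ (haN _), h12, m01, m02,
      mink_comm (D (a 1)) (D (a 0)), mink_comm (D (a 2)) (D (a 0)),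
      mink_comm (D (a 2)) (D (a 1))] at e0 e1 e2
    set C := Real.cosh r
    have hC2 : 1 - C ^ 2 ≠ 0 := by nlinarith
    have g1 : g 1 = 0 := by
      have : (1 - C ^ 2) * g 1 = 0 := by linear_combination e1 - C * e0
      exact (mul_eq_zero.1 this).resolve_left hC2
    have g2 : g 2 = 0 := by
      have : (1 - C ^ 2) * g 2 = 0 := by linear_combination e2 - C * e0
      exact (mul_eq_zero.1 this).resolve_left hC2
    have g0 : g 0 = 0 := by rw [g1, g2] at e0; linarith
    intro i; fin_cases i <;> assumption
  have hcard : Fintype.card (Fin 3) = Module.finrank ℝ (ℝ × ℂ) := by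
    rw [Module.finrank_prod, Complex.finrank_real_complex]; simp
  exact ⟨a, basisOfLinearIndependentOfCardEqFinrank hli hcard, haN, fun i => by simp⟩

/-- Two isometric maps into the hyperboloid differ by a Lorentz transformation. -/
lemma IsometricOn.exists_transition {D₁ D₂ : Y → ℝ × ℂ} {N : Set Y} {y : Y}
    (h₁ : IsometricOn D₁ N) (h₂ : IsometricOn D₂ N) (hN : N ∈ nhds y)
    (hy : HasConeAngle y (2 * Real.pi)) :
    ∃ M : (ℝ × ℂ) →ₗ[ℝ] (ℝ × ℂ), (∀ u v, mink (M u) (M v) = mink u v) ∧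
      ∀ a ∈ N, D₂ a = M (D₁ a) := by
  obtain ⟨a, b, haN, hb⟩ := h₁.exists_basis hN hy
  set M := b.constr ℝ fun i => D₂ (a i) with hM
  have hMb : ∀ i, M (b i) = D₂ (a i) := fun i => by rw [hM, Module.Basis.constr_basis]
  have hpres : ∀ u v, mink (M u) (M v) = mink u v := by
    intro u v
    have : minkForm.compl₁₂ M M = minkForm := by
      refine b.ext fun i => b.ext fun j => ?_
      simp only [LinearMap.compl₁₂_apply, minkForm_apply, hMb]
      rw [h₂ _ (haN i) _ (haN j), hb, hb, h₁ _ (haN i) _ (haN j)]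
    exact LinearMap.congr_fun₂ this u v
  refine ⟨M, hpres, fun x hx => ?_⟩
  have hsurj : Function.Surjective M := by
    have hinj : Function.Injective M := by
      rw [injective_iff_map_eq_zero]
      intro u hu
      refine eq_zero_of_forall_mink u fun v => ?_
      rw [← hpres, hu]; simp [mink]
    exact (LinearMap.injective_iff_surjective).1 hinj
  rw [← sub_eq_zero]
  refine eq_zero_of_forall_mink _ fun v => ?_
  obtain ⟨w, rfl⟩ := hsurj v
  have : (minkForm (D₂ x - M (D₁ x))).comp M = 0 := by
    refine b.ext fun i => ?_
    simp only [LinearMap.comp_apply, minkForm_apply, mink_sub_left, LinearMap.zero_apply]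
    rw [hpres, hMb, hb, h₂ x hx _ (haN i), h₁ x hx _ (haN i), sub_self]
  exact LinearMap.congr_fun this w

/-- Developing maps on two open sets with connected intersection can be glued. -/
lemma IsDevelopment.exists_union {D₁ D₂ : Y → ℝ × ℂ} {A₁ A₂ : Set Y} (h₁ : IsDevelopment D₁ A₁)
    (h₂ : IsDevelopment D₂ A₂) (o₁ : IsOpen A₁) (o₂ : IsOpen A₂)
    (hc : IsPreconnected (A₁ ∩ A₂)) (hs : ∀ y ∈ A₁ ∩ A₂, HasConeAngle y (2 * Real.pi)) :
    ∃ D, IsDevelopment D (A₁ ∪ A₂) := by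
  classical
  have hM : ∃ M : (ℝ × ℂ) →ₗ[ℝ] (ℝ × ℂ), (∀ u v, mink (M u) (M v) = mink u v) ∧
      ∀ a ∈ A₁ ∩ A₂, D₂ a = M (D₁ a) := by
    rcases (A₁ ∩ A₂).eq_empty_or_nonempty with h0 | ⟨y₀, hy₀⟩
    · exact ⟨LinearMap.id, fun _ _ => rfl, by rw [h0]; simp⟩
    have loc : ∀ y ∈ A₁ ∩ A₂, ∃ M : (ℝ × ℂ) →ₗ[ℝ] (ℝ × ℂ),
        (∀ u v, mink (M u) (M v) = mink u v) ∧ ∀ᶠ a in nhds y, D₂ a = M (D₁ a) := by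
      intro y hy
      obtain ⟨N₁, hN₁, i₁⟩ := h₁ y hy.1
      obtain ⟨N₂, hN₂, i₂⟩ := h₂ y hy.2
      obtain ⟨M, hM, hM'⟩ := (i₁.mono inter_subset_left).exists_transition
        (i₂.mono inter_subset_right) (Filter.inter_mem hN₁ hN₂) (hs y hy)
      exact ⟨M, hM, Filter.mem_of_superset (Filter.inter_mem hN₁ hN₂) hM'⟩
    -- The values of `D₁` near any point contain a basis, so the local transition map is unique. It
    -- is therefore locally constant, hence constant on the connected overlap.
    have uniq : ∀ y ∈ A₁ ∩ A₂, ∀ M M' : (ℝ × ℂ) →ₗ[ℝ] (ℝ × ℂ),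
        (∀ᶠ a in nhds y, D₂ a = M (D₁ a)) → (∀ᶠ a in nhds y, D₂ a = M' (D₁ a)) → M = M' := by
      intro y hy M M' hM hM'
      obtain ⟨N₁, hN₁, i₁⟩ := h₁ y hy.1
      have hN : N₁ ∩ {a | D₂ a = M (D₁ a) ∧ D₂ a = M' (D₁ a)} ∈ nhds y :=
        Filter.inter_mem hN₁ (hM.and hM')
      obtain ⟨a, b, ha, hb⟩ := (i₁.mono inter_subset_left).exists_basis hN (hs y hy)
      refine b.ext fun i => ?_
      rw [hb, ← (ha i).2.1, ← (ha i).2.2]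
    obtain ⟨M, hM, hM'⟩ := loc y₀ hy₀
    refine ⟨M, hM, ?_⟩
    have hsub := hc.subset_left_of_subset_union
      (u := (A₁ ∩ A₂) ∩ {y | ∀ᶠ a in nhds y, D₂ a = M (D₁ a)})
      (v := (A₁ ∩ A₂) ∩ ⋃ M' ∈ {M' | M' ≠ M}, {y | ∀ᶠ a in nhds y, D₂ a = M' (D₁ a)})
      ((o₁.inter o₂).inter isOpen_setOfPred_eventually_nhds)
      ((o₁.inter o₂).inter (isOpen_biUnion fun _ _ => isOpen_setOfPred_eventually_nhds)) ?_ ?_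
      ⟨y₀, hy₀, hy₀, hM'⟩
    · exact fun a ha => (hsub ha).2.self_of_nhds
    · rw [Set.disjoint_left]
      rintro y ⟨hy, h1⟩ ⟨-, h2⟩
      obtain ⟨M', hne, h3⟩ := mem_iUnion₂.1 h2
      exact hne (uniq y hy _ _ h3 h1)
    · intro y hy
      obtain ⟨M', -, h3⟩ := loc y hy
      by_cases he : M' = M
      · left; exact ⟨hy, he ▸ h3⟩
      · right; exact ⟨hy, mem_iUnion₂.2 ⟨M', he, h3⟩⟩
  obtain ⟨M, hM, hM'⟩ := hM
  refine ⟨fun a => if a ∈ A₁ then M (D₁ a) else D₂ a, ?_⟩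
  rintro y (hy | hy)
  · obtain ⟨N, hN, hi⟩ := h₁ y hy
    refine ⟨N ∩ A₁, Filter.inter_mem hN (o₁.mem_nhds hy), ?_⟩
    rintro a ⟨ha, ha'⟩ b ⟨hb, hb'⟩
    dsimp only
    rw [if_pos ha', if_pos hb', hM, hi a ha b hb]
  · obtain ⟨N, hN, hi⟩ := h₂ y hy
    have e : ∀ a ∈ A₂, (if a ∈ A₁ then M (D₁ a) else D₂ a) = D₂ a := by
      intro a ha
      split_ifs with h
      · exact (hM' a ⟨h, ha⟩).symm
      · rfl
    refine ⟨N ∩ A₂, Filter.inter_mem hN (o₂.mem_nhds hy), ?_⟩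
    rintro a ⟨ha, ha'⟩ b ⟨hb, hb'⟩
    dsimp only
    rw [e a ha', e b hb', hi a ha b hb]

/-- A developing map is isometric along geodesics. -/
lemma IsDevelopment.mink_eq [CompactSpace Y] (hI : IsIntrinsic Y) {D : Y → ℝ × ℂ} {A C : Set Y}
    (h : IsDevelopment D A) (hC : IsCompact C) (hCA : C ⊆ A) {x y : Y}
    (hxy : ∀ z, dist x z ≤ dist x y → z ∈ C) : mink (D x) (D y) = Real.cosh (dist x y) := by
  choose! N hN hi using h
  obtain ⟨μ, hμ, H⟩ := lebesgue_number_lemma_of_metric hC (c := fun a : A => interior (N a))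
    (fun _ => isOpen_interior)
    (fun a ha => mem_iUnion.2 ⟨⟨a, hCA ha⟩, mem_interior_iff_mem_nhds.2 (hN a (hCA ha))⟩)
  obtain ⟨k, hk⟩ := pow_unbounded_of_one_lt (dist x y / μ) one_lt_two
  obtain ⟨z, z0, z1, hz⟩ := exists_geodesic_chain hI k x y
  set δ := dist x y / 2 ^ k with hδ
  have hp : (0 : ℝ) < 2 ^ k := by positivity
  have hδμ : δ < μ := by
    rw [hδ, div_lt_iff₀ hp, mul_comm]; rwa [div_lt_iff₀ hμ] at hk
  have htot : ((2 ^ k : ℕ) : ℝ) * δ = dist x y := by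
    rw [hδ]; push_cast; field_simp
  -- The steps add up to at most `dist x y`, so the triangle inequality leaves no slack and all
  -- distances within the chain are exact.
  have hexact : ∀ i j, i ≤ j → j ≤ 2 ^ k → dist (z i) (z j) = (j - i) * δ := by
    intro i j hij hj
    refine le_antisymm (dist_chain_le hz hij hj) ?_
    have h1 := dist_chain_le hz (Nat.zero_le i) (hij.trans hj)
    have h2 := dist_chain_le hz hj le_rfl
    have h3 := dist_triangle4 (z 0) (z i) (z j) (z (2 ^ k))
    rw [z0, z1] at h3
    rw [z0] at h1
    rw [z1] at h2
    push_cast at htot h1 h2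
    linarith
  have hzC : ∀ i ≤ 2 ^ k, z i ∈ C := by
    intro i hi
    refine hxy _ ?_
    rw [← z0, ← z1, hexact 0 i (Nat.zero_le _) hi, hexact 0 _ (Nat.zero_le _) le_rfl]
    have : (i : ℝ) ≤ ((2 ^ k : ℕ) : ℝ) := by exact_mod_cast hi
    have hδ0 : 0 ≤ δ := by positivity
    nlinarith
  have hloc : ∀ c ∈ C, ∀ a b, dist a c < μ → dist b c < μ →
      mink (D a) (D b) = Real.cosh (dist a b) := by
    intro c hc a b ha hb
    obtain ⟨i, hi'⟩ := H c hc
    exact hi i i.2 a (interior_subset (hi' ha)) b (interior_subset (hi' hb))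
  have hδ0 : 0 ≤ δ := by positivity
  -- Three consecutive points of the chain lie within `δ < μ` of the middle one, where `D` is
  -- isometric; so the middle image is the midpoint of its neighbours.
  have hfin := mink_chain (z := fun i => D (z i)) (a := δ) (N := 2 ^ k) ?_ ?_ ?_ (2 ^ k) le_rfl
  · simp only [z0, z1] at hfin
    rw [hfin, htot]
  · intro i hii
    rw [hloc _ (hzC i hii) _ _ (by simpa using hμ) (by simpa using hμ)]; simp
  · intro i hii
    have e := hexact i (i + 1) (by omega) hii
    push_cast at e
    rw [hloc _ (hzC i hii.le) _ _ (by simpa using hμ) (by rw [dist_comm, e]; linarith), e]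
    congr 1; ring
  · intro i hii
    have e := hexact i (i + 2) (by omega) hii
    have e1 := hexact i (i + 1) (by omega) (by omega)
    have e2 := hexact (i + 1) (i + 2) (by omega) (by omega)
    push_cast at e e1 e2
    rw [hloc _ (hzC (i + 1) (by omega)) _ _ (by rw [e1]; linarith)
      (by rw [dist_comm, e2]; linarith), e]
    congr 1; ring

end Development

universe u

/-! ### Development of discs around a point -/

section Disc

variable {X : Type*} [MetricSpace X]

/-- A cone ball is the injective continuous image of a disc. -/
lemma IsConeChart.exists_disc {p : X} {κ ρ : ℝ} {e : ℝ → AddCircle κ → X}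
    (h : IsConeChart p κ ρ e) : ∃ Q : ℂ → X, ContinuousOn Q (Metric.ball 0 ρ) ∧
      InjOn Q (Metric.ball 0 ρ) ∧ (∀ w ∈ Metric.ball (0 : ℂ) ρ, dist (Q w) p = ‖w‖) ∧
      ∀ x ∈ Metric.ball p ρ, ∃ w ∈ Metric.ball (0 : ℂ) ρ, Q w = x := by
  -- Angles are rescaled from `2π` to `κ`. This distorts the metric, but only continuity and
  -- injectivity of the disc are wanted.
  set φ := AddCircle.homeomorphAddCircle (2 * Real.pi) κ Real.two_pi_pos.ne' h.1.ne' with hφ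
  set Θ : ℂ → AddCircle κ := fun w => φ ((Complex.arg w : ℝ) : AddCircle (2 * Real.pi)) with hΘ
  have hmem : ∀ w ∈ Metric.ball (0 : ℂ) ρ, ‖w‖ ∈ Ico 0 ρ := fun w hw =>
    ⟨norm_nonneg _, by simpa using hw⟩
  have hdist : ∀ w ∈ Metric.ball (0 : ℂ) ρ, dist (e ‖w‖ (Θ w)) p = ‖w‖ := fun w hw =>
    h.dist_apex (hmem w hw) _
  refine ⟨fun w => e ‖w‖ (Θ w), ?_, ?_, hdist, ?_⟩
  · intro w₀ hw₀
    rw [ContinuousWithinAt, tendsto_iff_dist_tendsto_zero]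
    rcases eq_or_ne w₀ 0 with rfl | hne
    · have h1 : e ‖(0 : ℂ)‖ (Θ 0) = p := by rw [norm_zero, h.2.2.1]
      have h2 : Filter.Tendsto (fun w : ℂ => ‖w‖) (nhdsWithin 0 (Metric.ball 0 ρ)) (nhds 0) := by
        have : Continuous fun w : ℂ => ‖w‖ := continuous_norm
        simpa using (this.tendsto 0).mono_left nhdsWithin_le_nhds
      refine h2.congr' ?_
      filter_upwards [self_mem_nhdsWithin] with w hw
      rw [h1, hdist w hw]
    · have hcont : ContinuousAt Θ w₀ :=
        φ.continuous.continuousAt.comp (Complex.continuousAt_arg_coe_angle hne)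
      have h1 : ContinuousAt (fun w => coneCosh κ ‖w‖ (Θ w) ‖w₀‖ (Θ w₀)) w₀ := by
        unfold coneCosh
        have : ContinuousAt (fun w => min ‖Θ w - Θ w₀‖ Real.pi) w₀ :=
          ((hcont.sub continuousAt_const).norm).min continuousAt_const
        have h3 : ContinuousAt (fun w => Real.cos (min ‖Θ w - Θ w₀‖ Real.pi)) w₀ :=
          Real.continuous_cos.continuousAt.comp this
        fun_prop
      have h2 : ContinuousAt (fun w => Real.arcosh (max 1 (coneCosh κ ‖w‖ (Θ w) ‖w₀‖ (Θ w₀)))) w₀ := by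
        have hc : Continuous fun x : ℝ => Real.arcosh (max 1 x) :=
          Real.continuousOn_arcosh.comp_continuous (by fun_prop) fun x => mem_Ici.2 (le_max_left _ _)
        exact hc.continuousAt.comp h1
      have h3 := h2.tendsto.mono_left (nhdsWithin_le_nhds (s := Metric.ball 0 ρ))
      rw [coneCosh_self_angle, sub_self, Real.cosh_zero, max_self, Real.arcosh_zero] at h3
      refine h3.congr' ?_
      filter_upwards [self_mem_nhdsWithin] with w hw
      rw [← h.cosh_dist (hmem w hw) (hmem w₀ hw₀), max_eq_right (Real.one_le_cosh _),
        Real.arcosh_cosh dist_nonneg]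
  · intro w hw w' hw' heq
    have hn : ‖w‖ = ‖w'‖ := by rw [← hdist w hw, ← hdist w' hw']; exact congrArg (dist · p) heq
    have h1 := h.cosh_dist (hmem w hw) (hmem w' hw') (Θ w) (Θ w')
    have heq' : e ‖w‖ (Θ w) = e ‖w'‖ (Θ w') := heq
    rw [heq', dist_self, Real.cosh_zero] at h1
    obtain ⟨-, h2 | h2⟩ := coneCosh_eq_one (norm_nonneg _) (norm_nonneg _) h1.symm
    · rw [norm_eq_zero.1 h2, eq_comm, ← norm_eq_zero, ← hn, h2]
    · have h3 := φ.injective h2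
      exact Complex.ext_norm_arg hn (Complex.arg_coe_angle_eq_iff.1 h3)
  · intro x hx
    obtain ⟨θ, hθ⟩ := h.exists_polar hx
    rcases (dist_nonneg (x := x) (y := p)).eq_or_lt with h0 | h0
    · refine ⟨0, by simpa using h.2.1, ?_⟩
      dsimp only
      rw [norm_zero, h.2.2.1, eq_comm, ← dist_eq_zero, ← h0]
    · obtain ⟨α, rfl⟩ := φ.surjective θ
      set w : ℂ := (dist x p : ℝ) * (Real.Angle.cos α + Real.Angle.sin α * Complex.I) with hw
      have hα : ((Complex.arg w : ℝ) : Real.Angle) = α :=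
        Complex.arg_mul_cos_add_sin_mul_I_coe_angle h0 α
      have hnw : ‖w‖ = dist x p := by
        have h4 : ‖((Real.Angle.cos α : ℂ) + Real.Angle.sin α * Complex.I)‖ = 1 := by
          induction α using Real.Angle.induction_on with
          | _ a =>
            rw [Real.Angle.cos_coe, Real.Angle.sin_coe, Complex.ofReal_cos, Complex.ofReal_sin,
              Complex.norm_cos_add_sin_mul_I]
        rw [hw, norm_mul, h4, mul_one, Complex.norm_real, Real.norm_of_nonneg h0.le]
      refine ⟨w, by rw [mem_ball_zero_iff, hnw]; exact hx, ?_⟩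
      dsimp only
      rw [hnw]
      exact (congrArg (e _) (congrArg φ hα)).trans hθ

end Disc

/-- An induction on intervals: a property of small intervals that passes from overlapping
intervals to their union holds for all intervals. -/
lemma interval_induction {P : ℝ → ℝ → Prop} {l u μ : ℝ} (hμ : 0 < μ)
    (small : ∀ a b, l ≤ a → b ≤ u → b - a ≤ 2 * μ → P a b)
    (glue : ∀ a a' b' b, l ≤ a → a ≤ a' → a' < b' → b' ≤ b → b ≤ u → P a b' → P a' b → P a b) :
    P l u := by
  have key : ∀ n : ℕ, ∀ b ≤ u, b - l ≤ n * μ → P l b := by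
    intro n
    induction n with
    | zero =>
      intro b hb h
      exact small l b le_rfl hb (by simp at h; linarith)
    | succ n ih =>
      intro b hb h
      rcases le_or_gt (b - l) (2 * μ) with h1 | h1
      · exact small l b le_rfl hb h1
      · refine glue l (b - 2 * μ) (b - μ) b le_rfl (by linarith) (by linarith) (by linarith) hb
          (ih _ (by linarith) ?_) (small _ _ (by linarith) hb (by linarith))
        push_cast at h
        linarith
  obtain ⟨n, hn⟩ := exists_nat_gt ((u - l) / μ)
  exact key n u le_rfl (by rw [div_lt_iff₀ hμ] at hn; exact hn.le)

section Square

variable {Y : Type*} [MetricSpace Y]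

/-- A developing map exists on the image of a square. -/
lemma exists_development_square {F : ℂ → Y} {ρ : ℝ} (hρ : 0 < ρ)
    (hF : ContinuousOn F (Metric.ball 0 ρ)) (hinj : InjOn F (Metric.ball 0 ρ))
    (hopen : ∀ R : Set ℂ, IsOpen R → R ⊆ Metric.ball 0 (3 / 4 * ρ) → IsOpen (F '' R))
    (hs : ∀ w ∈ Metric.ball (0 : ℂ) ρ, HasConeAngle (F w) (2 * Real.pi)) :
    ∃ D, IsDevelopment D (F '' (Ioo (-(ρ / 2)) (ρ / 2) ×ℂ Ioo (-(ρ / 2)) (ρ / 2))) := by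
  set σ := ρ / 2 with hσ
  -- The half-diagonal `ρ / √2` of the square is less than `3 / 4 * ρ`, so the square lies where
  -- images of open sets are known to be open.
  have hK : ∀ w : ℂ, w ∈ Icc (-σ) σ ×ℂ Icc (-σ) σ → ‖w‖ < 3 / 4 * ρ := by
    intro w hw
    rw [Complex.mem_reProdIm] at hw
    have h1 : w.re ^ 2 ≤ σ ^ 2 := sq_le_sq' hw.1.1 hw.1.2
    have h2 : w.im ^ 2 ≤ σ ^ 2 := sq_le_sq' hw.2.1 hw.2.2
    have h3 : ‖w‖ ^ 2 < (3 / 4 * ρ) ^ 2 := by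
      rw [← Complex.normSq_eq_norm_sq, Complex.normSq_apply]
      nlinarith
    exact lt_of_pow_lt_pow_left₀ 2 (by positivity) h3
  have hsubK : ∀ a b c d : ℝ, -σ ≤ a → b ≤ σ → -σ ≤ c → d ≤ σ →
      Ioo a b ×ℂ Ioo c d ⊆ Icc (-σ) σ ×ℂ Icc (-σ) σ := by
    intro a b c d ha hb hc hd w hw
    rw [Complex.mem_reProdIm] at hw ⊢
    exact ⟨⟨ha.trans hw.1.1.le, hw.1.2.le.trans hb⟩, ⟨hc.trans hw.2.1.le, hw.2.2.le.trans hd⟩⟩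
  have hball : Metric.ball (0 : ℂ) (3 / 4 * ρ) ⊆ Metric.ball 0 ρ :=
    Metric.ball_subset_ball (by linarith)
  have hKb : Icc (-σ) σ ×ℂ Icc (-σ) σ ⊆ Metric.ball (0 : ℂ) (3 / 4 * ρ) := fun w hw => by
    rw [mem_ball_zero_iff]; exact hK w hw
  have hcomp : IsCompact (Icc (-σ) σ ×ℂ Icc (-σ) σ) := isCompact_Icc.reProdIm isCompact_Icc
  choose! A hAo hAm D hD using fun w (hw : w ∈ Metric.ball (0 : ℂ) ρ) => exists_isDevelopment (hs w hw)
  obtain ⟨μ, hμ, H⟩ := lebesgue_number_lemma_of_metric hcomp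
    (c := fun w : Metric.ball (0 : ℂ) ρ => Metric.ball 0 ρ ∩ F ⁻¹' A w)
    (fun w => hF.isOpen_inter_preimage Metric.isOpen_ball (hAo w w.2))
    (fun w hw => mem_iUnion.2 ⟨⟨w, hball (hKb hw)⟩, hball (hKb hw), hAm w (hball (hKb hw))⟩)
  set P : Set ℂ → Prop := fun R => ∃ D, IsDevelopment D (F '' R) with hP
  have hsmall : ∀ a b c d : ℝ, -σ ≤ a → b ≤ σ → -σ ≤ c → d ≤ σ → b - a ≤ μ / 2 →
      d - c ≤ μ / 2 → P (Ioo a b ×ℂ Ioo c d) := by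
    intro a b c d ha hb hc hd h1 h2
    rcases (Ioo a b ×ℂ Ioo c d).eq_empty_or_nonempty with h0 | ⟨w, hw⟩
    · refine ⟨fun _ => 0, ?_⟩
      rw [h0, image_empty]
      exact fun y hy => absurd hy (notMem_empty y)
    · obtain ⟨i, hi⟩ := H w (hsubK a b c d ha hb hc hd hw)
      refine ⟨D i, (hD i i.2).mono ?_⟩
      rintro _ ⟨v, hv, rfl⟩
      refine (hi ?_).2
      rw [Metric.mem_ball, dist_eq_norm]
      rw [Complex.mem_reProdIm] at hv hw
      refine (Complex.norm_le_abs_re_add_abs_im _).trans_lt ?_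
      rw [Complex.sub_re, Complex.sub_im]
      have e1 : |v.re - w.re| < μ / 2 := by
        rw [abs_lt]; constructor <;> linarith [hv.1.1, hv.1.2, hw.1.1, hw.1.2]
      have e2 : |v.im - w.im| < μ / 2 := by
        rw [abs_lt]; constructor <;> linarith [hv.2.1, hv.2.2, hw.2.1, hw.2.2]
      linarith
  have hopenR : ∀ a b c d : ℝ, IsOpen (Ioo a b ×ℂ Ioo c d) := fun a b c d =>
    isOpen_Ioo.reProdIm isOpen_Ioo
  have hconvR : ∀ a b c d : ℝ, Convex ℝ (Ioo a b ×ℂ Ioo c d) := fun a b c d =>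
    ((convex_Ioo a b).linear_preimage Complex.reLm).inter
      ((convex_Ioo c d).linear_preimage Complex.imLm)
  have hglue : ∀ a b c d a₁ b₁ c₁ d₁ a₂ b₂ c₂ d₂ : ℝ,
      -σ ≤ a → b ≤ σ → -σ ≤ c → d ≤ σ → Ioo a₁ b₁ ×ℂ Ioo c₁ d₁ ∪ Ioo a₂ b₂ ×ℂ Ioo c₂ d₂ =
        Ioo a b ×ℂ Ioo c d → P (Ioo a₁ b₁ ×ℂ Ioo c₁ d₁) → P (Ioo a₂ b₂ ×ℂ Ioo c₂ d₂) →
        P (Ioo a b ×ℂ Ioo c d) := by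
    rintro a b c d a₁ b₁ c₁ d₁ a₂ b₂ c₂ d₂ ha hb hc hd hU ⟨D₁, h₁⟩ ⟨D₂, h₂⟩
    have hsub : Ioo a b ×ℂ Ioo c d ⊆ Metric.ball 0 (3 / 4 * ρ) :=
      (hsubK a b c d ha hb hc hd).trans hKb
    have s₁ := (subset_union_left.trans hU.subset).trans hsub
    have s₂ := (subset_union_right.trans hU.subset).trans hsub
    -- By injectivity the overlap of the images is the image of an intersection of rectangles, which
    -- is convex and hence connected.
    have hint : F '' (Ioo a₁ b₁ ×ℂ Ioo c₁ d₁) ∩ F '' (Ioo a₂ b₂ ×ℂ Ioo c₂ d₂) =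
        F '' (Ioo a₁ b₁ ×ℂ Ioo c₁ d₁ ∩ Ioo a₂ b₂ ×ℂ Ioo c₂ d₂) :=
      (hinj.image_inter (s₁.trans hball) (s₂.trans hball)).symm
    have := h₁.exists_union h₂ (hopen _ (hopenR _ _ _ _) s₁) (hopen _ (hopenR _ _ _ _) s₂) ?_ ?_
    · rwa [← image_union, hU] at this
    · rw [hint]
      exact ((hconvR _ _ _ _).inter (hconvR _ _ _ _)).isPreconnected.image _
        (hF.mono (inter_subset_left.trans (s₁.trans hball)))
    · rintro y ⟨⟨w, hw, rfl⟩, -⟩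
      exact hs w (hball (s₁ hw))
  have hIoo : ∀ a a' b' b : ℝ, a ≤ a' → a' < b' → b' ≤ b → Ioo a b' ∪ Ioo a' b = Ioo a b := by
    intro a a' b' b h1 h2 h3
    ext x
    simp only [mem_union, mem_Ioo]
    constructor
    · rintro (h | h)
      · exact ⟨h.1, h.2.trans_le h3⟩
      · exact ⟨h1.trans_lt h.1, h.2⟩
    · rintro h
      rcases lt_or_ge x b' with h4 | h4
      · exact Or.inl ⟨h.1, h4⟩
      · exact Or.inr ⟨h2.trans_le h4, h.2⟩
  -- Small rectangles are assembled into thin strips, and the strips into the square.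
  refine interval_induction (P := fun c d => P (Ioo (-σ) σ ×ℂ Ioo c d)) (μ := μ / 4)
    (by positivity) ?_ ?_
  · intro c d hc hd hcd
    refine interval_induction (P := fun a b => P (Ioo a b ×ℂ Ioo c d)) (μ := μ / 4)
      (by positivity) ?_ ?_
    · intro a b ha hb hab
      exact hsmall a b c d ha hb hc hd (by linarith) (by linarith)
    · intro a a' b' b ha h1 h2 h3 hb p1 p2
      refine hglue a b c d _ _ _ _ _ _ _ _ ha hb hc hd ?_ p1 p2
      rw [← hIoo a a' b' b h1 h2 h3]
      ext w; simp only [mem_union, Complex.mem_reProdIm]; tauto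
  · intro a a' b' b ha h1 h2 h3 hb p1 p2
    refine hglue (-σ) σ a b _ _ _ _ _ _ _ _ le_rfl le_rfl ha hb ?_ p1 p2
    rw [← hIoo a a' b' b h1 h2 h3]
    ext w; simp only [mem_union, Complex.mem_reProdIm]; tauto

end Square

/-! ### Gram determinants and the stability of cone-points -/

/-- Four points on the hyperboloid have a degenerate Gram matrix. -/
lemma det_mink_eq_zero (v : Fin 4 → ℝ × ℂ) :
    (Matrix.of fun i j => mink (v i) (v j)).det = 0 := by
  have hdep : ¬ LinearIndependent ℝ v := by
    intro h
    have := h.fintype_card_le_finrank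
    rw [Module.finrank_prod, Complex.finrank_real_complex] at this
    simp at this
  rw [Fintype.not_linearIndependent_iff] at hdep
  obtain ⟨g, hg, i, hi⟩ := hdep
  rw [← Matrix.exists_mulVec_eq_zero_iff]
  refine ⟨g, fun h => hi (congrFun h i), ?_⟩
  ext i
  have : minkForm (v i) (∑ j, g j • v j) = 0 := by rw [hg, map_zero]
  rw [map_sum] at this
  simp only [Matrix.mulVec, dotProduct, Matrix.of_apply, Pi.zero_apply]
  rw [← this]
  refine Finset.sum_congr rfl fun j _ => ?_
  rw [map_smul, minkForm_apply, smul_eq_mul, mul_comm]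

/-- The apex and three equidistributed points of a cone with angle less than `2π` do not embed
into the hyperbolic plane. -/
lemma IsConeChart.exists_four_points {X : Type*} [MetricSpace X] {p : X} {κ ρ : ℝ}
    {e : ℝ → AddCircle κ → X} (h : IsConeChart p κ ρ e) (hκ : κ < 2 * Real.pi) {t : ℝ}
    (ht : t ∈ Ioo 0 ρ) : ∃ v : Fin 4 → X, (∀ i, dist (v i) p ≤ t) ∧
      (Matrix.of fun i j => Real.cosh (dist (v i) (v j))).det ≠ 0 := by
  have ht' : t ∈ Ico 0 ρ := ⟨ht.1.le, ht.2⟩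
  have hκ0 := h.1
  set x : ℝ → X := fun a => e t (a : AddCircle κ) with hx
  have hp : ∀ a, dist (x a) p = t := fun a => h.dist_apex ht' _
  set C := Real.cosh t with hC
  set E := Real.cosh t * Real.cosh t - Real.sinh t * Real.sinh t * Real.cos (κ / 3) with hE
  have hxx : ∀ a b, |a - b| = κ / 3 → Real.cosh (dist (x a) (x b)) = E := by
    intro a b hab
    rw [h.cosh_dist ht' ht', coneCosh_coe hκ0 _ _ (by rw [hab]; linarith) (by rw [hab]; linarith),
      mink_hpt, ← Real.cos_abs (a - b), hab]
  have h1 : Real.cosh (dist (x (-(κ / 3))) (x 0)) = E := hxx _ _ (by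
    rw [sub_zero, abs_neg, abs_of_pos (by positivity)])
  have h2 : Real.cosh (dist (x 0) (x (κ / 3))) = E := hxx _ _ (by
    rw [zero_sub, abs_neg, abs_of_pos (by positivity)])
  -- The angles `-κ/3` and `κ/3` are `2κ/3` apart on the line, but `κ/3` apart the other way around
  -- the circle.
  have h3 : Real.cosh (dist (x (-(κ / 3))) (x (κ / 3))) = E := by
    have : x (-(κ / 3)) = x (-(κ / 3) + κ) := by
      simp only [hx, AddCircle.coe_add_period]
    rw [this]
    refine hxx _ _ ?_
    rw [show -(κ / 3) + κ - κ / 3 = κ / 3 by ring, abs_of_pos (by positivity)]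
  refine ⟨![p, x (-(κ / 3)), x 0, x (κ / 3)], ?_, ?_⟩
  · intro i
    fin_cases i
    · simpa using ht.1.le
    · exact (hp _).le
    · exact (hp _).le
    · exact (hp _).le
  · have hM : (Matrix.of fun i j => Real.cosh (dist ((![p, x (-(κ / 3)), x 0, x (κ / 3)] : Fin 4 → X) i)
        ((![p, x (-(κ / 3)), x 0, x (κ / 3)] : Fin 4 → X) j))) =
        !![1, C, C, C; C, 1, E, E; C, E, 1, E; C, E, E, 1] := by
      have q1 : ∀ a, Real.cosh (dist (x a) p) = C := fun a => by rw [hp]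
      have q2 : ∀ a, Real.cosh (dist p (x a)) = C := fun a => by rw [dist_comm, hp]
      have h1' : Real.cosh (dist (x 0) (x (-(κ / 3)))) = E := by rw [dist_comm, h1]
      have h2' : Real.cosh (dist (x (κ / 3)) (x 0)) = E := by rw [dist_comm, h2]
      have h3' : Real.cosh (dist (x (κ / 3)) (x (-(κ / 3)))) = E := by rw [dist_comm, h3]
      ext i j
      fin_cases i <;> fin_cases j <;>
        simp [q1, q2, h1, h2, h3, h1', h2', h3']
    rw [hM]
    have hdet : (!![1, C, C, C; C, 1, E, E; C, E, 1, E; C, E, E, 1] :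
        Matrix (Fin 4) (Fin 4) ℝ).det = (1 - E) ^ 2 * (1 + 2 * E - 3 * C ^ 2) := by
      simp [Matrix.det_succ_row_zero, Fin.sum_univ_succ, Fin.succAbove]
      ring
    rw [hdet]
    have hs : 0 < Real.sinh t := Real.sinh_pos_iff.2 ht.1
    have hc := Real.cosh_sq t
    have c1 : Real.cos (κ / 3) < 1 := by
      rw [← Real.cos_zero]
      exact Real.cos_lt_cos_of_nonneg_of_le_pi le_rfl (by linarith) (by positivity)
    have c2 : -(1 / 2) < Real.cos (κ / 3) := by
      have e1 : Real.cos (2 * Real.pi / 3) = -(1 / 2) := by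
        rw [show 2 * Real.pi / 3 = Real.pi - Real.pi / 3 by ring, Real.cos_pi_sub,
          Real.cos_pi_div_three]
      rw [← e1]
      exact Real.cos_lt_cos_of_nonneg_of_le_pi (by positivity) (by linarith [Real.pi_pos])
        (by linarith)
    -- The decisive factor is `1 + 2 * cos (κ / 3)`, which vanishes for `κ = 2π` and is positive for
    -- smaller angles.
    have g1 : 1 - E = - (Real.sinh t ^ 2 * (1 - Real.cos (κ / 3))) := by
      rw [hE]; linear_combination -hc
    have g2 : 1 + 2 * E - 3 * C ^ 2 = - (Real.sinh t ^ 2 * (1 + 2 * Real.cos (κ / 3))) := by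
      rw [hE, hC]; linear_combination -hc
    rw [g1, g2]
    have g3 : 0 < Real.sinh t ^ 2 * (1 - Real.cos (κ / 3)) := mul_pos (by positivity) (by linarith)
    have g4 : 0 < Real.sinh t ^ 2 * (1 + 2 * Real.cos (κ / 3)) :=
      mul_pos (by positivity) (by linarith)
    exact mul_ne_zero (pow_ne_zero 2 (neg_ne_zero.2 g3.ne')) (neg_ne_zero.2 g4.ne')

/-- Stability of cone-points: a metric that is close to one with a cone-point of angle less than
`2π` has a cone-point nearby. -/
lemma exists_conePoint_near {X : Type u} [MetricSpace X] {p : X} {κ : ℝ} (hp : HasConeAngle p κ)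
    (hκ : κ < 2 * Real.pi) {τ : ℝ} (hτ : 0 < τ) :
    ∃ K > 1, ∀ (Y : Type u) [MetricSpace Y] [CompactSpace Y] (f : X ≃ₜ Y), IsIntrinsic Y →
      (∀ x x', dist (f x) (f x') ≤ K * dist x x') → (∀ x x', dist x x' ≤ K * dist (f x) (f x')) →
      ∃ v ∈ conePoints Y, dist (f p) v < τ := by
  obtain ⟨ρ₀, e, hc₀⟩ := hasConeAngle_iff.1 hp
  -- As the Lipschitz constant will be at most 2, the image of the ball of radius `ρ ≤ τ / 2` stays
  -- within `τ` of `f p`, where no cone-point is allowed.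
  set ρ := min ρ₀ (τ / 2) with hρdef
  have hρ : 0 < ρ := lt_min hc₀.2.1 (by positivity)
  have hc := hc₀.mono hρ (min_le_left _ _)
  -- The four points have mutual distances at most `2t`, and their images at most `4t`. A ball of
  -- radius `4t` around an image point pulls back to within `8t` of the point, hence within `9t < ρ
  -- / 4` of `p`, so the geodesics between the images stay in the developed region.
  set t := ρ / 40 with ht
  have ht0 : 0 < t := by positivity
  obtain ⟨v, hv, hdet⟩ := hc.exists_four_points hκ (t := t) ⟨ht0, by linarith⟩
  set Φ : (Fin 4 → Fin 4 → ℝ) → ℝ := fun d => (Matrix.of fun i j => Real.cosh (d i j)).det with hΦ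
  have hΦc : Continuous Φ := by
    refine Continuous.matrix_det (continuous_matrix fun i j => ?_)
    exact Real.continuous_cosh.comp ((continuous_apply j).comp (continuous_apply i))
  obtain ⟨η, hη, hΦη⟩ := Metric.eventually_nhds_iff.1
    (hΦc.continuousAt.eventually_ne (x := fun i j => dist (v i) (v j)) hdet)
  set ε := min 1 (η / (16 * t)) with hε
  have hε0 : 0 < ε := lt_min one_pos (by positivity)
  have hε1 : ε ≤ 1 := min_le_left _ _
  have hεη : ε * (8 * t) < η := by
    have : ε ≤ η / (16 * t) := min_le_right _ _
    rw [le_div_iff₀ (by positivity)] at this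
    nlinarith
  refine ⟨1 + ε, by linarith, fun Y _ _ f hI hf hf' => ?_⟩
  by_contra hcon
  push Not at hcon
  obtain ⟨Q, hQc, hQi, hQd, hQs⟩ := hc.exists_disc
  have hQmem : ∀ w ∈ Metric.ball (0 : ℂ) ρ, Q w ∈ Metric.ball p ρ := fun w hw => by
    rw [Metric.mem_ball, hQd w hw]; simpa using hw
  obtain ⟨D, hD⟩ := exists_development_square (F := fun w => f (Q w)) hρ
    (f.continuous.comp_continuousOn hQc) (fun w hw w' hw' h => hQi hw hw' (f.injective h)) (by
      intro R hR hsub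
      have hb34 : Metric.closedBall (0 : ℂ) (3 / 4 * ρ) ⊆ Metric.ball 0 ρ :=
        Metric.closedBall_subset_ball (by linarith)
      -- The image of an open set is a ball minus the continuous image of a compact set, hence open.
      have e1 : Q '' R = Metric.ball p (3 / 4 * ρ) \ Q '' (Metric.closedBall 0 (3 / 4 * ρ) \ R) := by
        ext x
        constructor
        · rintro ⟨w, hw, rfl⟩
          have hw1 := hsub hw
          have hw2 := hb34 (Metric.ball_subset_closedBall hw1)
          refine ⟨by rw [Metric.mem_ball, hQd w hw2]; simpa using hw1, ?_⟩
          rintro ⟨w', ⟨hw', hn⟩, he⟩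
          exact hn (hQi (hb34 hw') hw2 he ▸ hw)
        · rintro ⟨hx, hx'⟩
          obtain ⟨w, hw, rfl⟩ := hQs x (Metric.ball_subset_ball (by linarith) hx)
          refine ⟨w, ?_, rfl⟩
          by_contra hn
          refine hx' ⟨w, ⟨?_, hn⟩, rfl⟩
          rw [Metric.mem_ball, hQd w hw] at hx
          simpa using hx.le
      have e2 : IsCompact (Q '' (Metric.closedBall 0 (3 / 4 * ρ) \ R)) :=
        ((isCompact_closedBall _ _).diff hR).image_of_continuousOn (hQc.mono (sdiff_subset.trans hb34))
      rw [show (fun w => f (Q w)) '' R = f '' (Q '' R) by rw [image_image], e1]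
      exact f.isOpenMap _ (Metric.isOpen_ball.sdiff e2.isClosed)) (by
      intro w hw
      by_contra hn
      refine absurd (hcon (f (Q w)) hn) (not_le.2 ?_)
      have h1 := hf p (Q w)
      rw [dist_comm p, hQd w hw] at h1
      have h2 : ‖w‖ < ρ := by simpa using hw
      have h3 : ρ ≤ τ / 2 := min_le_right _ _
      nlinarith [norm_nonneg w])
  have : CompactSpace X := f.symm.compactSpace
  set C := f '' Metric.closedBall p (ρ / 4) with hC
  have hCc : IsCompact C := Metric.isClosed_closedBall.isCompact.image f.continuous
  have hCsub : C ⊆ (fun w => f (Q w)) '' (Ioo (-(ρ / 2)) (ρ / 2) ×ℂ Ioo (-(ρ / 2)) (ρ / 2)) := by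
    rintro _ ⟨x, hx, rfl⟩
    obtain ⟨w, hw, rfl⟩ := hQs x (Metric.closedBall_subset_ball (by linarith) hx)
    refine ⟨w, ?_, rfl⟩
    rw [Metric.mem_closedBall, hQd w hw] at hx
    have h1 := abs_le.1 ((Complex.abs_re_le_norm w).trans hx)
    have h2 := abs_le.1 ((Complex.abs_im_le_norm w).trans hx)
    rw [Complex.mem_reProdIm]
    constructor <;> constructor <;> linarith [h1.1, h1.2, h2.1, h2.2]
  have hvv : ∀ i j, dist (v i) (v j) ≤ 2 * t := fun i j => by
    have := dist_triangle_right (v i) (v j) p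
    linarith [hv i, hv j]
  have hfvv : ∀ i j, dist (f (v i)) (f (v j)) ≤ 4 * t := fun i j => by
    nlinarith [hf (v i) (v j), hvv i j, dist_nonneg (x := v i) (y := v j)]
  have hmink : ∀ i j, mink (D (f (v i))) (D (f (v j))) =
      Real.cosh (dist (f (v i)) (f (v j))) := by
    intro i j
    refine hD.mink_eq hI hCc hCsub fun z hz => ?_
    refine ⟨f.symm z, ?_, f.apply_symm_apply z⟩
    have h1 := hf' (v i) (f.symm z)
    rw [f.apply_symm_apply] at h1
    have h2 := hfvv i j
    have h3 : dist (v i) (f.symm z) ≤ 8 * t := by nlinarith [dist_nonneg (x := f (v i)) (y := z)]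
    have h4 := dist_triangle_left (f.symm z) p (v i)
    rw [Metric.mem_closedBall]
    linarith [hv i]
  -- The determinant is still nonzero at the distances of the images, although these are distances
  -- of four points of the hyperboloid.
  refine hΦη (y := fun i j => dist (f (v i)) (f (v j))) ?_ ?_
  · rw [dist_pi_lt_iff hη]
    intro i
    rw [dist_pi_lt_iff hη]
    intro j
    rw [Real.dist_eq, abs_lt]
    have h1 := hf (v i) (v j)
    have h2 := hf' (v i) (v j)
    constructor <;> nlinarith [hvv i j, hfvv i j, dist_nonneg (x := v i) (y := v j),
      dist_nonneg (x := f (v i)) (y := f (v j))]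
  · have h1 := det_mink_eq_zero fun i => D (f (v i))
    simp only [hmink] at h1
    exact h1

section Distortion

variable {X Y : Type*} [MetricSpace X] [MetricSpace Y]

/-! ### Openness -/

lemma le_exp_mul_of_distortion_le {f : X → Y} (hf : Function.Injective f) {ε : ℝ} (hε : 0 ≤ ε)
    (h : distortion f ≤ ENNReal.ofReal ε) (x x' : X) :
    dist (f x) (f x') ≤ Real.exp ε * dist x x' ∧ dist x x' ≤ Real.exp ε * dist (f x) (f x') := by
  rcases eq_or_ne x x' with rfl | hne
  · simp
  have h1 : ENNReal.ofReal |Real.log (dist (f x) (f x') / dist x x')| ≤ ENNReal.ofReal ε := by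
    refine le_trans ?_ h
    refine le_trans ?_ (le_iSup_of_le x (le_iSup_of_le x' (le_iSup_of_le hne le_rfl)))
    exact le_rfl
  rw [ENNReal.ofReal_le_ofReal_iff hε, abs_le] at h1
  have hd : 0 < dist x x' := dist_pos.2 hne
  have hd' : 0 < dist (f x) (f x') := dist_pos.2 (hf.ne hne)
  constructor
  · have := (Real.log_le_iff_le_exp (div_pos hd' hd)).1 h1.2
    rwa [div_le_iff₀ hd] at this
  · have h2 : Real.log (dist x x' / dist (f x) (f x')) ≤ ε := by
      rw [← inv_div, Real.log_inv]; linarith [h1.1]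
    have := (Real.log_le_iff_le_exp (div_pos hd hd')).1 h2
    rwa [div_le_iff₀ hd'] at this

lemma distortion_le_of_le_mul {f : X → Y} (hf : Function.Injective f) {K : ℝ}
    (h1 : ∀ x x', dist (f x) (f x') ≤ K * dist x x')
    (h2 : ∀ x x', dist x x' ≤ K * dist (f x) (f x')) :
    distortion f ≤ ENNReal.ofReal (Real.log K) := by
  refine iSup_le fun x => iSup_le fun x' => iSup_le fun hne => ENNReal.ofReal_le_ofReal ?_
  have hd : 0 < dist x x' := dist_pos.2 hne
  have hd' : 0 < dist (f x) (f x') := dist_pos.2 (hf.ne hne)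
  rw [abs_le]
  constructor
  · rw [neg_le, ← Real.log_inv, inv_div]
    exact Real.log_le_log (div_pos hd hd') ((div_le_iff₀ hd').2 (h2 x x'))
  · exact Real.log_le_log (div_pos hd' hd) ((div_le_iff₀ hd).2 (h1 x x'))

/-- The systoles of `K`-bi-Lipschitz spaces differ by a factor at most `K`, and `δ` is continuous at
the positive systole of `X`. The form "for all `K > 1` close to 1" allows this condition to be
combined with finitely many others. -/
lemma eventually_lt_systole [CompactSpace X] [ConnectedSpace X] (hS : ¬ SimplyConnectedSpace X)
    (h : ∀ p : X, ∃ κ, HasConeAngle p κ) {δ : ℝ → ℝ} (hδ : ContinuousOn δ (Ioi 0)) {b : ℝ}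
    (hb : b < δ (systole X).toReal) :
    ∀ᶠ K in nhdsWithin (1 : ℝ) (Ioi 1), ∀ (Y : Type*) [MetricSpace Y] (f : X ≃ₜ Y),
      (∀ x x', dist (f x) (f x') ≤ K * dist x x') → (∀ x x', dist x x' ≤ K * dist (f x) (f x')) →
      b < δ (systole Y).toReal := by
  have hlt := systole_lt_top hS h
  set s := (systole X).toReal with hs
  have hs0 : 0 < s := ENNReal.toReal_pos (systole_pos h).ne' hlt.ne
  have hc : ContinuousAt δ s := hδ.continuousAt (Ioi_mem_nhds hs0)
  obtain ⟨η, hη, H⟩ := Metric.eventually_nhds_iff.1 (hc.eventually (lt_mem_nhds hb))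
  have hK : ∀ᶠ K in nhdsWithin (1 : ℝ) (Ioi 1), (K - 1) * s < η := by
    refine eventually_nhdsWithin_of_eventually_nhds ?_
    have : Continuous fun K : ℝ => (K - 1) * s := by fun_prop
    refine this.continuousAt.eventually (gt_mem_nhds ?_)
    simpa using hη
  filter_upwards [hK, self_mem_nhdsWithin] with K hK hK1 Y _ f h1 h2
  have hK1 : 1 < K := hK1
  have hK0 : 0 < K := by linarith
  have hKn : Real.toNNReal K ≠ 0 := by simpa using hK0
  have l1 : systole Y ≤ Real.toNNReal K * systole X :=
    systole_le_of_homeomorph f hKn (LipschitzWith.of_dist_le_mul fun x x' => by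
      rw [Real.coe_toNNReal _ hK0.le]; exact h1 x x')
  have l2 : systole X ≤ Real.toNNReal K * systole Y :=
    systole_le_of_homeomorph f.symm hKn (LipschitzWith.of_dist_le_mul fun x x' => by
      rw [Real.coe_toNNReal _ hK0.le]
      simpa using h2 (f.symm x) (f.symm x'))
  have hYlt : systole Y ≠ ∞ := (l1.trans_lt (ENNReal.mul_lt_top ENNReal.coe_lt_top hlt)).ne
  have m1 : (systole Y).toReal ≤ K * s := by
    have := ENNReal.toReal_mono (ENNReal.mul_ne_top ENNReal.coe_ne_top hlt.ne) l1
    rwa [ENNReal.toReal_mul, ENNReal.coe_toReal, Real.coe_toNNReal _ hK0.le] at this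
  have m2 : s ≤ K * (systole Y).toReal := by
    have := ENNReal.toReal_mono (ENNReal.mul_ne_top ENNReal.coe_ne_top hYlt) l2
    rwa [ENNReal.toReal_mul, ENNReal.coe_toReal, Real.coe_toNNReal _ hK0.le] at this
  refine H ?_
  rw [Real.dist_eq, abs_lt]
  constructor
  · nlinarith
  · linarith

end Distortion

section Openness

/-- A point within `s` of a cone-point `v` goes to a point within `K * s` of `f v`, and a new
cone-point lies within `τ` of `f v`. So a number `b` slightly larger than `s` bounds the new
cone-sparsity, while `δ` at the new systole still exceeds `b`. -/
lemma IsBalanced.exists_nhds {X : Type u} [MetricSpace X] [CompactSpace X] [ConnectedSpace X]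
    (hS : ¬ SimplyConnectedSpace X) (hX : IsHyperbolicConeMetric X) (hX' : IsConvexConeMetric X)
    {δ : ℝ → ℝ} (hδ : ContinuousOn δ (Ioi 0)) (hb : IsBalanced X δ) :
    ∃ ε > 0, ∀ (Y : Type u) [MetricSpace Y] [CompactSpace Y] (f : X ≃ₜ Y), IsIntrinsic Y →
      distortion f ≤ ENNReal.ofReal ε → IsBalanced Y δ := by
  set V := conePoints X with hV
  set s := (coneSparsity X).toReal with hs
  have hlt : coneSparsity X ≠ ∞ := (lt_of_lt_of_le hb le_top).ne
  have hss : coneSparsity X = ENNReal.ofReal s := (ENNReal.ofReal_toReal hlt).symm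
  have hs0 : 0 ≤ s := ENNReal.toReal_nonneg
  have hlt2 : s < δ (systole X).toReal := by
    rw [IsBalanced, hss] at hb
    exact (ENNReal.ofReal_lt_ofReal_iff_of_nonneg hs0).1 hb
  obtain ⟨b, hb1, hb2⟩ := exists_between hlt2
  -- One `τ` pays for the displacement of the cone-point and one for `K * s - s`.
  set τ := (b - s) / 3 with hτ
  have hτ0 : 0 < τ := by rw [hτ]; linarith
  -- Without cone-points the sparsity would be `∞`, which is never less than a value of
  -- `ENNReal.ofReal`.
  have hne : V.Nonempty := by
    by_contra hem
    rw [not_nonempty_iff_eq_empty] at hem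
    obtain ⟨x⟩ := (inferInstance : Nonempty X)
    have : Metric.infEDist x V ≤ coneSparsity X := le_iSup (fun p => Metric.infEDist p V) x
    rw [hem, Metric.infEDist_empty, top_le_iff] at this
    exact hlt this
  have hsm : ∀ v ∈ V, ∃ κ < 2 * Real.pi, HasConeAngle v κ := by
    intro v hv
    obtain ⟨κ, hκ⟩ := hX.2.2 v
    refine ⟨κ, lt_of_le_of_ne (hX' v κ hκ) ?_, hκ⟩
    rintro rfl
    exact hv hκ
  have hK1 : ∀ᶠ K in nhdsWithin (1 : ℝ) (Ioi 1), ∀ v ∈ V, ∀ (Y : Type u) [MetricSpace Y]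
      [CompactSpace Y] (f : X ≃ₜ Y), IsIntrinsic Y →
      (∀ x x', dist (f x) (f x') ≤ K * dist x x') → (∀ x x', dist x x' ≤ K * dist (f x) (f x')) →
      ∃ w ∈ conePoints Y, dist (f v) w < τ := by
    rw [Filter.eventually_all_finite hX.2.1]
    intro v hv
    obtain ⟨κ, hκ, hvκ⟩ := hsm v hv
    obtain ⟨K, hK, H⟩ := exists_conePoint_near hvκ hκ hτ0
    filter_upwards [Ioo_mem_nhdsGT hK] with K' hK' Y _ _ f hI h1 h2
    exact H Y f hI (fun x x' => (h1 x x').trans (by gcongr; exact hK'.2.le))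
      (fun x x' => (h2 x x').trans (by gcongr; exact hK'.2.le))
  have hK2 : ∀ᶠ K in nhdsWithin (1 : ℝ) (Ioi 1), K * s < s + τ := by
    refine eventually_nhdsWithin_of_eventually_nhds ?_
    have : Continuous fun K : ℝ => K * s := by fun_prop
    refine this.continuousAt.eventually (gt_mem_nhds ?_)
    simpa using hτ0
  obtain ⟨K, hK1, hK2, hK3, hK4⟩ := (hK1.and (hK2.and
    ((eventually_lt_systole.{u, u} hS hX.2.2 hδ hb2).and self_mem_nhdsWithin))).exists
  have hK4 : 1 < K := hK4
  refine ⟨Real.log K, Real.log_pos hK4, fun Y _ _ f hI hf => ?_⟩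
  have hbd := le_exp_mul_of_distortion_le f.injective (Real.log_pos hK4).le hf
  rw [Real.exp_log (by linarith)] at hbd
  have h1 := fun x x' => (hbd x x').1
  have h2 := fun x x' => (hbd x x').2
  have h3 := hK3 Y f h1 h2
  refine lt_of_le_of_lt ?_ ((ENNReal.ofReal_lt_ofReal_iff_of_nonneg (by linarith : 0 ≤ b)).2 h3)
  refine iSup_le fun y => ?_
  obtain ⟨x, rfl⟩ := f.surjective y
  obtain ⟨v, hv, hxv⟩ := hX.2.1.isCompact.exists_infEDist_eq_edist hne x
  have hxs : dist x v ≤ s := by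
    have : Metric.infEDist x V ≤ coneSparsity X := le_iSup (fun p => Metric.infEDist p V) x
    rw [hxv, hss, edist_dist] at this
    exact (ENNReal.ofReal_le_ofReal_iff hs0).1 this
  obtain ⟨w, hw, hvw⟩ := hK1 v hv Y f hI h1 h2
  refine (Metric.infEDist_le_edist_of_mem hw).trans ?_
  rw [edist_dist]
  refine ENNReal.ofReal_le_ofReal ?_
  calc dist (f x) w ≤ dist (f x) (f v) + dist (f v) w := dist_triangle _ _ _
    _ ≤ K * dist x v + τ := add_le_add (h1 x v) hvw.le
    _ ≤ K * s + τ := by gcongr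
    _ ≤ b := by rw [hτ] at hK2 ⊢; linarith

/-- The topology of the metric of a `ConvexConeMetric` is only propositionally equal to the given
one; this carries homeomorphisms across that equality. -/
lemma exists_homeomorph_coe_eq {S : Type*} {t t' : TopologicalSpace S} (h : t' = t)
    (f : @Homeomorph S S t t) : ∃ g : @Homeomorph S S t t', (g : S → S) = f := by
  subst h
  exact ⟨f, rfl⟩

lemma ConvexConeMetric.isOpen_balanced {S : Type u} [t : TopologicalSpace S] [CompactSpace S]
    [ConnectedSpace S] (hS : ¬ SimplyConnectedSpace S) {δ : ℝ → ℝ}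
    (hδ : ContinuousOn δ (Ioi 0)) : IsOpen (ConvexConeMetric.balanced S δ) := by
  refine EMetric.isOpen_iff.2 fun d hd => ?_
  obtain ⟨m, ht, h1, h2⟩ := d
  subst ht
  obtain ⟨ε, hε, H⟩ := IsBalanced.exists_nhds hS h1 h2 hδ hd
  refine ⟨ENNReal.ofReal ε, ENNReal.ofReal_pos.2 hε, fun d' hd' => ?_⟩
  obtain ⟨m', ht', h1', h2'⟩ := d'
  rw [Metric.mem_eball, edist_comm] at hd'
  obtain ⟨f, hf⟩ := iInf_lt_iff.1 hd'
  obtain ⟨g, hg⟩ := exists_homeomorph_coe_eq ht' f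
  have hc : @CompactSpace S m'.toPseudoMetricSpace.toUniformSpace.toTopologicalSpace := by
    rw [ht']; infer_instance
  refine @H S m' hc g h1'.1 ?_
  rw [hg]
  exact hf.le

end Openness

section Angle

open Real

/-! ### Contraction of angles -/

/-- The density of `squeeze k`. -/
noncomputable def squeezeDensity (k u : ℝ) : ℝ := k / (k ^ 2 * cos u ^ 2 + sin u ^ 2)

/-- The lift to `ℝ` of the action of `diag(k, 1)` on directions in the plane. -/
noncomputable def squeeze (k u : ℝ) : ℝ :=
  u - arctan ((k - 1) * sin u * cos u / (k * cos u ^ 2 + sin u ^ 2))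

lemma mul_cos_sq_add_pos {k : ℝ} (hk : 0 < k) (u : ℝ) : 0 < k * cos u ^ 2 + sin u ^ 2 := by
  rcases eq_or_ne (sin u) 0 with h | h
  · have := sin_sq_add_cos_sq u
    rw [h] at this
    have h2 : cos u ^ 2 = 1 := by linarith
    rw [h, h2]; linarith
  · have := pow_pos (abs_pos.2 h) 2
    rw [sq_abs] at this
    positivity

variable {k : ℝ}

lemma squeezeDensity_pos (hk : 0 < k) (u : ℝ) : 0 < squeezeDensity k u :=
  div_pos hk (mul_cos_sq_add_pos (by positivity) u)

lemma squeezeDensity_neg (k u : ℝ) : squeezeDensity k (-u) = squeezeDensity k u := by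
  simp [squeezeDensity]

lemma continuous_squeezeDensity (hk : 0 < k) : Continuous (squeezeDensity k) := by
  unfold squeezeDensity
  exact Continuous.div (by fun_prop) (by fun_prop)
    fun u => (mul_cos_sq_add_pos (by positivity) u).ne'

lemma hasDerivAt_squeeze (hk : 0 < k) (u : ℝ) :
    HasDerivAt (squeeze k) (squeezeDensity k u) u := by
  have hq := mul_cos_sq_add_pos hk u
  have hq2 := mul_cos_sq_add_pos (pow_pos hk 2) u
  have h1 : HasDerivAt (fun u => (k - 1) * sin u * cos u)
      ((k - 1) * cos u * cos u + (k - 1) * sin u * (-sin u)) u :=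
    ((hasDerivAt_sin u).const_mul _).mul (hasDerivAt_cos u)
  have h2 : HasDerivAt (fun u => k * cos u ^ 2 + sin u ^ 2)
      (k * ((2 : ℕ) * cos u ^ (2 - 1) * (-sin u)) + (2 : ℕ) * sin u ^ (2 - 1) * cos u) u :=
    (((hasDerivAt_cos u).pow 2).const_mul k).add ((hasDerivAt_sin u).pow 2)
  have h3 := (hasDerivAt_id u).sub ((h1.div h2 hq.ne').arctan)
  refine h3.congr_deriv ?_
  have e : 1 + ((k - 1) * sin u * cos u / (k * cos u ^ 2 + sin u ^ 2)) ^ 2 =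
      (k ^ 2 * cos u ^ 2 + sin u ^ 2) / (k * cos u ^ 2 + sin u ^ 2) ^ 2 := by
    rw [div_pow, eq_div_iff (by positivity), add_mul, div_mul_cancel₀ _ (by positivity)]
    have := sin_sq_add_cos_sq u
    linear_combination (k ^ 2 * cos u ^ 2 + sin u ^ 2) * this
  simp only [squeezeDensity, Pi.div_apply]
  rw [e]
  have := sin_sq_add_cos_sq u
  field_simp
  push_cast
  have hs : sin u ^ 2 = 1 - cos u ^ 2 := by linarith
  have hs4 : sin u ^ 4 = (1 - cos u ^ 2) ^ 2 := by rw [← hs]; ring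
  ring_nf
  rw [hs4, hs]
  ring

/-- The vector `(k cos u, sin u)` points in the direction `squeeze k u`. The two identities replace
the arctangent in the definition in later trigonometry. -/
lemma norm_squeeze (hk : 0 < k) (u : ℝ) :
    sqrt (k ^ 2 * cos u ^ 2 + sin u ^ 2) * sin (squeeze k u) = sin u ∧
    sqrt (k ^ 2 * cos u ^ 2 + sin u ^ 2) * cos (squeeze k u) = k * cos u := by
  have hq := mul_cos_sq_add_pos hk u
  have hq2 := mul_cos_sq_add_pos (pow_pos hk 2) u
  have e : 1 + ((k - 1) * sin u * cos u / (k * cos u ^ 2 + sin u ^ 2)) ^ 2 =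
      (k ^ 2 * cos u ^ 2 + sin u ^ 2) / (k * cos u ^ 2 + sin u ^ 2) ^ 2 := by
    rw [div_pow, eq_div_iff (by positivity), add_mul, div_mul_cancel₀ _ (by positivity)]
    have := sin_sq_add_cos_sq u
    linear_combination (k ^ 2 * cos u ^ 2 + sin u ^ 2) * this
  have hr : 0 < sqrt (k ^ 2 * cos u ^ 2 + sin u ^ 2) := sqrt_pos.2 hq2
  rw [squeeze, sin_sub, cos_sub, sin_arctan, cos_arctan, e, sqrt_div hq2.le, sqrt_sq hq.le]
  have := sin_sq_add_cos_sq u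
  constructor
  · field_simp
    linear_combination sin u * this
  · field_simp
    linear_combination k * cos u * this

lemma squeeze_apply_zero (k : ℝ) : squeeze k 0 = 0 := by simp [squeeze]

lemma squeeze_neg (k u : ℝ) : squeeze k (-u) = -squeeze k u := by
  simp only [squeeze, sin_neg, cos_neg]
  rw [show (k - 1) * -sin u * cos u / (k * cos u ^ 2 + (-sin u) ^ 2) =
    -((k - 1) * sin u * cos u / (k * cos u ^ 2 + sin u ^ 2)) by ring, arctan_neg]
  ring

lemma squeeze_pi_sub (k u : ℝ) : squeeze k (π - u) = π - squeeze k u := by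
  simp only [squeeze, sin_pi_sub, cos_pi_sub]
  rw [show (k - 1) * sin u * -cos u / (k * (-cos u) ^ 2 + sin u ^ 2) =
    -((k - 1) * sin u * cos u / (k * cos u ^ 2 + sin u ^ 2)) by ring, arctan_neg]
  ring

lemma squeeze_pi (k : ℝ) : squeeze k π = π := by
  have := squeeze_pi_sub k 0
  rwa [sub_zero, squeeze_apply_zero, sub_zero] at this

lemma strictMono_squeeze (hk : 0 < k) : StrictMono (squeeze k) :=
  strictMono_of_hasDerivAt_pos (hasDerivAt_squeeze hk) (squeezeDensity_pos hk)

/-- If the inequality failed, the difference of the two sides would lie in `[0, π]` and have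
nonnegative sine. Multiplied by the norms of the three vectors `(k cos, sin)`, this sine equals `-(k
^ 2 - 1) * sin x * sin y * sin (x + y) < 0`. -/
lemma squeeze_add_lt (hk : 1 < k) {x y : ℝ} (hx : 0 < x) (hy : 0 < y) (hxy : x + y < π) :
    squeeze k x + squeeze k y < squeeze k (x + y) := by
  have hk0 : 0 < k := by linarith
  obtain ⟨s1, c1⟩ := norm_squeeze hk0 x
  obtain ⟨s2, c2⟩ := norm_squeeze hk0 y
  obtain ⟨s3, c3⟩ := norm_squeeze hk0 (x + y)
  have p1 := sqrt_pos.2 (mul_cos_sq_add_pos (pow_pos hk0 2) x)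
  have p2 := sqrt_pos.2 (mul_cos_sq_add_pos (pow_pos hk0 2) y)
  have p3 := sqrt_pos.2 (mul_cos_sq_add_pos (pow_pos hk0 2) (x + y))
  set r1 := sqrt (k ^ 2 * cos x ^ 2 + sin x ^ 2)
  set r2 := sqrt (k ^ 2 * cos y ^ 2 + sin y ^ 2)
  set r3 := sqrt (k ^ 2 * cos (x + y) ^ 2 + sin (x + y) ^ 2)
  have m := strictMono_squeeze hk0
  have z := squeeze_apply_zero k
  have pi := squeeze_pi k
  have l1 := m hx
  have l2 := m hy
  have l3 := m hxy
  have l4 := m (show x < x + y by linarith)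
  have l5 := m (show y < π by linarith)
  by_contra hle
  push Not at hle
  have hsin : sin (squeeze k x + squeeze k y - squeeze k (x + y)) ≥ 0 :=
    sin_nonneg_of_nonneg_of_le_pi (by linarith) (by linarith)
  have key : r1 * r2 * r3 * sin (squeeze k x + squeeze k y - squeeze k (x + y)) =
      - ((k ^ 2 - 1) * sin x * sin y * sin (x + y)) := by
    rw [sin_sub, sin_add, cos_add]
    calc _ = ((r1 * sin (squeeze k x)) * (r2 * cos (squeeze k y)) +
          (r1 * cos (squeeze k x)) * (r2 * sin (squeeze k y))) * (r3 * cos (squeeze k (x + y))) -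
          ((r1 * cos (squeeze k x)) * (r2 * cos (squeeze k y)) -
          (r1 * sin (squeeze k x)) * (r2 * sin (squeeze k y))) * (r3 * sin (squeeze k (x + y))) := by
          ring
      _ = _ := by
          rw [s1, c1, s2, c2, s3, c3, sin_add, cos_add]; ring
  have q1 := sin_pos_of_pos_of_lt_pi hx (by linarith)
  have q2 := sin_pos_of_pos_of_lt_pi hy (by linarith)
  have q3 := sin_pos_of_pos_of_lt_pi (by linarith : 0 < x + y) hxy
  have q4 : 0 < k ^ 2 - 1 := by nlinarith
  have q5 : 0 < (k ^ 2 - 1) * sin x * sin y * sin (x + y) := by positivity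
  have q6 : 0 ≤ r1 * r2 * r3 * sin (squeeze k x + squeeze k y - squeeze k (x + y)) :=
    mul_nonneg (by positivity) hsin
  linarith

lemma squeeze_add_le (hk : 1 < k) {x y : ℝ} (hx : 0 < x) (hy : 0 < y) (hxy : x + y ≤ π) :
    squeeze k x + squeeze k y ≤ squeeze k (x + y) := by
  rcases hxy.lt_or_eq with h | h
  · exact (squeeze_add_lt hk hx hy h).le
  · rw [h, show y = π - x by linarith, squeeze_pi_sub, squeeze_pi]; linarith

/-! ### The angular coordinate squeezed towards a set of directions -/

variable {Λ : Set ℝ}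

/-- The primitive of the density `squeezeDensity k`, taken at the distance to `Λ`. -/
noncomputable def squeezeAlong (k : ℝ) (Λ : Set ℝ) (x : ℝ) : ℝ :=
  ∫ s in (0 : ℝ)..x, squeezeDensity k (Metric.infDist s Λ)

lemma hasDerivAt_squeezeAlong (hk : 0 < k) (x : ℝ) :
    HasDerivAt (squeezeAlong k Λ) (squeezeDensity k (Metric.infDist x Λ)) x := by
  have hc : Continuous fun s => squeezeDensity k (Metric.infDist s Λ) :=
    (continuous_squeezeDensity hk).comp (Metric.continuous_infDist_pt Λ)
  exact intervalIntegral.integral_hasDerivAt_right (hc.intervalIntegrable _ _)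
    (hc.stronglyMeasurableAtFilter _ _) hc.continuousAt

lemma strictMono_squeezeAlong (hk : 0 < k) : StrictMono (squeezeAlong k Λ) :=
  strictMono_of_hasDerivAt_pos (hasDerivAt_squeezeAlong hk) fun _ => squeezeDensity_pos hk _

/-- In the sector of `t ∈ Λ`, `squeezeAlong` is a translate of `squeeze`. -/
lemma squeezeAlong_sub (hk : 0 < k) {t u : ℝ} (ht : t ∈ Λ) (hu : ∀ l ∈ Λ, |u| ≤ |t + u - l|) :
    squeezeAlong k Λ (t + u) - squeezeAlong k Λ t = squeeze k u := by
  -- On the way from `t` to `t + u` the point `t` remains a nearest point of `Λ`, so both sides have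
  -- the same derivative.
  have hd : ∀ c ∈ Icc (0 : ℝ) 1, Metric.infDist (t + c * u) Λ = |c * u| := by
    intro c hc
    refine le_antisymm ?_ ?_
    · refine (Metric.infDist_le_dist_of_mem ht).trans (le_of_eq ?_)
      rw [Real.dist_eq]; congr 1; ring
    · refine (Metric.le_infDist ⟨t, ht⟩).2 fun l hl => ?_
      have h1 := hu l hl
      have h2 : |t + u - l| ≤ |t + c * u - l| + |(1 - c) * u| := by
        refine le_trans (le_of_eq ?_) (abs_add_le _ _); congr 1; ring
      rw [abs_mul, abs_of_nonneg (by linarith [hc.2] : 0 ≤ 1 - c)] at h2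
      rw [Real.dist_eq, abs_mul, abs_of_nonneg hc.1]
      linarith
  have hder : ∀ c ∈ Icc (0 : ℝ) 1, HasDerivWithinAt
      (fun c => squeezeAlong k Λ (t + c * u) - squeeze k (c * u)) 0 (Icc 0 1) c := by
    intro c hc
    have i1 : HasDerivAt (fun c : ℝ => t + c * u) u c := by
      simpa using ((hasDerivAt_id c).mul_const u).const_add t
    have i2 : HasDerivAt (fun c : ℝ => c * u) u c := by
      simpa using (hasDerivAt_id c).mul_const u
    have h1 := (hasDerivAt_squeezeAlong (Λ := Λ) hk (t + c * u)).comp c i1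
    have h2 := (hasDerivAt_squeeze hk (c * u)).comp c i2
    refine ((h1.sub h2).congr_deriv ?_).hasDerivWithinAt
    rw [hd c hc]
    have : squeezeDensity k |c * u| = squeezeDensity k (c * u) := by
      rcases abs_choice (c * u) with h | h <;> rw [h]
      exact squeezeDensity_neg _ _
    rw [this, sub_self]
  have := constant_of_has_deriv_right_zero (fun c hc => (hder c hc).continuousWithinAt)
    (fun c hc => ((hder c (Ico_subset_Icc_self hc)).mono_of_mem_nhdsWithin
      (Icc_mem_nhdsGE_of_mem hc))) 1 (by simp)
  simp only [one_mul, zero_mul, add_zero, squeeze_apply_zero, sub_zero] at this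
  linarith

/-- The middle of a gap belongs to the sectors of both ends, so the gap consists of two half-gaps,
each measured by `squeeze k`. -/
lemma squeezeAlong_gap_eq (hk : 0 < k) {a b : ℝ} (ha : a ∈ Λ) (hb : b ∈ Λ) (hab : a ≤ b)
    (h : ∀ l ∈ Λ, l ∉ Ioo a b) :
    squeezeAlong k Λ b - squeezeAlong k Λ a = 2 * squeeze k ((b - a) / 2) := by
  have key : ∀ l ∈ Λ, (b - a) / 2 ≤ |(a + b) / 2 - l| := by
    intro l hl
    have := h l hl
    rw [mem_Ioo, not_and_or, not_lt, not_lt] at this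
    rcases this with h1 | h1
    · exact le_trans (by linarith) (le_abs_self _)
    · exact le_trans (by linarith) (neg_le_abs _)
  have h1 := squeezeAlong_sub hk (u := (b - a) / 2) ha (fun l hl => by
    rw [abs_of_nonneg (by linarith), show a + (b - a) / 2 = (a + b) / 2 by ring]
    exact key l hl)
  have h2 := squeezeAlong_sub hk (u := -((b - a) / 2)) hb (fun l hl => by
    rw [abs_neg, abs_of_nonneg (by linarith), show b + -((b - a) / 2) = (a + b) / 2 by ring]
    exact key l hl)
  rw [squeeze_neg] at h2
  rw [show a + (b - a) / 2 = (a + b) / 2 by ring] at h1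
  rw [show b + -((b - a) / 2) = (a + b) / 2 by ring] at h2
  linarith

/-- By superadditivity, every further direction of `Λ` inside the gap can only lower the squeezed
length. For `b = a + 2π` the bound is `2 * squeeze k π = 2π`: the total angle does not grow. -/
lemma squeezeAlong_gap_le (hk : 1 < k) {a b : ℝ} (ha : a ∈ Λ) (hb : b ∈ Λ) (hab : a < b)
    (hπ : b - a ≤ 2 * π) (hfin : (Λ ∩ Ioo a b).Finite) :
    squeezeAlong k Λ b - squeezeAlong k Λ a ≤ 2 * squeeze k ((b - a) / 2) := by
  induction hn : (Λ ∩ Ioo a b).ncard using Nat.strong_induction_on generalizing a b with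
  | _ n ih =>
    by_cases h : ∃ c ∈ Λ, c ∈ Ioo a b
    · obtain ⟨c, hc, hc'⟩ := h
      have s1 : Λ ∩ Ioo a c ⊂ Λ ∩ Ioo a b := by
        refine ssubset_iff_exists.2 ⟨inter_subset_inter_right _ (Ioo_subset_Ioo_right hc'.2.le),
          c, ⟨hc, hc'⟩, fun h => lt_irrefl _ h.2.2⟩
      have s2 : Λ ∩ Ioo c b ⊂ Λ ∩ Ioo a b := by
        refine ssubset_iff_exists.2 ⟨inter_subset_inter_right _ (Ioo_subset_Ioo_left hc'.1.le),
          c, ⟨hc, hc'⟩, fun h => lt_irrefl _ h.2.1⟩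
      have i1 := ih _ (hn ▸ ncard_lt_ncard s1 hfin) ha hc hc'.1 (by linarith [hc'.2])
        (hfin.subset s1.subset) rfl
      have i2 := ih _ (hn ▸ ncard_lt_ncard s2 hfin) hc hb hc'.2 (by linarith [hc'.1])
        (hfin.subset s2.subset) rfl
      have i3 := squeeze_add_le hk (x := (c - a) / 2) (y := (b - c) / 2) (by linarith [hc'.1])
        (by linarith [hc'.2]) (by linarith)
      rw [show (c - a) / 2 + (b - c) / 2 = (b - a) / 2 by ring] at i3
      linarith
    · push Not at h
      exact (squeezeAlong_gap_eq (by linarith) ha hb hab.le h).le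

lemma squeezeAlong_add_two_pi (hΛ : ∀ x, x + 2 * π ∈ Λ ↔ x ∈ Λ) (hk : 0 < k) (x : ℝ) :
    squeezeAlong k Λ (x + 2 * π) = squeezeAlong k Λ x + squeezeAlong k Λ (2 * π) := by
  have hper : ∀ s, Metric.infDist (s + 2 * π) Λ = Metric.infDist s Λ := by
    intro s
    have : (fun y : ℝ => y + 2 * π) '' Λ = Λ := by
      ext y
      constructor
      · rintro ⟨z, hz, rfl⟩; exact (hΛ z).2 hz
      · intro hy
        exact ⟨y - 2 * π, (hΛ _).1 (by simpa using hy), by ring⟩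
    conv_lhs => rw [← this]
    exact Metric.infDist_image (isometry_add_right (2 * π))
  have hd : ∀ x, HasDerivAt (fun x => squeezeAlong k Λ (x + 2 * π) - squeezeAlong k Λ x) 0 x := by
    intro x
    have h1 := (hasDerivAt_squeezeAlong (Λ := Λ) hk (x + 2 * π)).comp x
      ((hasDerivAt_id x).add_const (2 * π))
    refine (h1.sub (hasDerivAt_squeezeAlong hk x)).congr_deriv ?_
    rw [hper]; ring
  have := is_const_of_deriv_eq_zero (fun x => (hd x).differentiableAt) (fun x => (hd x).deriv) x 0
  simp only [zero_add] at this
  have h0 : squeezeAlong k Λ 0 = 0 := by simp [squeezeAlong]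
  linarith

lemma exists_next (hΛ : ∀ x, x + 2 * π ∈ Λ ↔ x ∈ Λ)
    (hfin : ∀ a b, b - a ≤ 2 * π → (Λ ∩ Ioo a b).Finite) {t : ℝ} (ht : t ∈ Λ) :
    ∃ c ∈ Λ, t < c ∧ c ≤ t + 2 * π ∧ ∀ l ∈ Λ, l ∉ Ioo t c := by
  have hπ := Real.pi_pos
  have hf : (Λ ∩ Ioc t (t + 2 * π)).Finite := by
    refine ((hfin t (t + 2 * π) (by linarith)).union (finite_singleton (t + 2 * π))).subset ?_
    rintro x ⟨hx, h1, h2⟩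
    rcases h2.lt_or_eq with h | h
    · exact Or.inl ⟨hx, h1, h⟩
    · exact Or.inr h
  obtain ⟨c, ⟨hc, h1, h2⟩, hmin⟩ := Set.exists_min_image _ id hf
    ⟨t + 2 * π, (hΛ t).2 ht, by simpa using hπ, le_rfl⟩
  refine ⟨c, hc, h1, h2, fun l hl hl' => ?_⟩
  exact absurd (hmin l ⟨hl, hl'.1, hl'.2.le.trans h2⟩) (not_le.2 hl'.2)

lemma exists_prev (hΛ : ∀ x, x + 2 * π ∈ Λ ↔ x ∈ Λ)
    (hfin : ∀ a b, b - a ≤ 2 * π → (Λ ∩ Ioo a b).Finite) {t : ℝ} (ht : t ∈ Λ) :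
    ∃ c ∈ Λ, c < t ∧ t - 2 * π ≤ c ∧ ∀ l ∈ Λ, l ∉ Ioo c t := by
  have hπ := Real.pi_pos
  have hf : (Λ ∩ Ico (t - 2 * π) t).Finite := by
    refine ((hfin (t - 2 * π) t (by linarith)).union (finite_singleton (t - 2 * π))).subset ?_
    rintro x ⟨hx, h1, h2⟩
    rcases h1.lt_or_eq with h | h
    · exact Or.inl ⟨hx, h, h2⟩
    · exact Or.inr h.symm
  obtain ⟨c, ⟨hc, h1, h2⟩, hmax⟩ := Set.exists_max_image _ id hf
    ⟨t - 2 * π, (hΛ _).1 (by simpa using ht), le_rfl, by simpa using hπ⟩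
  refine ⟨c, hc, h2, h1, fun l hl hl' => ?_⟩
  exact absurd (hmax l ⟨hl, h1.trans hl'.1.le, hl'.2⟩) (not_le.2 hl'.1)

/-- Squeezing the circle of directions towards a finite set of directions shortens it, and maps
each sector isometrically to a sector squeezed linearly. -/
lemma exists_squeeze_circle (hk : 1 < k) (hΛ : ∀ x, x + 2 * π ∈ Λ ↔ x ∈ Λ) (hne : Λ.Nonempty)
    (hfin : ∀ a b, b - a ≤ 2 * π → (Λ ∩ Ioo a b).Finite) :
    ∃ κ' > 0, κ' ≤ 2 * π ∧ ∃ h : AddCircle (2 * π) → AddCircle κ', Function.Bijective h ∧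
      (∀ t ∈ Λ, ∀ u u', (∀ l ∈ Λ, |u| ≤ |t + u - l|) → (∀ l ∈ Λ, |u'| ≤ |t + u' - l|) →
        cos (min ‖h ((t + u : ℝ) : AddCircle (2 * π)) - h ((t + u' : ℝ) : AddCircle (2 * π))‖ π) =
          cos (squeeze k u - squeeze k u')) ∧
      ((∃ t ∈ Λ, ∀ u, (∀ l ∈ Λ, |u| ≤ |t + u - l|) → |u| < π / 2) → κ' < 2 * π) := by
  have hk0 : 0 < k := by linarith
  have hπ := Real.pi_pos
  set F := squeezeAlong k Λ with hF
  set κ' := F (2 * π) with hκ'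
  have hF0 : F 0 = 0 := by simp [hF, squeezeAlong]
  have hmono : StrictMono F := strictMono_squeezeAlong hk0
  have hT : StrictMono (squeeze k) := strictMono_squeeze hk0
  have hper : ∀ x, F (x + 2 * π) = F x + κ' := squeezeAlong_add_two_pi hΛ hk0
  have hκ0 : 0 < κ' := by
    have := hmono (by linarith : (0 : ℝ) < 2 * π)
    rwa [hF0] at this
  have hle : κ' ≤ 2 * π := by
    obtain ⟨t, ht⟩ := hne
    have := squeezeAlong_gap_le hk ht ((hΛ t).2 ht) (by linarith) (by linarith)
      (hfin t (t + 2 * π) (by linarith))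
    rw [show (t + 2 * π - t) / 2 = π by ring, squeeze_pi] at this
    have h2 := hper t
    rw [hF] at h2
    linarith
  have hcont : Continuous F := continuous_iff_continuousAt.2 fun x =>
    (hasDerivAt_squeezeAlong hk0 x).continuousAt
  have hlin : Function.Periodic (fun x => F x - x * (κ' / (2 * π))) (2 * π) := by
    intro x
    simp only [hper]
    field_simp
    ring
  have hg : Function.Periodic (fun x => (F x : AddCircle κ')) (2 * π) := by
    intro x
    simp only [hper, AddCircle.coe_add_period]
  have hlift : ∀ x : ℝ, hg.lift (x : AddCircle (2 * π)) = (F x : AddCircle κ') :=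
    fun x => hg.lift_coe x
  refine ⟨κ', hκ0, hle, hg.lift, ⟨?_, ?_⟩, ?_, ?_⟩
  · intro x y
    induction x using QuotientAddGroup.induction_on with | _ x => ?_
    induction y using QuotientAddGroup.induction_on with | _ y => ?_
    intro hxy
    change hg.lift (x : AddCircle (2 * π)) = hg.lift (y : AddCircle (2 * π)) at hxy
    rw [hlift, hlift, ← sub_eq_zero, ← AddCircle.coe_sub, AddCircle.coe_eq_zero_iff] at hxy
    obtain ⟨n, hn⟩ := hxy
    have h1 : F (y + n * (2 * π)) - (y + n * (2 * π)) * (κ' / (2 * π)) =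
      F y - y * (κ' / (2 * π)) := hlin.int_mul n y
    have h2 : F (y + n * (2 * π)) = F x := by
      rw [zsmul_eq_mul] at hn
      have : (y + n * (2 * π)) * (κ' / (2 * π)) = y * (κ' / (2 * π)) + n * κ' := by
        field_simp
      linarith
    have h3 := hmono.injective h2
    change (x : AddCircle (2 * π)) = (y : AddCircle (2 * π))
    rw [← h3, ← sub_eq_zero, ← AddCircle.coe_sub, AddCircle.coe_eq_zero_iff]
    exact ⟨n, by rw [zsmul_eq_mul]; ring⟩
  · intro y
    have := Fact.mk hκ0
    have hy : y ∈ ((↑) : ℝ → AddCircle κ') '' Icc 0 (0 + κ') := by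
      rw [AddCircle.coe_image_Icc_eq]; exact mem_univ y
    obtain ⟨a, ha, rfl⟩ := hy
    have h1 := intermediate_value_Icc (by linarith : (0 : ℝ) ≤ 2 * π) hcont.continuousOn
    rw [hF0] at h1
    obtain ⟨x, -, hx⟩ := h1 (by simpa using ha)
    exact ⟨(x : AddCircle (2 * π)), by rw [hlift, hx]⟩
  · intro t ht u u' hu hu'
    rw [hlift, hlift, ← AddCircle.coe_sub]
    have e1 := squeezeAlong_sub hk0 ht hu
    have e2 := squeezeAlong_sub hk0 ht hu'
    rw [← hF] at e1 e2
    rw [show F (t + u) - F (t + u') = squeeze k u - squeeze k u' by linarith]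
    obtain ⟨c, hc, hc1, hc2, hc3⟩ := exists_next hΛ hfin ht
    obtain ⟨c', hc', hc1', hc2', hc3'⟩ := exists_prev hΛ hfin ht
    have g1 := squeezeAlong_gap_eq hk0 ht hc hc1.le hc3
    have g2 := squeezeAlong_gap_eq hk0 hc' ht hc1'.le hc3'
    rw [← hF] at g1 g2
    have hub : ∀ u, (∀ l ∈ Λ, |u| ≤ |t + u - l|) → u ≤ (c - t) / 2 ∧ -((t - c') / 2) ≤ u := by
      intro u hu
      constructor
      · have := hu c hc
        by_contra! hlt
        rw [abs_of_pos (by linarith : 0 < u)] at this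
        exact absurd this (not_le.2 (abs_lt.2 ⟨by linarith, by linarith⟩))
      · have := hu c' hc'
        by_contra! hlt
        rw [abs_of_neg (by linarith : u < 0)] at this
        exact absurd this (not_le.2 (abs_lt.2 ⟨by linarith, by linarith⟩))
    have b1 := hT.monotone (hub u hu).1
    have b2 := hT.monotone (hub u hu).2
    have b3 := hT.monotone (hub u' hu').1
    have b4 := hT.monotone (hub u' hu').2
    rw [squeeze_neg] at b2 b4
    -- If the preceding direction is not `t - 2π`, the squeezed sector has width at most `κ' / 2`,
    -- and norms on the circle are distances on the line. Otherwise `t` is the only direction up to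
    -- the period, `κ' = 2π`, and the periodicity of the cosine suffices.
    rcases hc2'.lt_or_eq with hlt | heq
    · have h1 : F c ≤ F c' + κ' := by
        rw [← hper]
        refine hmono.monotone ?_
        by_contra! hlt2
        exact hc3 _ ((hΛ c').2 hc') ⟨by linarith, hlt2⟩
      have hb : |squeeze k u - squeeze k u'| ≤ κ' / 2 := abs_le.2 ⟨by linarith, by linarith⟩
      rw [(AddCircle.norm_coe_eq_abs_iff κ' hκ0.ne').2 (by rwa [abs_of_pos hκ0]),
        min_eq_left (by linarith), cos_abs]
    · have h1 : κ' = 2 * π := by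
        have h2 := hper c'
        rw [show c' + 2 * π = t by linarith] at h2
        rw [show (t - c') / 2 = π by linarith, squeeze_pi] at g2
        linarith
      revert h1
      generalize κ' = κ''
      rintro rfl
      rw [min_eq_left (norm_two_pi_le _), cos_norm_two_pi]
  · rintro ⟨t, ht, hsec⟩
    obtain ⟨c, hc, hc1, hc2, hc3⟩ := exists_next hΛ hfin ht
    obtain ⟨c', hc', hc1', hc2', hc3'⟩ := exists_prev hΛ hfin ht
    have g1 := squeezeAlong_gap_eq hk0 ht hc hc1.le hc3
    have g2 := squeezeAlong_gap_eq hk0 hc' ht hc1'.le hc3'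
    rw [← hF] at g1 g2
    have d1 : c < t + π := by
      by_contra! hge
      have := hsec (π / 2) (fun l hl => by
        have := hc3 l hl
        rw [mem_Ioo, not_and_or, not_lt, not_lt] at this
        rw [abs_of_pos (by linarith)]
        rcases this with h | h
        · exact le_trans (by linarith) (le_abs_self _)
        · exact le_trans (by linarith) (neg_le_abs _))
      rw [abs_of_pos (by linarith)] at this
      exact lt_irrefl _ this
    have d2 : t - π < c' := by
      by_contra! hge
      have := hsec (-(π / 2)) (fun l hl => by
        have := hc3' l hl
        rw [mem_Ioo, not_and_or, not_lt, not_lt] at this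
        rw [abs_neg, abs_of_pos (by linarith)]
        rcases this with h | h
        · exact le_trans (by linarith) (le_abs_self _)
        · exact le_trans (by linarith) (neg_le_abs _))
      rw [abs_neg, abs_of_pos (by linarith)] at this
      exact lt_irrefl _ this
    -- The rest of the circle, from `c` to `c' + 2π`, contributes at most `2π - 2 * squeeze k ((c -
    -- c') / 2)`. The two gaps next to `t` contribute strictly less than `2 * squeeze k ((c - c') /
    -- 2)`, since `c - c' < 2π`.
    have g3 := squeezeAlong_gap_le hk hc ((hΛ c').2 hc') (by linarith) (by linarith)
      (hfin _ _ (by linarith))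
    rw [← hF, hper] at g3
    have g4 := squeeze_add_lt hk (x := (c - t) / 2) (y := (t - c') / 2) (by linarith)
      (by linarith) (by linarith)
    have g5 := squeeze_pi_sub k ((c - t) / 2 + (t - c') / 2)
    rw [show π - ((c - t) / 2 + (t - c') / 2) = (c' + 2 * π - c) / 2 by ring] at g5
    linarith

end Angle

/-! ### Metrics assembled from cells -/

/-- A transitive relation that holds for all pairs of points in the same member of a finite closed
cover of an interval holds for the end-points. -/
lemma interval_cover_induction {α ι : Type*} [LinearOrder α] [TopologicalSpace α]
    [OrderTopology α] [DenselyOrdered α] [CompactIccSpace α] {Q : α → α → Prop}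
    (htrans : ∀ s t u, Q s t → Q t u → Q s u) {T : ι → Set α} {a b : α}
    (hT : ∀ i, IsClosed (T i))
    (hQ : ∀ i, ∀ s ∈ T i, ∀ t ∈ T i, s ∈ Icc a b → t ∈ Icc a b → s ≤ t → Q s t) (hab : a ≤ b)
    (F : Finset ι) (hF : Icc a b ⊆ ⋃ i ∈ F, T i) : Q a b := by
  classical
  induction hn : F.card using Nat.strong_induction_on generalizing F a with
  | _ n ih =>
    have ha : a ∈ Icc a b := left_mem_Icc.2 hab
    obtain ⟨i, hi, hai⟩ := mem_iUnion₂.1 (hF ha)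
    -- Jump to the last parameter in `T i`. Beyond it `T i` is not met again, so the remaining
    -- interval is covered by fewer sets; closedness takes care of the point `c` itself.
    obtain ⟨c, ⟨hcT, hc⟩, hmax⟩ := ((isCompact_Icc (a := a) (b := b)).inter_left
      (hT i)).exists_isGreatest ⟨a, hai, ha⟩
    have hac : Q a c := hQ i a hai c hcT ha hc hc.1
    rcases hc.2.eq_or_lt with rfl | hlt
    · exact hac
    have h1 : Ioc c b ⊆ ⋃ j ∈ F.erase i, T j := by
      intro t ht
      obtain ⟨j, hj, htj⟩ := mem_iUnion₂.1 (hF ⟨hc.1.trans ht.1.le, ht.2⟩)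
      refine mem_iUnion₂.2 ⟨j, Finset.mem_erase.2 ⟨?_, hj⟩, htj⟩
      rintro rfl
      exact absurd (hmax ⟨htj, hc.1.trans ht.1.le, ht.2⟩) (not_le.2 ht.1)
    have h2 : Icc c b ⊆ ⋃ j ∈ F.erase i, T j := by
      rw [← closure_Ioc hlt.ne]
      exact closure_minimal h1 ((F.erase i).finite_toSet.isClosed_biUnion fun j _ => hT j)
    refine htrans _ _ _ hac (ih _ ?_ (fun j s hs t ht hs' ht' => hQ j s hs t ht
      ⟨hc.1.trans hs'.1, hs'.2⟩ ⟨hc.1.trans ht'.1, ht'.2⟩) hc.2 (F.erase i) h2 rfl)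
    rw [← hn]
    exact Finset.card_erase_lt_of_mem hi

section Chain

variable {X ι : Type*}

/-- `Chain C m x y s`: a chain of points from `x` to `y` with consecutive points in the same cell
has total length `s` with respect to `m`. -/
inductive Chain (C : ι → Set X) (m : X → X → ℝ) (x : X) : X → ℝ → Prop
  | refl : Chain C m x x 0
  | step {y w : X} {s s' : ℝ} (i : ι) (h : Chain C m x y s) (hy : y ∈ C i) (hw : w ∈ C i)
      (hs : s' = s + m y w) : Chain C m x w s'

variable {C : ι → Set X} {m : X → X → ℝ}

lemma Chain.single {x y : X} {i : ι} (hx : x ∈ C i) (hy : y ∈ C i) : Chain C m x y (m x y) :=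
  Chain.step i Chain.refl hx hy (by ring)

lemma Chain.trans {x y w : X} {s s' : ℝ} (h : Chain C m x y s) (h' : Chain C m y w s') :
    Chain C m x w (s + s') := by
  induction h' with
  | refl => simpa using h
  | step i _ hy hw hs ih => exact Chain.step i ih hy hw (by rw [hs]; ring)

lemma Chain.symm (hm : ∀ x y, m x y = m y x) {x y : X} {s : ℝ} (h : Chain C m x y s) :
    Chain C m y x s := by
  induction h with
  | refl => exact Chain.refl
  | step i _ hy hw hs ih =>
    have := (Chain.single (m := m) hw hy).trans ih
    rwa [hm, add_comm, ← hs] at this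

/-- Polar coordinates around `z` in which `m` is the distance in a cone for points of the same
cell. -/
structure IsCellChart (C : ι → Set X) (m : X → X → ℝ) (z : X) (κ ρ : ℝ)
    (e : ℝ → AddCircle κ → X) : Prop where
  angle_pos : 0 < κ
  radius_pos : 0 < ρ
  radial : ∀ r ∈ Ico 0 ρ, ∀ θ, m z (e r θ) = r
  exists_polar : ∀ x, m z x < ρ → ∃ θ, e (m z x) θ = x
  cosh_eq : ∀ i, ∀ r ∈ Ico 0 ρ, ∀ r' ∈ Ico 0 ρ, ∀ θ θ', e r θ ∈ C i → e r' θ' ∈ C i →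
    Real.cosh (m (e r θ) (e r' θ')) = coneCosh κ r θ r' θ'

lemma IsCellChart.mono {z : X} {κ ρ : ℝ} {e : ℝ → AddCircle κ → X} {ι' : Type*}
    {C' : ι' → Set X} (h : IsCellChart C m z κ ρ e)
    (hC : ∀ i, ∃ j, C' i ⊆ C j) : IsCellChart C' m z κ ρ e := by
  refine ⟨h.1, h.2, h.3, h.4, fun i r hr r' hr' θ θ' h1 h2 => ?_⟩
  obtain ⟨j, hj⟩ := hC i
  exact h.5 j r hr r' hr' θ θ' (hj h1) (hj h2)

variable [MetricSpace X]

lemma Chain.dist_le (hm : ∀ x y, dist x y ≤ m x y) {x y : X} {s : ℝ} (h : Chain C m x y s) :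
    dist x y ≤ s := by
  induction h with
  | refl => simp
  | step i _ _ _ hs ih => rw [hs]; exact (dist_triangle _ _ _).trans (add_le_add ih (hm _ _))

/-- Distances are approximated by chains. -/
lemma exists_chain_le [Finite ι] (hI : IsIntrinsic X) (hC : ∀ i, IsClosed (C i))
    (hcov : ∀ x, ∃ i, x ∈ C i) {K : ℝ} (hK : 0 < K) (hm0 : ∀ x y, 0 ≤ m x y)
    (hm : ∀ x y, m x y ≤ K * dist x y) (x y : X) {s : ℝ} (hs : K * dist x y < s) :
    ∃ s' ≤ s, Chain C m x y s' := by
  have hs0 : 0 < s := lt_of_le_of_lt (by positivity) hs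
  have h1 : edist x y < ENNReal.ofReal (s / K) := by
    rw [edist_dist, ENNReal.ofReal_lt_ofReal_iff (by positivity), lt_div_iff₀ hK]
    linarith
  rw [hI x y] at h1
  obtain ⟨γ, hγ⟩ := iInf_lt_iff.1 h1
  cases nonempty_fintype ι
  -- Along a nearly shortest path each step jumps between two of its points in the same cell, and
  -- the value of `m` there is at most `K` times the variation of the path in between.
  have key := interval_cover_induction (α := unitInterval) (a := 0) (b := 1)
    (T := fun i => γ ⁻¹' C i)
    (Q := fun s t => s ≤ t ∧ ∃ σ ≥ 0, Chain C m (γ s) (γ t) σ ∧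
      ENNReal.ofReal σ ≤ ENNReal.ofReal K * eVariationOn γ (univ ∩ Icc s t))
    (by
      rintro s t u ⟨hst, σ, hσ, h1, h2⟩ ⟨htu, σ', hσ', h1', h2'⟩
      refine ⟨hst.trans htu, σ + σ', by positivity, h1.trans h1', ?_⟩
      rw [ENNReal.ofReal_add hσ hσ', ← eVariationOn.Icc_add_Icc γ hst htu (mem_univ _), mul_add]
      exact add_le_add h2 h2')
    (fun i => (hC i).preimage γ.continuous)
    (by
      intro i s hs t ht _ _ hst
      refine ⟨hst, m (γ s) (γ t), hm0 _ _, Chain.single hs ht, ?_⟩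
      refine (ENNReal.ofReal_le_ofReal (hm _ _)).trans ?_
      rw [ENNReal.ofReal_mul hK.le, ← edist_dist]
      gcongr
      exact eVariationOn.edist_le γ ⟨mem_univ _, left_mem_Icc.2 hst⟩
        ⟨mem_univ _, right_mem_Icc.2 hst⟩)
    zero_le_one Finset.univ (by
      intro t _
      obtain ⟨i, hi⟩ := hcov (γ t)
      exact mem_iUnion₂.2 ⟨i, Finset.mem_univ i, hi⟩)
  obtain ⟨-, σ, hσ, h2, h3⟩ := key
  rw [γ.source, γ.target] at h2
  refine ⟨σ, ?_, h2⟩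
  have h4 : ENNReal.ofReal σ ≤ ENNReal.ofReal s := by
    calc ENNReal.ofReal σ ≤ ENNReal.ofReal K * pathLength γ :=
          h3.trans (by gcongr; exact eVariationOn.mono _ (subset_univ _))
      _ ≤ ENNReal.ofReal K * ENNReal.ofReal (s / K) := by gcongr
      _ = ENNReal.ofReal s := by rw [← ENNReal.ofReal_mul hK.le, mul_div_cancel₀ _ hK.ne']
  exact (ENNReal.ofReal_le_ofReal_iff hs0.le).1 h4

namespace IsCellChart

variable {z : X} {κ ρ : ℝ} {e : ℝ → AddCircle κ → X}

lemma apex (h : IsCellChart C m z κ ρ e) (hm : ∀ x y, dist x y ≤ m x y) (θ : AddCircle κ) :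
    e 0 θ = z := by
  have h1 := hm z (e 0 θ)
  rw [h.radial 0 ⟨le_rfl, h.radius_pos⟩] at h1
  exact (dist_le_zero.1 h1).symm

lemma coord_unique (h : IsCellChart C m z κ ρ e) (hcov : ∀ x, ∃ i, x ∈ C i) {K : ℝ}
    (hm1 : ∀ x y, dist x y ≤ m x y) (hm2 : ∀ x y, m x y ≤ K * dist x y) {r r' : ℝ}
    (hr : r ∈ Ico 0 ρ) (hr' : r' ∈ Ico 0 ρ) {θ θ' : AddCircle κ} (he : e r θ = e r' θ') :
    r = r' ∧ (r = 0 ∨ θ = θ') := by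
  obtain ⟨i, hi⟩ := hcov (e r θ)
  have h1 := h.cosh_eq i r hr r' hr' θ θ' hi (he ▸ hi)
  have h2 : m (e r θ) (e r' θ') = 0 := by
    rw [he]
    exact le_antisymm (by simpa using hm2 (e r' θ') (e r' θ'))
      (dist_nonneg.trans (hm1 _ _))
  rw [h2, Real.cosh_zero] at h1
  exact coneCosh_eq_one hr.1 hr'.1 h1.symm

/-- Chains are at least as long as the distance in the cone, or leave the chart. -/
lemma coneCosh_le_of_chain (h : IsCellChart C m z κ ρ e) {K : ℝ} (hK : 0 < K)
    (hcov : ∀ x, ∃ i, x ∈ C i)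
    (hm1 : ∀ x y, dist x y ≤ m x y) (hm2 : ∀ x y, m x y ≤ K * dist x y)
    {r r' : ℝ} (hr : r ∈ Ico 0 ρ) (hr' : r' ∈ Ico 0 ρ) (θ θ' : AddCircle κ) {s : ℝ}
    (hs : Chain C m (e r θ) (e r' θ') s) :
    coneCosh κ r θ r' θ' ≤ Real.cosh s ∨ ρ / K - r ≤ s := by
  have hm0 : ∀ x y, 0 ≤ m x y := fun x y => dist_nonneg.trans (hm1 x y)
  have hrz : dist z (e r θ) ≤ r := by
    have := hm1 z (e r θ)
    rwa [h.radial r hr] at this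
  have key : ∀ y s, Chain C m (e r θ) y s → 0 ≤ s ∧ ((∃ r' ∈ Ico 0 ρ, ∃ θ', y = e r' θ' ∧
      coneCosh κ r θ r' θ' ≤ Real.cosh s) ∨ ρ / K - r ≤ s) := by
    intro y s hs
    induction hs with
    | refl =>
      refine ⟨le_rfl, Or.inl ⟨r, hr, θ, rfl, ?_⟩⟩
      rw [coneCosh_self_angle, sub_self]
    | step i hc hy hw hs ih =>
      rename_i y w s s'
      have hms := hm0 y w
      have hs'0 : 0 ≤ s' := by linarith [ih.1]
      refine ⟨hs'0, ?_⟩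
      rcases ih.2 with ⟨r₁, hr₁, θ₁, rfl, h1⟩ | h1
      · by_cases hwz : m z w < ρ
        · obtain ⟨θ₂, h2⟩ := h.exists_polar w hwz
          have hr₂ : m z w ∈ Ico 0 ρ := ⟨hm0 _ _, hwz⟩
          generalize m z w = r₂ at h2 hr₂
          subst h2
          left
          refine ⟨r₂, hr₂, θ₂, rfl, ?_⟩
          have h3 := h.cosh_eq i r₁ hr₁ r₂ hr₂ θ₁ θ₂ hy hw
          set a := Real.arcosh (coneCosh κ r θ r₁ θ₁) with ha
          have hc1 := one_le_coneCosh hr.1 hr₁.1 θ θ₁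
          have ha0 : 0 ≤ a := Real.arcosh_nonneg hc1
          have hca : coneCosh κ r θ r₁ θ₁ = Real.cosh a := (Real.cosh_arcosh hc1).symm
          rw [hca, cosh_le_iff_of_nonneg ha0 ih.1] at h1
          refine (coneCosh_triangle hr.1 hr₂.1 θ θ₁ θ₂ ha0 hms hr₁.1 hca h3.symm).trans ?_
          rw [cosh_le_iff_of_nonneg (by positivity) hs'0]
          linarith
        -- A chain that leaves the chart reaches a point `w` with `m z w ≥ ρ`, hence with `dist z w
        -- ≥ ρ / K`, and it is at least as long as the distance it covers.
        · right
          have h2 := (Chain.step i hc hy hw hs).dist_le hm1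
          have h3 := hm2 z w
          have h4 : ρ / K ≤ dist z w := by
            rw [div_le_iff₀ hK]; linarith
          linarith [dist_triangle z (e r θ) w]
      · right; linarith
  rcases (key _ s hs).2 with ⟨r₁, hr₁, θ₁, he, h1⟩ | h1
  · left
    obtain ⟨rfl, h2 | rfl⟩ := h.coord_unique hcov hm1 hm2 hr' hr₁ he
    · subst h2
      rwa [coneCosh_zero_right] at h1 ⊢
    · exact h1
  · exact Or.inr h1

/-- The points of a cone geodesic in a closed cell form a closed set. -/
lemma isClosed_geodesic_mem [CompactSpace X] (h : IsCellChart C m z κ ρ e)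
    (hC : ∀ i, IsClosed (C i)) {K : ℝ}
    (hm1 : ∀ x y, dist x y ≤ m x y) (hm2 : ∀ x y, m x y ≤ K * dist x y)
    (hmc : Continuous (m z)) {L : ℝ} {R : ℝ → ℝ} {Θ : ℝ → AddCircle κ}
    (hR : ∀ t ∈ Icc 0 L, R t ∈ Ico 0 ρ)
    (hg : ∀ s ∈ Icc 0 L, ∀ t ∈ Icc 0 L, coneCosh κ (R s) (Θ s) (R t) (Θ t) = Real.cosh (s - t))
    (i : ι) : IsClosed {t | t ∈ Icc 0 L ∧ e (R t) (Θ t) ∈ C i} := by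
  refine IsSeqClosed.isClosed fun t a ht hta => ?_
  have ha : a ∈ Icc 0 L := isClosed_Icc.isSeqClosed (fun n => (ht n).1) hta
  -- Continuity of `e` is not available. A subsequence converges to some `x` in the compact cell,
  -- and the triangle inequality in the cone identifies `x` with the point of the geodesic at the
  -- limit parameter `a`.
  obtain ⟨x, hx, φ, hφ, hlim⟩ := (hC i).isCompact.tendsto_subseq fun n => (ht n).2
  have hta' := hta.comp hφ.tendsto_atTop
  have hRlip : ∀ s ∈ Icc 0 L, ∀ t ∈ Icc 0 L, |R s - R t| ≤ |s - t| := by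
    intro s hs t ht
    have h1 := cosh_sub_le_coneCosh (hR s hs).1 (hR t ht).1 (Θ s) (Θ t)
    rw [hg s hs t ht] at h1
    exact Real.cosh_le_cosh.1 h1
  have hRlim : Filter.Tendsto (fun n => R (t (φ n))) Filter.atTop (nhds (R a)) := by
    rw [tendsto_iff_dist_tendsto_zero] at hta' ⊢
    refine squeeze_zero (fun _ => dist_nonneg) (fun n => ?_) hta'
    exact hRlip _ (ht (φ n)).1 _ ha
  have hmx : m z x = R a := by
    have h1 := (hmc.tendsto x).comp hlim
    refine tendsto_nhds_unique h1 (hRlim.congr fun n => ?_)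
    exact (h.radial _ (hR _ (ht (φ n)).1) _).symm
  obtain ⟨ψ, hψ⟩ := h.exists_polar x (hmx ▸ (hR a ha).2)
  rw [hmx] at hψ
  have h1 : coneCosh κ (R a) (Θ a) (R a) ψ ≤ 1 := by
    have h2 : ∀ n, coneCosh κ (R a) (Θ a) (R a) ψ ≤
        Real.cosh (|a - t (φ n)| + m (e (R (t (φ n))) (Θ (t (φ n)))) x) := by
      intro n
      refine coneCosh_triangle (hR a ha).1 (hR a ha).1 _ (Θ (t (φ n))) _ (abs_nonneg _)
        (dist_nonneg.trans (hm1 _ _)) (hR _ (ht (φ n)).1).1 ?_ ?_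
      · rw [hg _ ha _ (ht (φ n)).1, Real.cosh_abs]
      · rw [← h.cosh_eq i _ (hR _ (ht (φ n)).1) _ (hR a ha) _ _ (ht (φ n)).2 (hψ ▸ hx), hψ]
    have h3 : Filter.Tendsto (fun n => m (e (R (t (φ n))) (Θ (t (φ n)))) x) Filter.atTop
        (nhds 0) := by
      have h4 := (tendsto_iff_dist_tendsto_zero.1 hlim).const_mul K
      rw [mul_zero] at h4
      exact squeeze_zero (fun n => dist_nonneg.trans (hm1 _ _)) (fun n => hm2 _ _) h4
    have h5 : Filter.Tendsto (fun n => |a - t (φ n)|) Filter.atTop (nhds 0) := by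
      have := (tendsto_const_nhds (x := a)).sub hta'
      rw [sub_self] at this
      simpa using this.abs
    have h6 := (Real.continuous_cosh.tendsto _).comp (h5.add h3)
    rw [add_zero, Real.cosh_zero] at h6
    exact ge_of_tendsto' h6 h2
  obtain ⟨-, h2⟩ := coneCosh_eq_one (hR a ha).1 (hR a ha).1
    (le_antisymm h1 (one_le_coneCosh (hR a ha).1 (hR a ha).1 _ _))
  have h3 : e (R a) (Θ a) = x := by
    rcases h2 with h2 | h2
    · rw [← hψ, h2, h.apex hm1, h.apex hm1]
    · rw [h2, hψ]
  exact ⟨ha, h3 ▸ hx⟩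

/-- Chains realize the distances in the cone. -/
lemma exists_chain_of_cosh [CompactSpace X] [Finite ι] (h : IsCellChart C m z κ ρ e)
    (hC : ∀ i, IsClosed (C i)) (hcov : ∀ x, ∃ i, x ∈ C i) {K : ℝ}
    (hm1 : ∀ x y, dist x y ≤ m x y) (hm2 : ∀ x y, m x y ≤ K * dist x y)
    (hmc : Continuous (m z)) {r r' : ℝ} (hr : r ∈ Ico 0 ρ) (hr' : r' ∈ Ico 0 ρ)
    (θ θ' : AddCircle κ) : ∃ L ≥ 0, Real.cosh L = coneCosh κ r θ r' θ' ∧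
      Chain C m (e r θ) (e r' θ') L := by
  have hm0 : ∀ x y, 0 ≤ m x y := fun x y => dist_nonneg.trans (hm1 x y)
  obtain ⟨L, R, Θ, hL, hR0, hΘ0, hRL, hΘL, hR, hg⟩ := exists_cone_geodesic h.1 hr hr' θ θ'
  cases nonempty_fintype ι
  -- Inside one cell `m` is the cone distance, so the pieces of the geodesic have total length
  -- exactly `L`.
  have key := interval_cover_induction (α := ℝ) (a := 0) (b := L)
    (T := fun i => {t | t ∈ Icc 0 L ∧ e (R t) (Θ t) ∈ C i})
    (Q := fun s t => Chain C m (e (R s) (Θ s)) (e (R t) (Θ t)) (t - s))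
    (by
      intro s t u h1 h2
      have := h1.trans h2
      rwa [show t - s + (u - t) = u - s by ring] at this)
    (fun i => h.isClosed_geodesic_mem hC hm1 hm2 hmc hR hg i)
    (by
      intro i s hs t ht _ _ hst
      have h1 : m (e (R s) (Θ s)) (e (R t) (Θ t)) = t - s := by
        refine cosh_inj_of_nonneg (hm0 _ _) (sub_nonneg.2 hst) ?_
        rw [h.cosh_eq i _ (hR s hs.1) _ (hR t ht.1) _ _ hs.2 ht.2, hg s hs.1 t ht.1,
          ← Real.cosh_neg, neg_sub]
      rw [← h1]
      exact Chain.single hs.2 ht.2)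
    hL Finset.univ (by
      intro t ht
      obtain ⟨i, hi⟩ := hcov (e (R t) (Θ t))
      exact mem_iUnion₂.2 ⟨i, Finset.mem_univ i, ht, hi⟩)
  have h0 := hg 0 ⟨le_rfl, hL⟩ L ⟨hL, le_rfl⟩
  rw [zero_sub, Real.cosh_neg, hR0, hΘ0, hRL] at h0
  rw [sub_zero, hR0, hΘ0, hRL] at key
  refine ⟨L, hL, ?_⟩
  rcases hΘL with h1 | rfl
  · rw [← h1]
    exact ⟨h0.symm, key⟩
  · rw [h.apex hm1] at key ⊢
    rw [coneCosh_zero_right] at h0 ⊢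
    exact ⟨h0.symm, key⟩

end IsCellChart

end Chain

section Assembly

variable {X Y ι : Type*} [MetricSpace X] [MetricSpace Y]
  {C : ι → Set X} {m : X → X → ℝ} {f : X ≃ Y} {K : ℝ}

lemma dist_le_chainDist (hf : ∀ x y, IsGLB {s | Chain C m x y s} (dist (f x) (f y)))
    (hm1 : ∀ x y, dist x y ≤ m x y) (x y : X) : dist x y ≤ dist (f x) (f y) :=
  (hf x y).2 fun _ hs => Chain.dist_le hm1 hs

lemma chainDist_le_mul_dist [Finite ι] (hf : ∀ x y, IsGLB {s | Chain C m x y s} (dist (f x) (f y)))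
    (hI : IsIntrinsic X) (hC : ∀ i, IsClosed (C i)) (hcov : ∀ x, ∃ i, x ∈ C i) (hK : 0 < K)
    (hm1 : ∀ x y, dist x y ≤ m x y) (hm2 : ∀ x y, m x y ≤ K * dist x y) (x y : X) :
    dist (f x) (f y) ≤ K * dist x y := by
  refine le_of_forall_gt fun s hs => ?_
  obtain ⟨s', hs', h⟩ := exists_between hs
  obtain ⟨σ, hσ, hch⟩ := exists_chain_le hI hC hcov hK (fun x y => dist_nonneg.trans (hm1 x y))
    hm2 x y hs'
  exact ((hf x y).1 hch).trans_lt (hσ.trans_lt h)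

/-- The cell charts are cone charts for the metric assembled from the cells. -/
lemma IsCellChart.isConeChart [CompactSpace X] [Finite ι] {z : X} {κ ρ : ℝ} {e : ℝ → AddCircle κ → X}
    (h : IsCellChart C m z κ ρ e)
    (hf : ∀ x y, IsGLB {s | Chain C m x y s} (dist (f x) (f y)))
    (hC : ∀ i, IsClosed (C i)) (hcov : ∀ x, ∃ i, x ∈ C i) (hK : 1 ≤ K)
    (hm1 : ∀ x y, dist x y ≤ m x y) (hm2 : ∀ x y, m x y ≤ K * dist x y)
    (hmc : Continuous (m z)) : IsConeChart (f z) κ (ρ / (3 * K)) fun r θ => f (e r θ) := by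
  have hρ := h.radius_pos
  have hρK : ρ / K ≤ ρ := div_le_self hρ.le hK
  have hρ3 : ρ / (3 * K) = ρ / K / 3 := by rw [div_div, mul_comm]
  have hρK0 : 0 < ρ / K := by positivity
  have hdist : ∀ x y, dist x y ≤ dist (f x) (f y) := dist_le_chainDist hf hm1
  have hup : ∀ r ∈ Ico 0 ρ, ∀ r' ∈ Ico 0 ρ, ∀ θ θ',
      Real.cosh (dist (f (e r θ)) (f (e r' θ'))) ≤ coneCosh κ r θ r' θ' := by
    intro r hr r' hr' θ θ'
    obtain ⟨L, hL, h1, h2⟩ := h.exists_chain_of_cosh hC hcov hm1 hm2 hmc hr hr' θ θ'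
    rw [← h1, cosh_le_iff_of_nonneg dist_nonneg hL]
    exact (hf _ _).1 h2
  -- For radii below `ρ / (3 * K)` the cone distance is at most `r + r' < ρ / K - r`, so chains
  -- leaving the chart are too long to compete. This is where the 3 comes from.
  have hlow : ∀ r ∈ Ico 0 ρ, ∀ r' ∈ Ico 0 ρ, ∀ θ θ', ∀ b ≥ 0, b ≤ ρ / K - r →
      Real.cosh b ≤ coneCosh κ r θ r' θ' → b ≤ dist (f (e r θ)) (f (e r' θ')) := by
    intro r hr r' hr' θ θ' b hb0 hb hb'
    refine (hf _ _).2 fun s hs => ?_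
    have hs0 : 0 ≤ s := dist_nonneg.trans (hs.dist_le hm1)
    rcases h.coneCosh_le_of_chain (by linarith) hcov hm1 hm2 hr hr' θ θ' hs with h1 | h1
    · exact (cosh_le_iff_of_nonneg hb0 hs0).1 (hb'.trans h1)
    · linarith
  have hsmall : ∀ r ∈ Ico 0 (ρ / (3 * K)), r ∈ Ico 0 ρ := fun r hr => ⟨hr.1, by linarith [hr.2]⟩
  have hrad : ∀ r ∈ Ico 0 ρ, ∀ θ, dist (f z) (f (e r θ)) ≤ r := by
    intro r hr θ
    have h1 := hup 0 ⟨le_rfl, hρ⟩ r hr θ θ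
    rw [h.apex hm1, coneCosh_zero_left, cosh_le_iff_of_nonneg dist_nonneg hr.1] at h1
    exact h1
  refine ⟨h.angle_pos, by positivity, fun θ => congrArg f (h.apex hm1 θ), ?_, ?_⟩
  · ext x
    constructor
    · rintro ⟨r, hr, θ, rfl⟩
      rw [Metric.mem_ball, dist_comm]
      exact (hrad r (hsmall r hr) θ).trans_lt hr.2
    · intro hx
      obtain ⟨x, rfl⟩ := f.surjective x
      rw [Metric.mem_ball, dist_comm] at hx
      have h1 : m z x < ρ := by
        have h2 := hm2 z x
        have h3 : dist z x < ρ / K := (hdist z x).trans_lt (by linarith)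
        rw [lt_div_iff₀ (by linarith)] at h3
        linarith
      obtain ⟨θ, hθ⟩ := h.exists_polar x h1
      refine ⟨m z x, ⟨dist_nonneg.trans (hm1 _ _), ?_⟩, θ, congrArg f hθ⟩
      have hr : m z x ∈ Ico 0 ρ := ⟨dist_nonneg.trans (hm1 _ _), h1⟩
      by_contra hge
      push Not at hge
      have h3 := hlow 0 ⟨le_rfl, hρ⟩ _ hr θ θ (ρ / (3 * K)) (by positivity) (by linarith) (by
        rw [coneCosh_zero_left, cosh_le_iff_of_nonneg (by positivity) hr.1]; exact hge)
      rw [h.apex hm1, hθ] at h3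
      linarith
  · intro r hr r' hr' θ θ'
    refine le_antisymm (hup r (hsmall r hr) r' (hsmall r' hr') θ θ') ?_
    have hc1 := one_le_coneCosh hr.1 hr'.1 θ θ'
    have h2 : Real.arcosh (coneCosh κ r θ r' θ') ≤ r + r' := by
      rw [← cosh_le_iff_of_nonneg (Real.arcosh_nonneg hc1) (add_nonneg hr.1 hr'.1),
        Real.cosh_arcosh hc1]
      exact coneCosh_le_cosh_add hr.1 hr'.1 θ θ'
    have h3 := hlow r (hsmall r hr) r' (hsmall r' hr') θ θ' _ (Real.arcosh_nonneg hc1)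
      (by linarith [hr.2, hr'.2]) (Real.cosh_arcosh hc1).le
    rwa [← cosh_le_iff_of_nonneg (Real.arcosh_nonneg hc1) dist_nonneg,
      Real.cosh_arcosh hc1] at h3

end Assembly

section Intrinsic

variable {Y : Type*} [MetricSpace Y]

/-- Points of a cone ball are joined by geodesics. -/
lemma IsConeChart.exists_geodesic {p : Y} {κ ρ : ℝ} {e : ℝ → AddCircle κ → Y}
    (h : IsConeChart p κ ρ e) {x y : Y} (hx : x ∈ Metric.ball p ρ) (hy : y ∈ Metric.ball p ρ) :
    ∃ γ : Path x y, pathLength γ ≤ edist x y := by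
  obtain ⟨θ, hθ⟩ := h.exists_polar hx
  obtain ⟨θ', hθ'⟩ := h.exists_polar hy
  have hr : dist x p ∈ Ico 0 ρ := ⟨dist_nonneg, hx⟩
  have hr' : dist y p ∈ Ico 0 ρ := ⟨dist_nonneg, hy⟩
  obtain ⟨L, R, Θ, hL, hR0, hΘ0, hRL, hΘL, hR, hg⟩ := exists_cone_geodesic h.1 hr hr' θ θ'
  have hd : ∀ s ∈ Icc 0 L, ∀ t ∈ Icc 0 L,
      dist (e (R s) (Θ s)) (e (R t) (Θ t)) = |s - t| := by
    intro s hs t ht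
    refine cosh_inj_of_nonneg dist_nonneg (abs_nonneg _) ?_
    rw [h.cosh_dist (hR s hs) (hR t ht), hg s hs t ht, Real.cosh_abs]
  have hmem : ∀ t : unitInterval, (t : ℝ) * L ∈ Icc 0 L := fun t =>
    ⟨mul_nonneg t.2.1 hL, mul_le_of_le_one_left hL t.2.2⟩
  have hl : ∀ s t : unitInterval, dist (e (R (s * L)) (Θ (s * L))) (e (R (t * L)) (Θ (t * L))) ≤
      L.toNNReal * |(s : ℝ) - t| := by
    intro s t
    rw [hd _ (hmem s) _ (hmem t), ← sub_mul, abs_mul, abs_of_nonneg hL, Real.coe_toNNReal _ hL,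
      mul_comm]
  have hc : Continuous fun t : unitInterval => e (R (t * L)) (Θ (t * L)) := by
    have : LipschitzWith L.toNNReal fun t : unitInterval => e (R (t * L)) (Θ (t * L)) :=
      LipschitzWith.of_dist_le_mul fun s t => hl s t
    exact this.continuous
  have h0 : e (R 0) (Θ 0) = x := by rw [hR0, hΘ0, hθ]
  have h1 : e (R L) (Θ L) = y := by
    rw [hRL]
    rcases hΘL with h1 | h1
    · rw [h1, hθ']
    · rw [h1] at hθ' ⊢
      rw [h.2.2.1] at hθ' ⊢
      exact hθ'
  refine ⟨⟨⟨_, hc⟩, by simpa using h0, by simpa using h1⟩, ?_⟩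
  refine (pathLength_le_of_lipschitz (C := L.toNNReal) _ hl).trans ?_
  have h2 := hd 0 ⟨le_rfl, hL⟩ L ⟨hL, le_rfl⟩
  rw [h0, h1, zero_sub, abs_neg, abs_of_nonneg hL] at h2
  rw [edist_dist, h2]
  rfl

end Intrinsic

section Assembly

variable {X Y ι : Type*} [MetricSpace Y] {C : ι → Set X} {m : X → X → ℝ} {f : X ≃ Y}

/-- Each step of a chain stays in a cell inside a cone ball and can be replaced there by a geodesic
that is no longer than its `m`-length; so almost minimal chains yield almost shortest paths. -/
lemma isIntrinsic_of_chain (hf : ∀ x y, IsGLB {s | Chain C m x y s} (dist (f x) (f y)))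
    (hne : ∀ x y, ∃ s, Chain C m x y s)
    (hsmall : ∀ i, ∃ p κ ρ e, IsConeChart (X := Y) p κ ρ e ∧ f '' C i ⊆ Metric.ball p ρ) :
    IsIntrinsic Y := by
  intro x y
  obtain ⟨x, rfl⟩ := f.surjective x
  obtain ⟨y, rfl⟩ := f.surjective y
  refine le_antisymm (le_iInf fun γ => ?_) ?_
  · have := edist_le_pathLength γ 0 1
    rwa [γ.source, γ.target] at this
  have key : ∀ y s, Chain C m x y s → 0 ≤ s ∧
      ∃ γ : Path (f x) (f y), pathLength γ ≤ ENNReal.ofReal s := by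
    intro y s h
    induction h with
    | refl => exact ⟨le_rfl, Path.refl _,
        (pathLength_le_of_lipschitz (C := 0) _ (by simp)).trans (by simp)⟩
    | step i hc hy hw hs ih =>
      rename_i y w s s'
      obtain ⟨hs0, γ, hγ⟩ := ih
      obtain ⟨p, κ, ρ, e, hch, hsub⟩ := hsmall i
      obtain ⟨γ', hγ'⟩ := hch.exists_geodesic (hsub ⟨y, hy, rfl⟩) (hsub ⟨w, hw, rfl⟩)
      have h1 : dist (f y) (f w) ≤ m y w := (hf y w).1 (Chain.single hy hw)
      have h2 : 0 ≤ m y w := dist_nonneg.trans h1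
      refine ⟨by rw [hs]; positivity, γ.trans γ', (pathLength_trans_le _ _).trans ?_⟩
      rw [hs, ENNReal.ofReal_add hs0 h2]
      refine add_le_add hγ (hγ'.trans ?_)
      rw [edist_dist]
      exact ENNReal.ofReal_le_ofReal h1
  refine le_of_forall_gt fun b hb => ?_
  rw [edist_dist] at hb
  by_cases hbt : b = ∞
  · obtain ⟨s, hs⟩ := hne x y
    obtain ⟨-, γ, hγ⟩ := key y s hs
    exact (iInf_le_of_le γ hγ).trans_lt (by rw [hbt]; exact ENNReal.ofReal_lt_top)
  · rw [ENNReal.ofReal_lt_iff_lt_toReal dist_nonneg hbt] at hb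
    obtain ⟨s, hs, -, hsb⟩ := (hf x y).exists_between hb
    obtain ⟨hs0, γ, hγ⟩ := key y s hs
    exact (iInf_le_of_le γ hγ).trans_lt ((ENNReal.ofReal_lt_iff_lt_toReal hs0 hbt).2 hsb)

end Assembly

section Assembly

/-- The properties of a metric given by the lengths of chains. -/
lemma properties_of_chain_metric {X Y ι : Type*} [MetricSpace X] [MetricSpace Y] [CompactSpace X]
    [Finite ι] {C : ι → Set X} {m : X → X → ℝ} {K : ℝ} (hI : IsIntrinsic X)
    (hC : ∀ i, IsClosed (C i)) (hcov : ∀ x, ∃ i, x ∈ C i) (hK : 1 ≤ K)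
    (hm1 : ∀ x y, dist x y ≤ m x y) (hm2 : ∀ x y, m x y ≤ K * dist x y)
    (hmc : ∀ z, Continuous (m z)) {κ ρ : X → ℝ} {e : ∀ z, ℝ → AddCircle (κ z) → X}
    (hch : ∀ z, IsCellChart C m z (κ z) (ρ z) (e z))
    (hsmall : ∀ i, ∃ z, ∀ x ∈ C i, dist x z ≤ ρ z / (6 * K ^ 2)) {f : X ≃ Y}
    (hf : ∀ x y, IsGLB {s | Chain C m x y s} (dist (f x) (f y))) :
    Topology.IsInducing f ∧ (∀ x y, dist x y ≤ dist (f x) (f y)) ∧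
      (∀ x y, dist (f x) (f y) ≤ K * dist x y) ∧ IsIntrinsic Y ∧
      ∀ z, HasConeAngle (f z) (κ z) := by
  have hK0 : 0 < K := by linarith
  have hm0 : ∀ x y, 0 ≤ m x y := fun x y => dist_nonneg.trans (hm1 x y)
  have hdD := dist_le_chainDist hf hm1
  have hDK := chainDist_le_mul_dist hf hI hC hcov hK0 hm1 hm2
  have hcone := fun z => (hch z).isConeChart hf hC hcov hK hm1 hm2 (hmc z)
  refine ⟨?_, hdD, hDK, ?_, fun z => hasConeAngle_iff.2 ⟨_, _, hcone z⟩⟩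
  · have h1 : LipschitzWith K.toNNReal f := LipschitzWith.of_dist_le_mul fun x y => by
      rw [Real.coe_toNNReal _ hK0.le]; exact hDK x y
    have h2 : AntilipschitzWith 1 f := AntilipschitzWith.of_le_mul_dist fun x y => by
      simpa using hdD x y
    exact (h2.isUniformInducing h1.uniformContinuous).isInducing
  · refine isIntrinsic_of_chain hf (fun x y => ?_) fun i => ?_
    · obtain ⟨s, -, hs⟩ := exists_chain_le hI hC hcov hK0 hm0 hm2 x y (lt_add_one _)
      exact ⟨s, hs⟩
    · obtain ⟨z, hz⟩ := hsmall i
      refine ⟨f z, κ z, _, _, hcone z, ?_⟩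
      rintro _ ⟨x, hx, rfl⟩
      have h1 := hz x hx
      have h2 := hDK x z
      have h3 : K * (ρ z / (6 * K ^ 2)) = ρ z / (3 * K) / 2 := by field_simp; ring
      have h4 : 0 < ρ z / (3 * K) := by
        have := (hch z).radius_pos
        positivity
      have h5 : K * dist x z ≤ K * (ρ z / (6 * K ^ 2)) := by gcongr
      rw [Metric.mem_ball]
      linarith

/-- A function that is comparable to the distance, and is locally the distance in a cone for pairs
of points in the same cell of a finite closed cover, induces an intrinsic metric with these
cones. -/
lemma exists_metric_of_cells {X ι : Type*} [mX : MetricSpace X] [CompactSpace X] [Finite ι]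
    {C : ι → Set X} {m : X → X → ℝ} {K : ℝ} (hI : IsIntrinsic X) (hC : ∀ i, IsClosed (C i))
    (hcov : ∀ x, ∃ i, x ∈ C i) (hK : 1 ≤ K) (hsymm : ∀ x y, m x y = m y x)
    (hm1 : ∀ x y, dist x y ≤ m x y) (hm2 : ∀ x y, m x y ≤ K * dist x y)
    (hmc : ∀ z, Continuous (m z)) {κ : X → ℝ} (hch : ∀ z, ∃ ρ e, IsCellChart C m z (κ z) ρ e) :
    ∃ M : MetricSpace X,
      M.toPseudoMetricSpace.toUniformSpace.toTopologicalSpace =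
        mX.toPseudoMetricSpace.toUniformSpace.toTopologicalSpace ∧
      (∀ x y, mX.dist x y ≤ M.dist x y) ∧ (∀ x y, M.dist x y ≤ K * mX.dist x y) ∧
      @IsIntrinsic X M ∧ ∀ z, @HasConeAngle X M z (κ z) := by
  choose ρ e hch using hch
  have hK0 : 0 < K := by linarith
  have hr0 : ∀ z, 0 < ρ z / (6 * K ^ 2) := fun z => by
    have := (hch z).radius_pos
    positivity
  obtain ⟨N, hN⟩ := isCompact_univ.elim_finite_subcover
    (fun z : X => Metric.ball z (ρ z / (6 * K ^ 2))) (fun _ => Metric.isOpen_ball)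
    fun x _ => mem_iUnion.2 ⟨x, Metric.mem_ball_self (hr0 x)⟩
  -- The cells are cut by small balls so that each piece lies in a cone ball of the new metric:
  -- points within `ρ / (6 * K ^ 2)` have new distance at most `ρ / (6 * K)`, less than the chart
  -- radius `ρ / (3 * K)`.
  set C' : ι × N → Set X := fun i => C i.1 ∩ Metric.closedBall i.2.1 (ρ i.2.1 / (6 * K ^ 2))
    with hC'def
  have hC' : ∀ i, IsClosed (C' i) := fun i => (hC _).inter Metric.isClosed_closedBall
  have hcov' : ∀ x, ∃ i, x ∈ C' i := by
    intro x
    obtain ⟨i, hi⟩ := hcov x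
    obtain ⟨z, hz, hx⟩ := mem_iUnion₂.1 (hN (mem_univ x))
    exact ⟨(i, ⟨z, hz⟩), hi, Metric.ball_subset_closedBall hx⟩
  have hch' : ∀ z, IsCellChart C' m z (κ z) (ρ z) (e z) := fun z =>
    (hch z).mono fun i => ⟨i.1, inter_subset_left⟩
  have hm0 : ∀ x y, 0 ≤ m x y := fun x y => dist_nonneg.trans (hm1 x y)
  have hglb : ∀ x y, IsGLB {s | Chain C' m x y s} (sInf {s | Chain C' m x y s}) := by
    intro x y
    obtain ⟨s, -, hs⟩ := exists_chain_le hI hC' hcov' hK0 hm0 hm2 x y (lt_add_one _)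
    exact isGLB_csInf ⟨s, hs⟩ ⟨0, fun s hs => dist_nonneg.trans (Chain.dist_le hm1 hs)⟩
  have hdD : ∀ x y, dist x y ≤ sInf {s | Chain C' m x y s} := fun x y =>
    (hglb x y).2 fun _ hs => Chain.dist_le hm1 hs
  have hM : ∃ M : MetricSpace X, ∀ x y, M.dist x y = sInf {s | Chain C' m x y s} := by
    refine ⟨
      { dist := fun x y => sInf {s | Chain C' m x y s}
        dist_self := fun x => le_antisymm ((hglb x x).1 Chain.refl) (by simpa using hdD x x)
        dist_comm := fun x y => by
          have : {s | Chain C' m x y s} = {s | Chain C' m y x s} :=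
            Set.ext fun s => ⟨Chain.symm hsymm, Chain.symm hsymm⟩
          simp only [this]
        dist_triangle := fun x y w => by
          refine le_of_forall_pos_lt_add fun ε hε => ?_
          obtain ⟨s, hs, -, hs'⟩ := (hglb x y).exists_between (lt_add_of_pos_right _ (half_pos hε))
          obtain ⟨t, ht, -, ht'⟩ := (hglb y w).exists_between (lt_add_of_pos_right _ (half_pos hε))
          have := (hglb x w).1 (Chain.trans hs ht)
          linarith
        eq_of_dist_eq_zero := fun {x y} h => dist_le_zero.1 ((hdD x y).trans h.le) },
      fun _ _ => rfl⟩
  obtain ⟨M, hM⟩ := hM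
  obtain ⟨h1, h2⟩ := @properties_of_chain_metric X X (ι × N) mX M _ _ C' m K hI hC' hcov' hK hm1
    hm2 hmc κ ρ e hch' (fun i => ⟨i.2.1, fun x hx => hx.2⟩) (Equiv.refl X) (by
      intro x y
      have := hglb x y
      rwa [← hM] at this)
  exact ⟨M, ((@Topology.IsInducing.eq_induced X X
    mX.toPseudoMetricSpace.toUniformSpace.toTopologicalSpace
    M.toPseudoMetricSpace.toUniformSpace.toTopologicalSpace _ h1).trans induced_id).symm, h2⟩

end Assembly

section Net

open Filter Topology

variable {X : Type*} [MetricSpace X]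

/-! ### Sites -/

/-- Arbitrarily dense finite sets of sites, containing the cone-points, such that every other point
sees its nearest sites within a cone chart. -/
lemma exists_sites [CompactSpace X] [Nonempty X] (h : ∀ p : X, ∃ κ ≤ 2 * Real.pi, HasConeAngle p κ)
    {τ : ℝ} (hτ : 0 < τ) : ∃ Y : Set X, Y.Finite ∧ conePoints X ⊆ Y ∧ Y.Nonempty ∧
      (∀ x, Metric.infDist x Y ≤ τ) ∧ ∀ z ∉ Y, ∃ ρ E, IsConeChart z (2 * Real.pi) ρ E ∧
        ∀ y ∈ Y, dist z y = Metric.infDist z Y → ∃ θy, ∃ r₁ > 0, ∀ r ∈ Ico 0 r₁, ∀ θ,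
          Real.cosh (dist (E r θ) y) = Real.cosh (dist z y) * Real.cosh r -
            Real.sinh (dist z y) * Real.sinh r * Real.cos ‖θ - θy‖ := by
  have hπ := Real.pi_pos
  set V := conePoints X with hV
  have hVfin : V.Finite := finite_conePoints h
  choose κ hκ hang using h
  choose ρ e hc using fun p => hasConeAngle_iff.1 (hang p)
  have hκV : ∀ v ∈ V, κ v < 2 * Real.pi := fun v hv => by
    refine lt_of_le_of_ne (hκ v) fun he => hv ?_
    rw [← he]; exact hang v
  have hVsep : ∀ v, ∀ v' ∈ V, v' ≠ v → ρ v ≤ dist v' v := by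
    intro v v' hv' hne
    by_contra! hlt
    exact hv' ((hc v).hasConeAngle_two_pi (hκ v) hlt hne)
  obtain ⟨s, hs, hs0, hsτ⟩ : ∃ s, (∀ v ∈ V, 8 * s < ρ v) ∧ 0 < s ∧ s < τ := by
    have h1 : ∀ᶠ s : ℝ in 𝓝[>] 0, ∀ v ∈ V, 8 * s < ρ v := by
      rw [eventually_all_finite hVfin]
      intro v _
      refine eventually_nhdsWithin_of_eventually_nhds ?_
      have hcont : Continuous fun s : ℝ => 8 * s := by fun_prop
      refine hcont.continuousAt.eventually (gt_mem_nhds ?_)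
      simpa using (hc v).2.1
    obtain ⟨s, h1, h2⟩ := (h1.and (Ioo_mem_nhdsGT hτ)).exists
    exact ⟨s, h1, h2⟩
  set G : Set X := {x | ∀ v ∈ V, s ≤ dist x v} with hG
  have hGc : IsCompact G := by
    refine IsClosed.isCompact ?_
    have : G = ⋂ v ∈ V, {x | s ≤ dist x v} := by ext x; simp [hG]
    rw [this]
    exact isClosed_biInter fun v _ => isClosed_le continuous_const (by fun_prop)
  have hsm : ∀ p : {p : X // p ∉ V}, HasConeAngle p.1 (2 * Real.pi) := fun p => not_not.1 p.2
  choose ρ' e' hc' using fun p => hasConeAngle_iff.1 (hsm p)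
  obtain ⟨l, hl, hleb⟩ := lebesgue_number_lemma_of_metric hGc
    (c := fun p : {p : X // p ∉ V} => Metric.ball p.1 (ρ' p)) (fun _ => Metric.isOpen_ball)
    (fun x hx => mem_iUnion.2 ⟨⟨x, fun hxV => by
      have := hx x hxV
      rw [dist_self] at this
      linarith⟩, Metric.mem_ball_self (hc' _).2.1⟩)
  have hcosκ : ∀ v ∈ V, 0 < 1 - Real.cos (κ v / 2) := fun v hv => by
    have h1 := (hc v).1
    have h2 := hκV v hv
    have := Real.cos_lt_cos_of_nonneg_of_le_pi le_rfl (by linarith : κ v / 2 ≤ Real.pi)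
      (by linarith : 0 < κ v / 2)
    rw [Real.cos_zero] at this
    linarith
  -- The net outside the `s`-balls around the cone-points is chosen so fine that a point near a
  -- cone-point `v` has a nearer site than any site exactly opposite to it with respect to `v`.
  obtain ⟨η, hη, hη0, hητ, hηl⟩ : ∃ η, (∀ v ∈ V, Real.cosh s * (Real.cosh η - 1) +
      Real.sinh s * Real.sinh η < Real.sinh (s / 2) * Real.sinh s * (1 - Real.cos (κ v / 2))) ∧
      0 < η ∧ η < τ ∧ η < l := by
    have h1 : ∀ᶠ η : ℝ in 𝓝[>] 0, ∀ v ∈ V, Real.cosh s * (Real.cosh η - 1) +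
      Real.sinh s * Real.sinh η < Real.sinh (s / 2) * Real.sinh s * (1 - Real.cos (κ v / 2)) := by
      rw [eventually_all_finite hVfin]
      intro v hv
      refine eventually_nhdsWithin_of_eventually_nhds ?_
      have hcont : Continuous fun η : ℝ => Real.cosh s * (Real.cosh η - 1) +
        Real.sinh s * Real.sinh η := by fun_prop
      refine hcont.continuousAt.eventually (gt_mem_nhds ?_)
      have h2 := Real.sinh_pos_iff.2 hs0
      have h3 := Real.sinh_pos_iff.2 (half_pos hs0)
      have h4 := hcosκ v hv
      simp only [Real.cosh_zero, Real.sinh_zero, sub_self, mul_zero, add_zero]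
      positivity
    obtain ⟨η, ⟨h1, h2⟩, h3⟩ := ((h1.and (Ioo_mem_nhdsGT hτ)).and (Ioo_mem_nhdsGT hl)).exists
    exact ⟨η, h1, h2.1, h2.2, h3.2⟩
  obtain ⟨N, hNG, hNfin, hN⟩ := hGc.finite_cover_balls hη0
  have hnear : ∀ x ∈ G, ∃ n ∈ N, dist x n < η := fun x hx => by
    obtain ⟨n, hn, hxn⟩ := mem_iUnion₂.1 (hN hx)
    exact ⟨n, hn, hxn⟩
  have hGV : ∀ x, x ∉ G → ∃ v ∈ V, dist x v < s := fun x hx => by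
    simpa [hG] using hx
  have hdense : ∀ x : X, ∃ y ∈ V ∪ N, dist x y ≤ τ := by
    intro x
    by_cases hx : x ∈ G
    · obtain ⟨n, hn, hxn⟩ := hnear x hx
      exact ⟨n, Or.inr hn, by linarith⟩
    · obtain ⟨v, hv, hxv⟩ := hGV x hx
      exact ⟨v, Or.inl hv, by linarith⟩
  refine ⟨V ∪ N, hVfin.union hNfin, subset_union_left, ?_, fun x => ?_, fun z hz => ?_⟩
  · obtain ⟨y, hy, -⟩ := hdense (Classical.arbitrary X)
    exact ⟨y, hy⟩
  · obtain ⟨y, hy, hxy⟩ := hdense x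
    exact (Metric.infDist_le_dist_of_mem hy).trans hxy
  by_cases hzG : z ∈ G
  · obtain ⟨p, hp⟩ := hleb z hzG
    have hzp := hp (Metric.mem_ball_self hl)
    obtain ⟨α, hα⟩ := (hc' p).exists_polar hzp
    obtain ⟨r₀, E, hE, hE'⟩ := (hc' p).recenter le_rfl (t := dist z p.1) ⟨dist_nonneg, hzp⟩ α
      (fun _ => rfl)
    rw [hα] at hE hE'
    refine ⟨r₀, E, hE, fun y hy hyz => ?_⟩
    obtain ⟨n, hn, hzn⟩ := hnear z hzG
    have hyl : dist y z < l := by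
      have h1 : Metric.infDist z (V ∪ N) ≤ dist z n := Metric.infDist_le_dist_of_mem (Or.inr hn)
      rw [dist_comm]
      linarith
    have hyp := hp hyl
    obtain ⟨α', hα'⟩ := (hc' p).exists_polar hyp
    have := hE' (dist y p.1) ⟨dist_nonneg, hyp⟩ α' (Or.inl rfl)
    rwa [hα'] at this
  · obtain ⟨v, hv, hzv⟩ := hGV z hzG
    have h8 := hs v hv
    have hzv' : z ≠ v := by rintro rfl; exact hz (Or.inl hv)
    have hzball : dist z v ∈ Ico 0 (ρ v) := ⟨dist_nonneg, by linarith⟩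
    obtain ⟨α, hα⟩ := (hc v).exists_polar (x := z) hzball.2
    obtain ⟨r₀, E, hE, hE'⟩ := (hc v).recenter (hκ v) hzball α
      (fun h0 => absurd (dist_eq_zero.1 h0) hzv')
    rw [hα] at hE hE'
    refine ⟨r₀, E, hE, fun y hy hyz => ?_⟩
    have hyt : dist z y ≤ dist z v := hyz.le.trans (Metric.infDist_le_dist_of_mem (Or.inl hv))
    by_cases hyv : y = v
    · have := hE' 0 (hc v).zero_mem α (Or.inr (by simpa using (hc v).1))
      rw [(hc v).2.2.1] at this
      rwa [hyv]
    have hyv2 : dist y v ≤ 2 * dist z v := by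
      have := dist_triangle y z v
      rw [dist_comm y z] at this
      linarith
    have hyball : dist y v ∈ Ico 0 (ρ v) := ⟨dist_nonneg, by linarith⟩
    have hyN : y ∈ N := hy.resolve_left fun hyV => by
      have := hVsep v y hyV hyv
      linarith [hyball.2]
    have hys : s ≤ dist y v := hNG hyN v hv
    obtain ⟨α', hα'⟩ := (hc v).exists_polar (x := y) hyball.2
    have h1 := hE' (dist y v) hyball α'
    rw [hα'] at h1
    refine h1 (Or.inr ?_)
    -- For an opposite site two shortest paths compete and the law of cosines would fail nearby. The
    -- point at distance `s` from `v` on the ray of `z` has a site within `η`, so `dist z y ≤ s - t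
    -- + η`. The law of cosines at the angle `κ v / 2` makes `dist z y` larger than that, by the
    -- choice of `η`.
    by_contra! hge
    have hκ0 := (hc v).1
    have hκ2 := hκV v hv
    have hnorm : ‖α' - α‖ = κ v / 2 := by
      refine le_antisymm ?_ hge
      have := AddCircle.norm_le_half_period (p := κ v) (x := α' - α) hκ0.ne'
      rwa [abs_of_pos hκ0] at this
    set t := dist z v with ht
    set t' := dist y v with ht'
    have hst : s / 2 ≤ t := by linarith
    have hD : Real.cosh (dist z y) = Real.cosh t * Real.cosh t' -
        Real.sinh t * Real.sinh t' * Real.cos (κ v / 2) := by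
      have := (hc v).cosh_dist hzball hyball α α'
      rw [hα, hα', coneCosh, norm_sub_rev, hnorm, min_eq_left (by linarith)] at this
      exact this
    have hsball : s ∈ Ico 0 (ρ v) := ⟨hs0.le, by linarith⟩
    have hxv := (hc v).dist_apex hsball α
    have hxG : e v s α ∈ G := by
      intro v' hv'
      rcases eq_or_ne v' v with rfl | hne
      · exact hxv.ge
      · have h2 := hVsep v v' hv' hne
        have h3 := dist_triangle v' (e v s α) v
        rw [dist_comm v' (e v s α)] at h3
        linarith
    have hzx : dist z (e v s α) = s - t := by
      refine cosh_inj_of_nonneg dist_nonneg (by linarith) ?_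
      have := (hc v).cosh_dist hzball hsball α α
      rw [hα, coneCosh_self_angle, ← Real.cosh_neg (t - s), neg_sub] at this
      exact this
    obtain ⟨n, hn, hxn⟩ := hnear _ hxG
    have hDle : dist z y ≤ (s - t) + η := by
      have h2 : dist z y ≤ dist z n := hyz.le.trans (Metric.infDist_le_dist_of_mem (Or.inr hn))
      have h3 := dist_triangle z (e v s α) n
      linarith
    have h5 := Real.cosh_le_cosh.2 (abs_le_abs_of_nonneg dist_nonneg hDle)
    have h6 : Real.cosh (s - t) ≤ Real.cosh (t' - t) := by
      rw [cosh_le_iff_of_nonneg (by linarith) (by linarith)]; linarith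
    have h7 : Real.cosh (s - t) ≤ Real.cosh s := by
      rw [cosh_le_iff_of_nonneg (by linarith) (by linarith)]; linarith
    have h8 : Real.sinh (s - t) ≤ Real.sinh s := Real.sinh_le_sinh.2 (by linarith)
    have h9 : Real.sinh (s / 2) * Real.sinh s ≤ Real.sinh t * Real.sinh t' :=
      mul_le_mul (Real.sinh_le_sinh.2 hst) (Real.sinh_le_sinh.2 hys)
        (Real.sinh_nonneg_iff.2 hs0.le) (Real.sinh_nonneg_iff.2 (by linarith))
    have h10 := mul_le_mul_of_nonneg_right h9 (hcosκ v hv).le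
    have h11 := hη v hv
    have h12 := mul_le_mul_of_nonneg_right h7 (sub_nonneg.2 (Real.one_le_cosh η))
    have h13 := mul_le_mul_of_nonneg_right h8 (Real.sinh_nonneg_iff.2 hη0.le)
    rw [Real.cosh_add] at h5
    have h14 := Real.cosh_sub t' t
    linarith

end Net

section Deformation

/-! ### Deformed distances -/

/-- The difference vanishes at 0 and has nonnegative derivative. This turns a comparison of
hyperbolic sines into a comparison of distances. -/
lemma mul_sinh_le_sinh_mul {K x : ℝ} (hK : 1 ≤ K) (hx : 0 ≤ x) :
    K * Real.sinh x ≤ Real.sinh (K * x) := by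
  have hd : ∀ x, HasDerivAt (fun x => Real.sinh (K * x) - K * Real.sinh x)
      (Real.cosh (K * x) * (K * 1) - K * Real.cosh x) x := fun x =>
    (((hasDerivAt_id x).const_mul K).sinh).sub ((Real.hasDerivAt_sinh x).const_mul K)
  have hm : Monotone fun x => Real.sinh (K * x) - K * Real.sinh x := by
    refine monotone_of_hasDerivAt_nonneg hd fun x => ?_
    have : Real.cosh x ≤ Real.cosh (K * x) := by
      rw [Real.cosh_le_cosh, abs_mul, abs_of_nonneg (by linarith : 0 ≤ K)]
      exact le_mul_of_one_le_left (abs_nonneg x) hK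
    have := mul_le_mul_of_nonneg_left this (by linarith : 0 ≤ K)
    simp only [Pi.zero_apply]
    linarith
  have := hm hx
  simp only [mul_zero, Real.sinh_zero, sub_zero] at this
  linarith

lemma cosh_sub_one (x : ℝ) : Real.cosh x - 1 = 2 * Real.sinh (x / 2) ^ 2 := by
  have := Real.cosh_two_mul (x / 2)
  rw [mul_div_cancel₀ x two_ne_zero] at this
  have h2 := Real.cosh_sq (x / 2)
  linarith

/-- Since `cosh x - cosh y = 2 sinh ((x + y) / 2) sinh ((x - y) / 2)`. It bounds the variation of
`siteHeight`, as the hypothesis `hb` of `deform_le` demands. -/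
lemma sq_cosh_sub_cosh_le {x y d M : ℝ} (hx : 0 ≤ x) (hy : 0 ≤ y) (hxM : x ≤ M) (hyM : y ≤ M)
    (hd : |x - y| ≤ d) :
    (Real.cosh x - Real.cosh y) ^ 2 ≤ 2 * Real.sinh M ^ 2 * (Real.cosh d - 1) := by
  have h1 : Real.cosh x - Real.cosh y = 2 * (Real.sinh ((x + y) / 2) * Real.sinh ((x - y) / 2)) := by
    have e1 := Real.cosh_add ((x + y) / 2) ((x - y) / 2)
    have e2 := Real.cosh_sub ((x + y) / 2) ((x - y) / 2)
    rw [show (x + y) / 2 + (x - y) / 2 = x by ring] at e1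
    rw [show (x + y) / 2 - (x - y) / 2 = y by ring] at e2
    linarith
  have h2 : Real.sinh ((x + y) / 2) ^ 2 ≤ Real.sinh M ^ 2 :=
    pow_le_pow_left₀ (Real.sinh_nonneg_iff.2 (by linarith)) (Real.sinh_le_sinh.2 (by linarith)) 2
  have h3 : 2 * Real.sinh ((x - y) / 2) ^ 2 ≤ Real.cosh d - 1 := by
    rw [← cosh_sub_one]
    have : Real.cosh (x - y) ≤ Real.cosh d := Real.cosh_le_cosh.2 (hd.trans (le_abs_self d))
    linarith
  have h4 : 0 ≤ Real.sinh M ^ 2 := sq_nonneg _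
  have h5 : 0 ≤ Real.sinh ((x - y) / 2) ^ 2 := sq_nonneg _
  rw [h1]
  calc (2 * (Real.sinh ((x + y) / 2) * Real.sinh ((x - y) / 2))) ^ 2
      = 2 * (Real.sinh ((x + y) / 2) ^ 2 * (2 * Real.sinh ((x - y) / 2) ^ 2)) := by ring
    _ ≤ 2 * (Real.sinh M ^ 2 * (Real.cosh d - 1)) := by gcongr
    _ = _ := by ring

variable {X : Type*} [MetricSpace X]

/-- The deformation of the distance by a function `a`: the distance of the points obtained from
the points of the hyperboloid by adding the coordinate `a` in an extra dimension and rescaling. -/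
noncomputable def deform (a : X → ℝ) (x x' : X) : ℝ :=
  Real.arcosh ((Real.cosh (dist x x') - a x * a x') / (√(1 - a x ^ 2) * √(1 - a x' ^ 2)))

variable {a : X → ℝ}

lemma deform_comm (a : X → ℝ) (x x' : X) : deform a x x' = deform a x' x := by
  rw [deform, deform, dist_comm, mul_comm (a x), mul_comm (√_)]

lemma sqrt_mul_sqrt_le {s t : ℝ} (hs : s ^ 2 < 1) (ht : t ^ 2 < 1) :
    √(1 - s ^ 2) * √(1 - t ^ 2) ≤ 1 - s * t := by
  have h1 : s * t ≤ 1 := by nlinarith [sq_nonneg (s - t)]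
  rw [← Real.sqrt_mul (by linarith)]
  refine Real.sqrt_le_iff.2 ⟨by linarith, ?_⟩
  nlinarith [sq_nonneg (s - t)]

/-- With `P` the product of the roots, the inequality says `(cosh - 1) * (1 - P) + (1 - a x * a x' -
P) ≥ 0`, where the last bracket is nonnegative by the reversed Cauchy–Schwarz inequality. So the
argument of `Real.arcosh` in `deform` is at least 1 and the deformation never shortens. -/
lemma cosh_dist_le_div (ha : ∀ x, a x ^ 2 < 1) (x x' : X) : Real.cosh (dist x x') ≤
    (Real.cosh (dist x x') - a x * a x') / (√(1 - a x ^ 2) * √(1 - a x' ^ 2)) := by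
  have h1 : 0 < √(1 - a x ^ 2) := Real.sqrt_pos.2 (by linarith [ha x])
  have h2 : 0 < √(1 - a x' ^ 2) := Real.sqrt_pos.2 (by linarith [ha x'])
  have h3 := sqrt_mul_sqrt_le (ha x) (ha x')
  have h4 := Real.one_le_cosh (dist x x')
  have h5 : 0 ≤ 1 - √(1 - a x ^ 2) * √(1 - a x' ^ 2) := by
    have i1 : √(1 - a x ^ 2) ≤ 1 := Real.sqrt_le_one.2 (by linarith [sq_nonneg (a x)])
    have i2 : √(1 - a x' ^ 2) ≤ 1 := Real.sqrt_le_one.2 (by linarith [sq_nonneg (a x')])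
    have := mul_le_one₀ i1 h2.le i2
    linarith
  rw [le_div_iff₀ (mul_pos h1 h2)]
  nlinarith

lemma cosh_deform (ha : ∀ x, a x ^ 2 < 1) (x x' : X) : Real.cosh (deform a x x') =
    (Real.cosh (dist x x') - a x * a x') / (√(1 - a x ^ 2) * √(1 - a x' ^ 2)) :=
  Real.cosh_arcosh ((Real.one_le_cosh _).trans (cosh_dist_le_div ha x x'))

lemma deform_nonneg (ha : ∀ x, a x ^ 2 < 1) (x x' : X) : 0 ≤ deform a x x' :=
  Real.arcosh_nonneg ((Real.one_le_cosh _).trans (cosh_dist_le_div ha x x'))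

lemma dist_le_deform (ha : ∀ x, a x ^ 2 < 1) (x x' : X) : dist x x' ≤ deform a x x' := by
  rw [← cosh_le_iff_of_nonneg dist_nonneg (deform_nonneg ha x x'), cosh_deform ha]
  exact cosh_dist_le_div ha x x'

lemma continuous_deform (ha : ∀ x, a x ^ 2 < 1) (hc : Continuous a) (z : X) :
    Continuous (deform a z) := by
  have h : ∀ x, 0 < √(1 - a x ^ 2) := fun x => Real.sqrt_pos.2 (by linarith [ha x])
  refine Real.continuousOn_arcosh.comp_continuous ?_ fun x =>
    (Real.one_le_cosh _).trans (cosh_dist_le_div ha z x)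
  refine Continuous.div ?_ (by fun_prop) fun x => (mul_pos (h z) (h x)).ne'
  exact (Real.continuous_cosh.comp (by fun_prop)).sub (by fun_prop)

/-- Distances are compared through `cosh d - 1 = 2 sinh (d / 2) ^ 2`, which is why `K` enters
squared. The bound `q` on the squared height controls the denominator, and the bound `b` on the
slope controls the correction `1 - a x * a x' - P`. -/
lemma deform_le {b q K : ℝ} (hK : 1 ≤ K) (ha : ∀ x, a x ^ 2 ≤ q) (hq : q < 1)
    (hb : ∀ x x', (a x - a x') ^ 2 ≤ 2 * b * (Real.cosh (dist x x') - 1))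
    (hKq : (1 + b / (1 - q)) / (1 - q) ≤ K ^ 2) (x x' : X) : deform a x x' ≤ K * dist x x' := by
  have ha1 : ∀ x, a x ^ 2 < 1 := fun x => (ha x).trans_lt hq
  have h1 : 0 < √(1 - a x ^ 2) := Real.sqrt_pos.2 (by linarith [ha1 x])
  have h2 : 0 < √(1 - a x' ^ 2) := Real.sqrt_pos.2 (by linarith [ha1 x'])
  set P := √(1 - a x ^ 2) * √(1 - a x' ^ 2) with hP
  have hP0 : 0 < P := mul_pos h1 h2
  have hP2 : P ^ 2 = (1 - a x ^ 2) * (1 - a x' ^ 2) := by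
    rw [hP, mul_pow, Real.sq_sqrt (by linarith [ha1 x]), Real.sq_sqrt (by linarith [ha1 x'])]
  have hPq : 1 - q ≤ P := by
    refine abs_le_of_sq_le_sq' ?_ hP0.le |>.2
    rw [hP2, sq]
    exact mul_le_mul (by linarith [ha x]) (by linarith [ha x']) (by linarith) (by linarith [ha1 x])
  have h3 : P ≤ 1 - a x * a x' := sqrt_mul_sqrt_le (ha1 x) (ha1 x')
  set w := Real.cosh (dist x x') - 1 with hw
  have hw0 : 0 ≤ w := sub_nonneg.2 (Real.one_le_cosh _)
  have h4 : (1 - a x * a x' - P) * (2 * P) ≤ 2 * b * w := by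
    refine le_trans ?_ (hb x x')
    nlinarith
  have h5 : 1 - a x * a x' - P ≤ b / (1 - q) * w := by
    have i1 : (1 - a x * a x' - P) * (1 - q) ≤ b * w := by
      have := mul_le_mul_of_nonneg_left hPq (sub_nonneg.2 h3)
      linarith
    rw [div_mul_eq_mul_div, le_div_iff₀ (by linarith)]
    exact i1
  have h6 : Real.cosh (deform a x x') - 1 ≤ K ^ 2 * w := by
    rw [cosh_deform ha1, ← hP]
    have e : (Real.cosh (dist x x') - a x * a x') / P - 1 =
        (w + (1 - a x * a x' - P)) / P := by
      rw [hw]; field_simp; ring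
    rw [e]
    calc (w + (1 - a x * a x' - P)) / P ≤ (w + (1 - a x * a x' - P)) / (1 - q) := by
          refine div_le_div_of_nonneg_left (by linarith) (by linarith) hPq
      _ ≤ (w + b / (1 - q) * w) / (1 - q) := by
          have : 0 < 1 - q := by linarith
          gcongr
      _ = (1 + b / (1 - q)) / (1 - q) * w := by ring
      _ ≤ K ^ 2 * w := by gcongr
  have h7 : Real.sinh (deform a x x' / 2) ≤ K * Real.sinh (dist x x' / 2) := by
    rw [cosh_sub_one, hw, cosh_sub_one] at h6
    refine abs_le_of_sq_le_sq' ?_ (mul_nonneg (by linarith)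
      (Real.sinh_nonneg_iff.2 (by positivity))) |>.2
    rw [mul_pow]; linarith
  have h8 := h7.trans (mul_sinh_le_sinh_mul hK (by positivity : 0 ≤ dist x x' / 2))
  have h9 := Real.sinh_le_sinh.1 h8
  linarith

/-! ### Polar coordinates of the deformed distance -/

/-- Along a ray from a centre of height `A` the height is `A cosh r - β sinh r`. The left-hand side
is `sinh R ^ 2`, for the new radius `R`, multiplied by the two squared normalizations. -/
lemma deform_polar_sq (A β r : ℝ) :
    (Real.cosh r - A * (A * Real.cosh r - β * Real.sinh r)) ^ 2 -
      (1 - (A * Real.cosh r - β * Real.sinh r) ^ 2) * (1 - A ^ 2) =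
      Real.sinh r ^ 2 * (1 - A ^ 2 + β ^ 2) := by
  have := Real.cosh_sq r
  linear_combination (1 - A ^ 2) * this

/-- Equality of the quotients, which are `cosh R` up to a constant, gives equality of the
corresponding sines by `deform_polar_sq`; together these force `sinh (r - r') = 0`. -/
lemma deform_ray_injective {A β r r' : ℝ} (hA : A ^ 2 < 1) (hr : 0 ≤ r) (hr' : 0 ≤ r')
    (ha : (A * Real.cosh r - β * Real.sinh r) ^ 2 < 1)
    (ha' : (A * Real.cosh r' - β * Real.sinh r') ^ 2 < 1)
    (h : (Real.cosh r - A * (A * Real.cosh r - β * Real.sinh r)) /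
        √(1 - (A * Real.cosh r - β * Real.sinh r) ^ 2) =
      (Real.cosh r' - A * (A * Real.cosh r' - β * Real.sinh r')) /
        √(1 - (A * Real.cosh r' - β * Real.sinh r') ^ 2)) : r = r' := by
  have e := deform_polar_sq A β r
  have e' := deform_polar_sq A β r'
  set N := √(1 - (A * Real.cosh r - β * Real.sinh r) ^ 2) with hN
  set N' := √(1 - (A * Real.cosh r' - β * Real.sinh r') ^ 2) with hN'
  have n0 : 0 < N := Real.sqrt_pos.2 (by linarith)
  have n0' : 0 < N' := Real.sqrt_pos.2 (by linarith)
  have n2 : N ^ 2 = 1 - (A * Real.cosh r - β * Real.sinh r) ^ 2 := Real.sq_sqrt (by linarith)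
  have n2' : N' ^ 2 = 1 - (A * Real.cosh r' - β * Real.sinh r') ^ 2 := Real.sq_sqrt (by linarith)
  rw [← n2] at e
  rw [← n2'] at e'
  rw [div_eq_div_iff n0.ne' n0'.ne'] at h
  have hs : 0 ≤ Real.sinh r := Real.sinh_nonneg_iff.2 hr
  have hs' : 0 ≤ Real.sinh r' := Real.sinh_nonneg_iff.2 hr'
  have hq : 0 < 1 - A ^ 2 + β ^ 2 := by nlinarith [sq_nonneg β]
  have h2 : (Real.sinh r * N') ^ 2 = (Real.sinh r' * N) ^ 2 := by
    refine mul_right_cancel₀ hq.ne' ?_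
    linear_combination (-N' ^ 2) * e + N ^ 2 * e' +
      ((Real.cosh r - A * (A * Real.cosh r - β * Real.sinh r)) * N' +
        (Real.cosh r' - A * (A * Real.cosh r' - β * Real.sinh r')) * N) * h
  have h3 : Real.sinh r * N' = Real.sinh r' * N :=
    (pow_left_inj₀ (by positivity) (by positivity) two_ne_zero).1 h2
  have h4 : Real.sinh (r - r') = 0 := by
    refine (mul_eq_zero.1 (?_ : (1 - A ^ 2) * N * N' * Real.sinh (r - r') = 0)).resolve_left
      (mul_pos (mul_pos (by linarith) n0) n0').ne'
    rw [Real.sinh_sub]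
    linear_combination (Real.cosh r' - A * (A * Real.cosh r' - β * Real.sinh r')) * N * h3 -
      Real.sinh r' * N * h
  have := Real.sinh_eq_zero.1 h4
  linarith

/-- The law of cosines for the deformed distance in a sector around a site. -/
lemma deform_sector {A B c k R R' r r' u u' : ℝ} (hA : A ^ 2 < 1) (hB : B ^ 2 = A ^ 2 - c ^ 2)
    (hk : 0 < k) (hk2 : k ^ 2 * (1 - A ^ 2) = 1 - c ^ 2) (hr : 0 ≤ r) (hr' : 0 ≤ r')
    (hR : 0 ≤ R) (hR' : 0 ≤ R')
    (ha : (A * Real.cosh r - B * Real.cos u * Real.sinh r) ^ 2 < 1)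
    (ha' : (A * Real.cosh r' - B * Real.cos u' * Real.sinh r') ^ 2 < 1)
    (h : Real.cosh R = (Real.cosh r - A * (A * Real.cosh r - B * Real.cos u * Real.sinh r)) /
        (√(1 - A ^ 2) * √(1 - (A * Real.cosh r - B * Real.cos u * Real.sinh r) ^ 2)))
    (h' : Real.cosh R' = (Real.cosh r' - A * (A * Real.cosh r' - B * Real.cos u' * Real.sinh r')) /
        (√(1 - A ^ 2) * √(1 - (A * Real.cosh r' - B * Real.cos u' * Real.sinh r') ^ 2))) :
    (Real.cosh r * Real.cosh r' - Real.sinh r * Real.sinh r' * Real.cos (u - u') -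
        (A * Real.cosh r - B * Real.cos u * Real.sinh r) *
          (A * Real.cosh r' - B * Real.cos u' * Real.sinh r')) /
        (√(1 - (A * Real.cosh r - B * Real.cos u * Real.sinh r) ^ 2) *
          √(1 - (A * Real.cosh r' - B * Real.cos u' * Real.sinh r') ^ 2)) =
      Real.cosh R * Real.cosh R' -
        Real.sinh R * Real.sinh R' * Real.cos (squeeze k u - squeeze k u') := by
  -- The point with new polar coordinates `(R, squeeze k u)` has space-like coordinates `(k cos u,
  -- sin u)` times `sinh r`, divided by the normalization. The law of cosines then becomes an
  -- identity between bilinear expressions.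
  have key : ∀ {R r u : ℝ}, 0 ≤ r → 0 ≤ R →
      (A * Real.cosh r - B * Real.cos u * Real.sinh r) ^ 2 < 1 →
      Real.cosh R = (Real.cosh r - A * (A * Real.cosh r - B * Real.cos u * Real.sinh r)) /
        (√(1 - A ^ 2) * √(1 - (A * Real.cosh r - B * Real.cos u * Real.sinh r) ^ 2)) →
      Real.sinh R * Real.cos (squeeze k u) = k * Real.cos u * Real.sinh r /
        √(1 - (A * Real.cosh r - B * Real.cos u * Real.sinh r) ^ 2) ∧
      Real.sinh R * Real.sin (squeeze k u) = Real.sin u * Real.sinh r /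
        √(1 - (A * Real.cosh r - B * Real.cos u * Real.sinh r) ^ 2) := by
    intro R r u hr hR ha h
    have e := deform_polar_sq A (B * Real.cos u) r
    obtain ⟨t1, t2⟩ := norm_squeeze hk u
    set a := A * Real.cosh r - B * Real.cos u * Real.sinh r with hadef
    have n0 : 0 < √(1 - a ^ 2) := Real.sqrt_pos.2 (by linarith)
    have m0 : 0 < √(1 - A ^ 2) := Real.sqrt_pos.2 (by linarith)
    have n2 : √(1 - a ^ 2) ^ 2 = 1 - a ^ 2 := Real.sq_sqrt (by linarith)
    have m2 : √(1 - A ^ 2) ^ 2 = 1 - A ^ 2 := Real.sq_sqrt (by linarith)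
    have w2 : √(k ^ 2 * Real.cos u ^ 2 + Real.sin u ^ 2) ^ 2 =
      k ^ 2 * Real.cos u ^ 2 + Real.sin u ^ 2 := Real.sq_sqrt (by positivity)
    have hs : Real.sinh R =
        Real.sinh r * √(k ^ 2 * Real.cos u ^ 2 + Real.sin u ^ 2) / √(1 - a ^ 2) := by
      have h1 : 0 ≤ Real.sinh r := Real.sinh_nonneg_iff.2 hr
      refine (pow_left_inj₀ (Real.sinh_nonneg_iff.2 hR) (by positivity) two_ne_zero).1 ?_
      rw [Real.sinh_sq, h, div_pow, mul_pow, div_pow, mul_pow, w2, n2, m2]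
      have n1 : 1 - a ^ 2 ≠ 0 := by linarith
      have m1 : 1 - A ^ 2 ≠ 0 := by linarith
      rw [div_sub_one (mul_ne_zero m1 n1), div_eq_div_iff (mul_ne_zero m1 n1) n1]
      have hsc := Real.sin_sq_add_cos_sq u
      linear_combination (1 - a ^ 2) * e + (1 - a ^ 2) * Real.sinh r ^ 2 *
        (Real.cos u ^ 2 * hB - Real.cos u ^ 2 * hk2 - (1 - A ^ 2) * hsc)
    constructor
    · rw [hs, div_mul_eq_mul_div, mul_assoc, t2, mul_comm]
    · rw [hs, div_mul_eq_mul_div, mul_assoc, t1, mul_comm]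
  obtain ⟨e1, e2⟩ := key hr hR ha h
  obtain ⟨e1', e2'⟩ := key hr' hR' ha' h'
  have e3 : Real.sinh R * Real.sinh R' * Real.cos (squeeze k u - squeeze k u') =
      (Real.sinh R * Real.cos (squeeze k u)) * (Real.sinh R' * Real.cos (squeeze k u')) +
      (Real.sinh R * Real.sin (squeeze k u)) * (Real.sinh R' * Real.sin (squeeze k u')) := by
    rw [Real.cos_sub]; ring
  rw [e3, e1, e2, e1', e2', h, h', Real.cos_sub]
  set a := A * Real.cosh r - B * Real.cos u * Real.sinh r with hadef
  set a' := A * Real.cosh r' - B * Real.cos u' * Real.sinh r' with hadef'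
  have n0 : 0 < √(1 - a ^ 2) := Real.sqrt_pos.2 (by linarith)
  have n0' : 0 < √(1 - a' ^ 2) := Real.sqrt_pos.2 (by linarith)
  have m0 : 0 < √(1 - A ^ 2) := Real.sqrt_pos.2 (by linarith)
  have m2 : √(1 - A ^ 2) ^ 2 = 1 - A ^ 2 := Real.sq_sqrt (by linarith)
  generalize √(1 - a ^ 2) = N at *
  generalize √(1 - a' ^ 2) = N' at *
  generalize √(1 - A ^ 2) = n at *
  have hn : (Real.cosh r - A * a) * (Real.cosh r' - A * a') = n ^ 2 *
      (Real.cosh r * Real.cosh r' - a * a') + Real.sinh r * Real.sinh r' * Real.cos u *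
        Real.cos u' * (k ^ 2 * n ^ 2 - n ^ 2) := by
    rw [m2, hk2, hadef, hadef']
    linear_combination Real.sinh r * Real.sinh r' * Real.cos u * Real.cos u' * hB
  have e4 : (Real.cosh r - A * a) / (n * N) * ((Real.cosh r' - A * a') / (n * N')) =
      ((Real.cosh r - A * a) * (Real.cosh r' - A * a')) / (n ^ 2 * (N * N')) := by
    field_simp
  rw [e4, hn]
  field_simp
  ring

/-- The law of cosines for the deformed distance around a site. -/
lemma deform_site {c R R' r r' x : ℝ} (hr : 0 ≤ r) (hr' : 0 ≤ r') (hR : 0 ≤ R) (hR' : 0 ≤ R')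
    (hc : c ^ 2 < 1) (ha : (c * Real.cosh r) ^ 2 < 1) (ha' : (c * Real.cosh r') ^ 2 < 1)
    (h : Real.cosh R = (Real.cosh r - c * (c * Real.cosh r)) /
        (√(1 - c ^ 2) * √(1 - (c * Real.cosh r) ^ 2)))
    (h' : Real.cosh R' = (Real.cosh r' - c * (c * Real.cosh r')) /
        (√(1 - c ^ 2) * √(1 - (c * Real.cosh r') ^ 2))) :
    (Real.cosh r * Real.cosh r' - Real.sinh r * Real.sinh r' * x -
        (c * Real.cosh r) * (c * Real.cosh r')) /
        (√(1 - (c * Real.cosh r) ^ 2) * √(1 - (c * Real.cosh r') ^ 2)) =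
      Real.cosh R * Real.cosh R' - Real.sinh R * Real.sinh R' * x := by
  have m0 : 0 < √(1 - c ^ 2) := Real.sqrt_pos.2 (by linarith)
  have m2 : √(1 - c ^ 2) ^ 2 = 1 - c ^ 2 := Real.sq_sqrt (by linarith)
  have key : ∀ {R r : ℝ}, 0 ≤ r → 0 ≤ R → (c * Real.cosh r) ^ 2 < 1 →
      Real.cosh R = (Real.cosh r - c * (c * Real.cosh r)) /
        (√(1 - c ^ 2) * √(1 - (c * Real.cosh r) ^ 2)) →
      Real.sinh R = Real.sinh r / √(1 - (c * Real.cosh r) ^ 2) := by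
    intro R r hr hR ha h
    have h1 : 0 ≤ Real.sinh r := Real.sinh_nonneg_iff.2 hr
    have n2 : √(1 - (c * Real.cosh r) ^ 2) ^ 2 = 1 - (c * Real.cosh r) ^ 2 :=
      Real.sq_sqrt (by linarith)
    refine (pow_left_inj₀ (Real.sinh_nonneg_iff.2 hR) (by positivity) two_ne_zero).1 ?_
    rw [Real.sinh_sq, h, div_pow, mul_pow, div_pow, n2, m2]
    have n1 : 1 - (c * Real.cosh r) ^ 2 ≠ 0 := by linarith
    have m1 : 1 - c ^ 2 ≠ 0 := by linarith
    rw [div_sub_one (mul_ne_zero m1 n1), div_eq_div_iff (mul_ne_zero m1 n1) n1, Real.sinh_sq]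
    ring
  rw [key hr hR ha h, key hr' hR' ha' h', h, h']
  have n0 : 0 < √(1 - (c * Real.cosh r) ^ 2) := Real.sqrt_pos.2 (by linarith)
  have n0' : 0 < √(1 - (c * Real.cosh r') ^ 2) := Real.sqrt_pos.2 (by linarith)
  generalize √(1 - (c * Real.cosh r) ^ 2) = N at *
  generalize √(1 - (c * Real.cosh r') ^ 2) = N' at *
  generalize √(1 - c ^ 2) = n at *
  have e4 : (Real.cosh r - c * (c * Real.cosh r)) / (n * N) *
      ((Real.cosh r' - c * (c * Real.cosh r')) / (n * N')) =
      n ^ 2 * (Real.cosh r * Real.cosh r' * (1 - c ^ 2)) / (n ^ 2 * (N * N')) := by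
    have e5 : (Real.cosh r - c * (c * Real.cosh r)) * (Real.cosh r' - c * (c * Real.cosh r')) =
        n ^ 2 * (Real.cosh r * Real.cosh r' * (1 - c ^ 2)) := by rw [m2]; ring
    rw [← e5]; field_simp
  rw [e4]
  field_simp
  ring

end Deformation

/-! ### Cone charts of the deformed metric -/

section CellChart

open Filter Topology

variable {X : Type*} [MetricSpace X]

/-- Cell charts from cone charts by reparametrization of the directions and of the radii. -/
lemma IsConeChart.exists_cellChart {ι : Type*} {C : ι → Set X} {m : X → X → ℝ} {z : X}
    {κ₀ ρ₀ : ℝ} {E : ℝ → AddCircle κ₀ → X} (h : IsConeChart z κ₀ ρ₀ E) (hmc : Continuous (m z))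
    (hm1 : ∀ x y, dist x y ≤ m x y) (hz : m z z = 0) {κ' : ℝ} (hκ' : 0 < κ')
    {g : AddCircle κ₀ → AddCircle κ'} (hg : Function.Bijective g)
    (hinj : ∀ r ∈ Ico 0 ρ₀, ∀ r' ∈ Ico 0 ρ₀, ∀ θ, m z (E r θ) = m z (E r' θ) → r = r')
    (hcosh : ∀ i, ∀ r ∈ Ico 0 ρ₀, ∀ r' ∈ Ico 0 ρ₀, ∀ θ θ', E r θ ∈ C i → E r' θ' ∈ C i →
      Real.cosh (m (E r θ) (E r' θ')) =
        coneCosh κ' (m z (E r θ)) (g θ) (m z (E r' θ')) (g θ')) :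
    ∃ ρ' e', IsCellChart C m z κ' ρ' e' := by
  have hρ₀ := h.2.1
  -- Along each ray the new radius starts at 0, is continuous and is at least the old radius, so it
  -- takes every value below `ρ₀ / 2`.
  have hrad : ∀ R θ, ∃ r, R ∈ Ico 0 (ρ₀ / 2) → r ∈ Ico 0 ρ₀ ∧ m z (E r θ) = R := by
    intro R θ
    by_cases hR : R ∈ Ico 0 (ρ₀ / 2)
    · have hcont : ContinuousOn (fun r => m z (E r θ)) (Icc 0 (ρ₀ / 2)) := by
        refine hmc.comp_continuousOn ?_
        have : LipschitzOnWith 1 (fun r => E r θ) (Icc 0 (ρ₀ / 2)) :=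
          LipschitzOnWith.of_dist_le_mul fun r hr r' hr' => by
            refine le_of_eq ?_
            rw [NNReal.coe_one, one_mul, Real.dist_eq]
            refine cosh_inj_of_nonneg dist_nonneg (abs_nonneg _) ?_
            rw [h.cosh_dist ⟨hr.1, by linarith [hr.2]⟩ ⟨hr'.1, by linarith [hr'.2]⟩,
              coneCosh_self_angle, Real.cosh_abs]
        exact this.continuousOn
      have h1 := intermediate_value_Icc (by linarith : 0 ≤ ρ₀ / 2) hcont
      have h2 := hm1 z (E (ρ₀ / 2) θ)
      rw [dist_comm, h.dist_apex ⟨by linarith, by linarith⟩] at h2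
      simp only [h.2.2.1, hz] at h1
      obtain ⟨r, hr, hrR⟩ := h1 ⟨hR.1, hR.2.le.trans h2⟩
      exact ⟨r, fun _ => ⟨⟨hr.1, by linarith [hr.2]⟩, hrR⟩⟩
    · exact ⟨0, fun h => absurd h hR⟩
  choose rad hrad using hrad
  set G := Equiv.ofBijective g hg with hG
  have hGs : ∀ ψ, g (G.symm ψ) = ψ := fun ψ => G.apply_symm_apply ψ
  have hGs' : ∀ θ, G.symm (g θ) = θ := fun θ => G.symm_apply_apply θ
  refine ⟨ρ₀ / 2, fun R ψ => E (rad R (G.symm ψ)) (G.symm ψ), hκ', by linarith, ?_, ?_, ?_⟩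
  · exact fun R hR ψ => (hrad R _ hR).2
  · intro x hx
    have hxd : x ∈ Metric.ball z ρ₀ := by
      rw [Metric.mem_ball, dist_comm]
      linarith [hm1 z x]
    obtain ⟨θ, hθ⟩ := h.exists_polar hxd
    refine ⟨g θ, ?_⟩
    simp only [hGs']
    obtain ⟨h1, h2⟩ := hrad (m z x) θ ⟨dist_nonneg.trans (hm1 z x), hx⟩
    have h3 := hinj _ h1 (dist x z) ⟨dist_nonneg, hxd⟩ θ (by rw [h2, hθ])
    rw [h3, hθ]
  · intro i R hR R' hR' ψ ψ' hi hi'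
    obtain ⟨h1, h2⟩ := hrad R (G.symm ψ) hR
    obtain ⟨h1', h2'⟩ := hrad R' (G.symm ψ') hR'
    have := hcosh i _ h1 _ h1' _ _ hi hi'
    rwa [h2, h2', hGs, hGs] at this

lemma deform_self {a : X → ℝ} (ha : ∀ x, a x ^ 2 < 1) (z : X) : deform a z z = 0 := by
  refine cosh_inj_of_nonneg (deform_nonneg ha z z) le_rfl ?_
  have h := ha z
  rw [cosh_deform ha, dist_self, Real.cosh_zero, ← sq, Real.mul_self_sqrt (by linarith),
    div_self (by linarith)]

/-- The function by which the distance is deformed: it has its minima at the sites. -/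
noncomputable def siteHeight (Y : Set X) (c : ℝ) (x : X) : ℝ := c * Real.cosh (Metric.infDist x Y)

/-- The cell of a site: the points to which it is nearest. -/
def siteCell (Y : Set X) (y : Y) : Set X := {x | dist x y = Metric.infDist x Y}

lemma continuous_siteHeight (Y : Set X) (c : ℝ) : Continuous (siteHeight Y c) :=
  continuous_const.mul (Real.continuous_cosh.comp (Metric.continuous_infDist_pt Y))

/-- A cell chart at a site. -/
lemma exists_cellChart_site {Y : Set X} (hY : Y.Finite) {c : ℝ}
    (hc : ∀ x, siteHeight Y c x ^ 2 < 1) {z : X} (hz : z ∈ Y) {κ : ℝ}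
    (h : HasConeAngle z κ) : ∃ ρ e, IsCellChart (siteCell Y) (deform (siteHeight Y c)) z κ ρ e := by
  obtain ⟨ρ₀, E, hE₀⟩ := hasConeAngle_iff.1 h
  -- Within `ρ` of `z` no other site is nearer, so the height depends on the radius only and angles
  -- are not changed.
  obtain ⟨ρ, hρY, hρ0, hρle⟩ : ∃ ρ, (∀ y ∈ Y, y ≠ z → 2 * ρ ≤ dist y z) ∧ 0 < ρ ∧ ρ < ρ₀ := by
    have h1 : ∀ᶠ ρ : ℝ in 𝓝[>] 0, ∀ y ∈ Y, y ≠ z → 2 * ρ ≤ dist y z := by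
      rw [eventually_all_finite hY]
      intro y _
      by_cases hy : y = z
      · simp [hy]
      refine eventually_nhdsWithin_of_eventually_nhds ?_
      have hcont : Continuous fun ρ : ℝ => 2 * ρ := by fun_prop
      filter_upwards [hcont.continuousAt.eventually (gt_mem_nhds
        (by simpa using dist_pos.2 hy : 2 * (0 : ℝ) < dist y z))] with ρ hρ _
      exact hρ.le
    obtain ⟨ρ, h1, h2⟩ := (h1.and (Ioo_mem_nhdsGT hE₀.2.1)).exists
    exact ⟨ρ, h1, h2⟩
  have hE := hE₀.mono hρ0 hρle.le
  have hinf : ∀ r ∈ Ico 0 ρ, ∀ θ, Metric.infDist (E r θ) Y = r := by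
    intro r hr θ
    have h1 := hE.dist_apex hr θ
    refine le_antisymm ((Metric.infDist_le_dist_of_mem hz).trans h1.le) ?_
    refine (Metric.le_infDist ⟨z, hz⟩).2 fun y hy => ?_
    by_cases hyz : y = z
    · rw [hyz, h1]
    · have h2 := hρY y hy hyz
      have h3 := dist_triangle_left y z (E r θ)
      linarith [hr.2]
  have hinfz : Metric.infDist z Y = 0 := Metric.infDist_zero_of_mem hz
  set a := siteHeight Y c with ha
  have haz : a z = c := by simp [ha, siteHeight, hinfz]
  have hc1 : c ^ 2 < 1 := haz ▸ hc z
  have haE : ∀ r ∈ Ico 0 ρ, ∀ θ, a (E r θ) = c * Real.cosh r := fun r hr θ => by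
    simp only [ha, siteHeight, hinf r hr θ]
  have hacont : Continuous a := continuous_siteHeight Y c
  have hrad : ∀ r ∈ Ico 0 ρ, ∀ θ, Real.cosh (deform a z (E r θ)) =
      (Real.cosh r - c * (c * Real.cosh r)) / (√(1 - c ^ 2) * √(1 - (c * Real.cosh r) ^ 2)) := by
    intro r hr θ
    rw [cosh_deform hc, dist_comm, hE.dist_apex hr, haE r hr, haz]
  have hlt : ∀ r ∈ Ico 0 ρ, (c * Real.cosh r) ^ 2 < 1 := fun r hr => by
    have := hc (E r 0)
    rwa [haE r hr] at this
  refine hE.exists_cellChart (continuous_deform hc hacont z) (dist_le_deform hc)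
    (deform_self hc z) hE.1 Function.bijective_id ?_ ?_
  · intro r hr r' hr' θ he
    have h1 := congrArg Real.cosh he
    rw [hrad r hr, hrad r' hr', mul_comm √(1 - c ^ 2), mul_comm √(1 - c ^ 2), ← div_div,
      ← div_div] at h1
    have hn : √(1 - c ^ 2) ≠ 0 := (Real.sqrt_pos.2 (by linarith)).ne'
    have h2 := (div_left_inj' hn).1 h1
    have h3 := deform_ray_injective (A := c) (β := 0) hc1 hr.1 hr'.1
    simp only [zero_mul, sub_zero] at h3
    exact h3 (hlt r hr) (hlt r' hr') h2
  · intro y r hr r' hr' θ θ' _ _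
    rw [cosh_deform hc, hE.cosh_dist hr hr', haE r hr, haE r' hr', coneCosh, coneCosh]
    exact deform_site hr.1 hr'.1 (deform_nonneg hc _ _) (deform_nonneg hc _ _) hc1 (hlt r hr)
      (hlt r' hr') (hrad r hr θ) (hrad r' hr' θ')

end CellChart

section NonSite

open Filter Topology

variable {X : Type*} [MetricSpace X]

/-- Near a point, only the nearest sites of the point are nearest sites. -/
lemma eventually_nearest {Y : Set X} (hY : Y.Finite) (z : X) :
    ∀ᶠ ρ : ℝ in 𝓝[>] 0, ∀ y ∈ Y, ∀ x ∈ Metric.ball z ρ, dist x y = Metric.infDist x Y →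
      dist z y = Metric.infDist z Y := by
  rw [eventually_all_finite hY]
  intro y hy
  by_cases h : dist z y = Metric.infDist z Y
  · exact Eventually.of_forall fun _ _ _ _ => h
  have hlt : 0 < dist z y - Metric.infDist z Y :=
    sub_pos.2 (lt_of_le_of_ne (Metric.infDist_le_dist_of_mem hy) (Ne.symm h))
  have hcont : Continuous fun ρ : ℝ => 2 * ρ := by fun_prop
  refine eventually_nhdsWithin_of_eventually_nhds ?_
  filter_upwards [hcont.continuousAt.eventually (gt_mem_nhds
    (by simpa using hlt : 2 * (0 : ℝ) < dist z y - Metric.infDist z Y))] with ρ hρ x hx hxy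
  rw [Metric.mem_ball] at hx
  have h1 := Metric.infDist_le_infDist_add_dist (s := Y) (x := x) (y := z)
  have h2 := dist_triangle_left z y x
  linarith

lemma finite_lift_inter_Ioo {Θ : Set (AddCircle (2 * Real.pi))} (hΘ : Θ.Finite) {a b : ℝ}
    (hab : b - a ≤ 2 * Real.pi) :
    ({t : ℝ | (t : AddCircle (2 * Real.pi)) ∈ Θ} ∩ Ioo a b).Finite := by
  refine Set.Finite.of_injOn (f := fun t : ℝ => (t : AddCircle (2 * Real.pi))) (t := Θ)
    (fun t ht => ht.1) (fun t ht t' ht' he => ?_) hΘ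
  have h1 : ((t - t' : ℝ) : AddCircle (2 * Real.pi)) = 0 := by
    rw [AddCircle.coe_sub]; exact sub_eq_zero.2 he
  obtain ⟨n, hn⟩ := (AddCircle.coe_eq_zero_iff (2 * Real.pi)).1 h1
  rw [zsmul_eq_mul] at hn
  have hπ := Real.pi_pos
  have h2 : |(n : ℝ) * (2 * Real.pi)| < 2 * Real.pi := by
    rw [hn, abs_lt]
    constructor <;> linarith [ht.2.1, ht.2.2, ht'.2.1, ht'.2.2]
  rw [abs_mul, abs_of_pos (by linarith : 0 < 2 * Real.pi)] at h2
  have h3 : |(n : ℝ)| < 1 := by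
    by_contra! hge
    have := mul_le_mul_of_nonneg_right hge (by linarith : 0 ≤ 2 * Real.pi)
    linarith
  have h4 : n = 0 := by
    rw [← Int.cast_abs] at h3
    exact Int.abs_lt_one_iff.1 (by exact_mod_cast h3)
  rw [h4] at hn
  simp only [Int.cast_zero, zero_mul] at hn
  linarith

/-- A cell chart at a point that is not a site. The new angle is at most `2π`, and less if the point
is a farthest point of a cell. -/
lemma exists_cellChart_of_notMem {Y : Set X} (hY : Y.Finite) (hne : Y.Nonempty) {c : ℝ} (hc0 : 0 < c)
    (hc : ∀ x, siteHeight Y c x ^ 2 < 1) {z : X} (hz : z ∉ Y) {ρ₀ : ℝ}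
    {E : ℝ → AddCircle (2 * Real.pi) → X} (hE₀ : IsConeChart z (2 * Real.pi) ρ₀ E)
    (hsee : ∀ y ∈ Y, dist z y = Metric.infDist z Y → ∃ θy, ∃ r₁ > 0, ∀ r ∈ Ico 0 r₁, ∀ θ,
      Real.cosh (dist (E r θ) y) = Real.cosh (dist z y) * Real.cosh r -
        Real.sinh (dist z y) * Real.sinh r * Real.cos ‖θ - θy‖) :
    ∃ κ ≤ 2 * Real.pi, (∃ ρ e, IsCellChart (siteCell Y) (deform (siteHeight Y c)) z κ ρ e) ∧
      ((∃ y : Y, z ∈ siteCell Y y ∧ ∀ x ∈ siteCell Y y, dist x y ≤ dist z y) →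
        κ < 2 * Real.pi) := by
  have hπ := Real.pi_pos
  choose! Θ r₁ hr₁ hsee using hsee
  obtain ⟨ρ, ⟨hρ1, hρ2⟩, hρ0, hρle⟩ : ∃ ρ, ((∀ y ∈ Y, dist z y = Metric.infDist z Y → ρ ≤ r₁ y) ∧
      ∀ y ∈ Y, ∀ x ∈ Metric.ball z ρ, dist x y = Metric.infDist x Y →
        dist z y = Metric.infDist z Y) ∧ 0 < ρ ∧ ρ < ρ₀ := by
    have h1 : ∀ᶠ ρ : ℝ in 𝓝[>] 0, ∀ y ∈ Y, dist z y = Metric.infDist z Y → ρ ≤ r₁ y := by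
      rw [eventually_all_finite hY]
      intro y hy
      by_cases h : dist z y = Metric.infDist z Y
      · filter_upwards [Ioo_mem_nhdsGT (hr₁ y hy h)] with ρ hρ _ using hρ.2.le
      · exact Eventually.of_forall fun _ h' => absurd h' h
    obtain ⟨ρ, h1, h2⟩ := ((h1.and (eventually_nearest hY z)).and
      (Ioo_mem_nhdsGT hE₀.2.1)).exists
    exact ⟨ρ, h1, h2⟩
  have hE := hE₀.mono hρ0 hρle.le
  set D := Metric.infDist z Y with hD
  have hD0 : 0 < D := (hY.isClosed.notMem_iff_infDist_pos hne).1 hz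
  have hnear : ∀ x : X, ∃ y ∈ Y, dist x y = Metric.infDist x Y := fun x => by
    obtain ⟨y, hy, h⟩ := hY.isCompact.exists_infDist_eq_dist hne x
    exact ⟨y, hy, h.symm⟩
  set a := siteHeight Y c with ha
  set A := c * Real.cosh D with hA
  set B := c * Real.sinh D with hB
  have haz : a z = A := rfl
  have hA1 : A ^ 2 < 1 := hc z
  have hsD : 0 < Real.sinh D := Real.sinh_pos_iff.2 hD0
  have hB2 : B ^ 2 = A ^ 2 - c ^ 2 := by
    have := Real.cosh_sq D
    rw [hA, hB, mul_pow, mul_pow, this]; ring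
  have hB0 : 0 < B := mul_pos hc0 hsD
  have hcA : c ^ 2 < A ^ 2 := by nlinarith
  -- The lifted tangent plane is stretched in the direction of the site: `k ^ 2 = 1 + B ^ 2 / (1 - A
  -- ^ 2)`, where `B` is the slope of the height.
  set k := √((1 - c ^ 2) / (1 - A ^ 2)) with hk
  have hk2 : k ^ 2 * (1 - A ^ 2) = 1 - c ^ 2 := by
    rw [hk, Real.sq_sqrt (div_nonneg (by linarith) (by linarith)),
      div_mul_cancel₀ _ (by linarith)]
  have hk1 : 1 < k := by
    rw [hk, Real.lt_sqrt zero_le_one, one_pow, lt_div_iff₀ (by linarith)]; linarith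
  have hcosh : ∀ y ∈ Y, dist z y = D → ∀ r ∈ Ico 0 ρ, ∀ θ, Real.cosh (dist (E r θ) y) =
      Real.cosh D * Real.cosh r - Real.sinh D * Real.sinh r * Real.cos ‖θ - Θ y‖ := by
    intro y hy hyD r hr θ
    have := hsee y hy hyD r ⟨hr.1, hr.2.trans_le (hρ1 y hy hyD)⟩ θ
    rwa [hyD] at this
  have hact : ∀ y ∈ Y, ∀ r ∈ Ico 0 ρ, ∀ θ, dist (E r θ) y = Metric.infDist (E r θ) Y →
      dist z y = D := fun y hy r hr θ h => hρ2 y hy _ (hE.mem_ball hr θ) h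
  -- In the cell of `y` the height is `c * cosh (dist · y)`, and the law of cosines puts it in the
  -- form required by `deform_sector`.
  have haE : ∀ y ∈ Y, ∀ r ∈ Ico 0 ρ, ∀ θ, dist (E r θ) y = Metric.infDist (E r θ) Y →
      a (E r θ) = A * Real.cosh r - B * Real.cos ‖θ - Θ y‖ * Real.sinh r := by
    intro y hy r hr θ h
    rw [ha, siteHeight, ← h, hcosh y hy (hact y hy r hr θ h) r hr θ, hA, hB]
    ring
  -- Among the nearest sites of `z`, a nearby point is closest to the one whose direction makes the
  -- smallest angle with its own. Near `z` the cells are thus sectors around the directions `Θ y`.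
  have hangle : ∀ y ∈ Y, ∀ r ∈ Ioo 0 ρ, ∀ θ, dist (E r θ) y = Metric.infDist (E r θ) Y →
      ∀ y' ∈ Y, dist z y' = D → ‖θ - Θ y‖ ≤ ‖θ - Θ y'‖ := by
    intro y hy r hr θ h y' hy' hy'D
    have hr' : r ∈ Ico 0 ρ := Ioo_subset_Ico_self hr
    have h1 : dist (E r θ) y ≤ dist (E r θ) y' := h.le.trans (Metric.infDist_le_dist_of_mem hy')
    rw [← cosh_le_iff_of_nonneg dist_nonneg dist_nonneg, hcosh y hy (hact y hy r hr' θ h) r hr' θ,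
      hcosh y' hy' hy'D r hr' θ] at h1
    have h2 : 0 < Real.sinh D * Real.sinh r := mul_pos hsD (Real.sinh_pos_iff.2 hr.1)
    have h3 : Real.cos ‖θ - Θ y'‖ ≤ Real.cos ‖θ - Θ y‖ := by
      refine le_of_mul_le_mul_left ?_ h2
      linarith
    exact (Real.strictAntiOn_cos.le_iff_ge ⟨norm_nonneg _, norm_two_pi_le _⟩
      ⟨norm_nonneg _, norm_two_pi_le _⟩).1 h3
  set L : Set ℝ := {t | (t : AddCircle (2 * Real.pi)) ∈ Θ '' {y ∈ Y | dist z y = D}} with hL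
  have hmemL : ∀ y ∈ Y, dist z y = D → ∀ t : ℝ, (t : AddCircle (2 * Real.pi)) = Θ y → t ∈ L :=
    fun y hy hyD t ht => ⟨y, ⟨hy, hyD⟩, ht.symm⟩
  have hLper : ∀ x, x + 2 * Real.pi ∈ L ↔ x ∈ L := fun x => by
    simp only [hL, mem_ofPred_eq, AddCircle.coe_add_period]
  have hLne : L.Nonempty := by
    obtain ⟨y, hy, hyD⟩ := hnear z
    obtain ⟨t, ht⟩ := QuotientAddGroup.mk_surjective (Θ y)
    exact ⟨t, hmemL y hy hyD t ht⟩
  have hLfin : ∀ a b, b - a ≤ 2 * Real.pi → (L ∩ Ioo a b).Finite := fun a b hab =>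
    finite_lift_inter_Ioo ((hY.subset (sep_subset _ _)).image Θ) hab
  obtain ⟨κ', hκ0, hκ2, g, hg, hsector, hstrict⟩ := exists_squeeze_circle hk1 hLper hLne hLfin
  have hrad : ∀ y ∈ Y, ∀ r ∈ Ico 0 ρ, ∀ θ, dist (E r θ) y = Metric.infDist (E r θ) Y →
      Real.cosh (deform a z (E r θ)) =
        (Real.cosh r - A * (A * Real.cosh r - B * Real.cos ‖θ - Θ y‖ * Real.sinh r)) /
        (√(1 - A ^ 2) *
          √(1 - (A * Real.cosh r - B * Real.cos ‖θ - Θ y‖ * Real.sinh r) ^ 2)) := by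
    intro y hy r hr θ h
    rw [cosh_deform hc, dist_comm, hE.dist_apex hr, haE y hy r hr θ h, haz]
  have hlt : ∀ y ∈ Y, ∀ r ∈ Ico 0 ρ, ∀ θ, dist (E r θ) y = Metric.infDist (E r θ) Y →
      (A * Real.cosh r - B * Real.cos ‖θ - Θ y‖ * Real.sinh r) ^ 2 < 1 := by
    intro y hy r hr θ h
    rw [← haE y hy r hr θ h]; exact hc _
  have hdself := deform_self hc z
  refine ⟨κ', hκ2, hE.exists_cellChart (continuous_deform hc (continuous_siteHeight Y c) z)
    (dist_le_deform hc) hdself hκ0 hg ?_ ?_, ?_⟩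
  · intro r hr r' hr' θ he
    have hpos : ∀ r ∈ Ico 0 ρ, r ≤ deform a z (E r θ) := fun r hr => by
      have := dist_le_deform hc z (E r θ)
      rwa [dist_comm, hE.dist_apex hr] at this
    have hzero : deform a z (E 0 θ) = 0 := by rw [hE.2.2.1, hdself]
    rcases hr.1.eq_or_lt with h0 | h0
    · subst h0
      have := hpos r' hr'
      rw [← he, hzero] at this
      exact le_antisymm hr'.1 this
    rcases hr'.1.eq_or_lt with h0' | h0'
    · subst h0'
      have := hpos r hr
      rw [he, hzero] at this
      exact le_antisymm this hr.1
    obtain ⟨y, hy, hry⟩ := hnear (E r θ)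
    obtain ⟨y', hy', hry'⟩ := hnear (E r' θ)
    -- Two points of one ray may be assigned different nearest sites, but these make the same angle
    -- with the ray, so one height formula holds for both.
    have hang : ‖θ - Θ y'‖ = ‖θ - Θ y‖ := le_antisymm
      (hangle y' hy' r' ⟨h0', hr'.2⟩ θ hry' y hy (hact y hy r hr θ hry))
      (hangle y hy r ⟨h0, hr.2⟩ θ hry y' hy' (hact y' hy' r' hr' θ hry'))
    have h1 := congrArg Real.cosh he
    have h3 := hlt y' hy' r' hr' θ hry'
    rw [hang] at h3
    rw [hrad y hy r hr θ hry, hrad y' hy' r' hr' θ hry', hang, mul_comm √(1 - A ^ 2),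
      mul_comm √(1 - A ^ 2), ← div_div, ← div_div] at h1
    have hn : √(1 - A ^ 2) ≠ 0 := (Real.sqrt_pos.2 (by linarith)).ne'
    exact deform_ray_injective hA1 hr.1 hr'.1 (hlt y hy r hr θ hry) h3 ((div_left_inj' hn).1 h1)
  · rintro ⟨y, hy⟩ r hr r' hr' θ θ' hry hry'
    have hry : dist (E r θ) y = Metric.infDist (E r θ) Y := hry
    have hry' : dist (E r' θ') y = Metric.infDist (E r' θ') Y := hry'
    rcases hr.1.eq_or_lt with h0 | h0
    · subst h0
      rw [hE.2.2.1, hdself, coneCosh_zero_left]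
    rcases hr'.1.eq_or_lt with h0' | h0'
    · subst h0'
      rw [hE.2.2.1, hdself, coneCosh_zero_right, deform_comm]
    have hyD := hact y hy r hr θ hry
    obtain ⟨t, ht⟩ := QuotientAddGroup.mk_surjective (Θ y)
    have ht : (t : AddCircle (2 * Real.pi)) = Θ y := ht
    have htL := hmemL y hy hyD t ht
    have hsec : ∀ r ∈ Ioo 0 ρ, ∀ θ, dist (E r θ) y = Metric.infDist (E r θ) Y → ∃ u : ℝ,
        θ = ((t + u : ℝ) : AddCircle (2 * Real.pi)) ∧ Real.cos ‖θ - Θ y‖ = Real.cos u ∧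
        ∀ l ∈ L, |u| ≤ |t + u - l| := by
      intro r hr θ hry
      obtain ⟨u, hu, -, -, hu'⟩ := exists_lift_norm (by linarith : 0 < 2 * Real.pi) (θ - Θ y)
      have hθ : θ = ((t + u : ℝ) : AddCircle (2 * Real.pi)) := by
        rw [AddCircle.coe_add, hu, ht]; abel
      refine ⟨u, hθ, by rw [hu', Real.cos_abs], ?_⟩
      rintro l ⟨y', ⟨hy', hy'D⟩, hl⟩
      have h1 := hangle y hy r hr θ hry y' hy' hy'D
      rw [hu', hl, hθ, ← AddCircle.coe_sub] at h1
      refine h1.trans ?_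
      exact QuotientAddGroup.norm_mk_le_norm
    obtain ⟨u, hu1, hu2, hu3⟩ := hsec r ⟨h0, hr.2⟩ θ hry
    obtain ⟨u', hu1', hu2', hu3'⟩ := hsec r' ⟨h0', hr'.2⟩ θ' hry'
    have h1 := hsector t htL u u' hu3 hu3'
    rw [← hu1, ← hu1'] at h1
    have h2 := hE.cosh_dist hr hr' θ θ'
    rw [coneCosh, min_eq_left (norm_two_pi_le _), hu1, hu1', ← AddCircle.coe_sub,
      cos_norm_two_pi, add_sub_add_left_eq_sub, ← hu1, ← hu1'] at h2
    have i1 := hrad y hy r hr θ hry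
    have i1' := hrad y hy r' hr' θ' hry'
    have i2 := hlt y hy r hr θ hry
    have i2' := hlt y hy r' hr' θ' hry'
    rw [hu2] at i1 i2
    rw [hu2'] at i1' i2'
    rw [cosh_deform hc, h2, haE y hy r hr θ hry, haE y hy r' hr' θ' hry', hu2, hu2', coneCosh, h1]
    exact deform_sector hA1 hB2 (by linarith) hk2 hr.1 hr'.1 (deform_nonneg hc _ _)
      (deform_nonneg hc _ _) i2 i2' i1 i1'
  · rintro ⟨⟨y, hy⟩, hzy, hmax⟩
    have hyD : dist z y = D := hzy
    obtain ⟨t, ht⟩ := QuotientAddGroup.mk_surjective (Θ y)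
    have ht : (t : AddCircle (2 * Real.pi)) = Θ y := ht
    have htL := hmemL y hy hyD t ht
    -- A direction of the sector at an angle of at least `π / 2` from the site would lead to points
    -- of the same cell farther from `y` than `z` is.
    refine hstrict ⟨t, htL, fun u hu => ?_⟩
    by_contra! hge
    have hule : |u| ≤ Real.pi := by
      have h1 := hu (t + 2 * Real.pi) ((hLper t).2 htL)
      have h2 := hu (t - 2 * Real.pi) ((hLper _).1 (by simpa using htL))
      rcases abs_cases u with ⟨h3, h4⟩ | ⟨h3, h4⟩
      · rw [h3] at h1 ⊢
        by_contra! hlt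
        exact absurd h1 (not_le.2 (abs_lt.2 ⟨by linarith, by linarith⟩))
      · rw [h3] at h2 ⊢
        by_contra! hlt
        exact absurd h2 (not_le.2 (abs_lt.2 ⟨by linarith, by linarith⟩))
    have hr : ρ / 2 ∈ Ico 0 ρ := ⟨by linarith, by linarith⟩
    set θ : AddCircle (2 * Real.pi) := ((t + u : ℝ) : AddCircle (2 * Real.pi)) with hθ
    have hcosu : Real.cos ‖θ - Θ y‖ = Real.cos u := by
      rw [← ht, hθ, ← AddCircle.coe_sub, cos_norm_two_pi, add_sub_cancel_left]
    have hsr : 0 < Real.sinh D * Real.sinh (ρ / 2) :=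
      mul_pos hsD (Real.sinh_pos_iff.2 (by linarith))
    have hx : dist (E (ρ / 2) θ) y = Metric.infDist (E (ρ / 2) θ) Y := by
      refine le_antisymm ?_ (Metric.infDist_le_dist_of_mem hy)
      obtain ⟨y', hy', hxy'⟩ := hnear (E (ρ / 2) θ)
      have hy'D := hact y' hy' _ hr θ hxy'
      rw [← hxy', ← cosh_le_iff_of_nonneg dist_nonneg dist_nonneg, hcosh y hy hyD _ hr,
        hcosh y' hy' hy'D _ hr, hcosu]
      obtain ⟨w, hw, -, hwπ, hw'⟩ := exists_lift_norm (by linarith : 0 < 2 * Real.pi) (θ - Θ y')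
      have hl : t + u - w ∈ L := hmemL y' hy' hy'D _ (by
        rw [AddCircle.coe_sub, hw, ← hθ]; abel)
      have h1 := hu _ hl
      rw [sub_sub_cancel, ← hw'] at h1
      have h2 : Real.cos ‖θ - Θ y'‖ ≤ Real.cos u := by
        rw [← Real.cos_abs u]
        exact Real.cos_le_cos_of_nonneg_of_le_pi (abs_nonneg _) (norm_two_pi_le _) h1
      have := mul_le_mul_of_nonneg_left h2 hsr.le
      linarith
    have h1 : dist (E (ρ / 2) θ) y ≤ dist z y := hmax _ hx
    rw [hyD, ← cosh_le_iff_of_nonneg dist_nonneg hD0.le, hcosh y hy hyD _ hr, hcosu] at h1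
    have h2 : Real.cos u ≤ 0 := by
      rw [← Real.cos_abs u]
      exact Real.cos_nonpos_of_pi_div_two_le_of_le hge (by linarith)
    have h3 : 1 < Real.cosh (ρ / 2) := Real.one_lt_cosh.2 (by linarith)
    have h4 := mul_nonpos_of_nonneg_of_nonpos hsr.le h2
    have h5 := mul_lt_mul_of_pos_left h3 (Real.cosh_pos D)
    linarith

end NonSite

/-! ### Density of balanced metrics -/

section Density

open Filter Topology

/-- Convex cone-metrics can be approximated by intrinsic metrics with cone-points that form a dense
net. -/
lemma exists_perturbation {X : Type*} [mX : MetricSpace X] [CompactSpace X] [Nonempty X]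
    (hI : IsIntrinsic X) (h : ∀ p : X, ∃ κ ≤ 2 * Real.pi, HasConeAngle p κ) {K τ : ℝ}
    (hK : 1 < K) (hτ : 0 < τ) : ∃ M : MetricSpace X,
      M.toPseudoMetricSpace.toUniformSpace.toTopologicalSpace =
        mX.toPseudoMetricSpace.toUniformSpace.toTopologicalSpace ∧
      (∀ x y, mX.dist x y ≤ M.dist x y) ∧ (∀ x y, M.dist x y ≤ K * mX.dist x y) ∧
      @IsIntrinsic X M ∧ ∃ κ : X → ℝ, (∀ z, κ z ≤ 2 * Real.pi) ∧
        (∀ z, @HasConeAngle X M z (κ z)) ∧ ∀ x, ∃ z, mX.dist x z ≤ 2 * τ ∧ κ z < 2 * Real.pi := by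
  obtain ⟨Y, hY, -, hne, hdense, hsee⟩ := exists_sites h hτ
  -- The constants `q = c² cosh² τ` and `b = c² sinh² τ` of `deform_le` tend to 0 with `c`, so the
  -- required factor tends to 1.
  obtain ⟨c, hcq, hcK, hc0⟩ : ∃ c : ℝ, c ^ 2 * Real.cosh τ ^ 2 < 1 ∧
      (1 + c ^ 2 * Real.sinh τ ^ 2 / (1 - c ^ 2 * Real.cosh τ ^ 2)) /
        (1 - c ^ 2 * Real.cosh τ ^ 2) < K ^ 2 ∧ 0 < c := by
    have h1 : ∀ᶠ c : ℝ in 𝓝[>] 0, c ^ 2 * Real.cosh τ ^ 2 < 1 := by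
      refine eventually_nhdsWithin_of_eventually_nhds ?_
      have : Continuous fun c : ℝ => c ^ 2 * Real.cosh τ ^ 2 := by fun_prop
      exact this.continuousAt.eventually (gt_mem_nhds (by simp))
    have h2 : ∀ᶠ c : ℝ in 𝓝[>] 0, (1 + c ^ 2 * Real.sinh τ ^ 2 / (1 - c ^ 2 * Real.cosh τ ^ 2)) /
        (1 - c ^ 2 * Real.cosh τ ^ 2) < K ^ 2 := by
      refine eventually_nhdsWithin_of_eventually_nhds ?_
      have : ContinuousAt (fun c : ℝ =>
          (1 + c ^ 2 * Real.sinh τ ^ 2 / (1 - c ^ 2 * Real.cosh τ ^ 2)) /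
          (1 - c ^ 2 * Real.cosh τ ^ 2)) 0 := by
        refine ContinuousAt.div (continuousAt_const.add (ContinuousAt.div ?_ ?_ ?_)) ?_ ?_ <;>
          first
          | fun_prop
          | simp
      refine this.eventually (gt_mem_nhds ?_)
      simp only [ne_eq, OfNat.ofNat_ne_zero, not_false_eq_true, zero_pow, zero_mul, sub_zero,
        div_one, add_zero]
      nlinarith
    obtain ⟨c, ⟨h1, h2⟩, h3⟩ := ((h1.and h2).and self_mem_nhdsWithin).exists
    exact ⟨c, h1, h2, h3⟩
  have hcosh : ∀ x, Real.cosh (Metric.infDist x Y) ≤ Real.cosh τ := fun x =>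
    (cosh_le_iff_of_nonneg Metric.infDist_nonneg hτ.le).2 (hdense x)
  have hq : ∀ x, siteHeight Y c x ^ 2 ≤ c ^ 2 * Real.cosh τ ^ 2 := fun x => by
    rw [siteHeight, mul_pow]
    have := pow_le_pow_left₀ (Real.cosh_pos _).le (hcosh x) 2
    gcongr
  have hc : ∀ x, siteHeight Y c x ^ 2 < 1 := fun x => (hq x).trans_lt hcq
  have hb : ∀ x x', (siteHeight Y c x - siteHeight Y c x') ^ 2 ≤
      2 * (c ^ 2 * Real.sinh τ ^ 2) * (Real.cosh (dist x x') - 1) := by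
    intro x x'
    have h1 := sq_cosh_sub_cosh_le Metric.infDist_nonneg Metric.infDist_nonneg (hdense x)
      (hdense x') (d := dist x x') (by
        have := (Metric.lipschitz_infDist_pt Y).dist_le_mul x x'
        rwa [NNReal.coe_one, one_mul, Real.dist_eq] at this)
    have h2 := mul_le_mul_of_nonneg_left h1 (sq_nonneg c)
    rw [siteHeight, siteHeight, ← mul_sub, mul_pow]
    linarith
  have hnear : ∀ x : X, ∃ y : Y, x ∈ siteCell Y y := fun x => by
    obtain ⟨y, hy, h⟩ := hY.isCompact.exists_infDist_eq_dist hne x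
    exact ⟨⟨y, hy⟩, h.symm⟩
  have hclosed : ∀ y : Y, IsClosed (siteCell Y y) := fun y =>
    isClosed_eq (by fun_prop) (Metric.continuous_infDist_pt Y)
  have hchart : ∀ z, ∃ κ ≤ 2 * Real.pi,
      (∃ ρ e, IsCellChart (siteCell Y) (deform (siteHeight Y c)) z κ ρ e) ∧
      (z ∉ Y → (∃ y : Y, z ∈ siteCell Y y ∧ ∀ x ∈ siteCell Y y, dist x y ≤ dist z y) →
        κ < 2 * Real.pi) := by
    intro z
    by_cases hz : z ∈ Y
    · obtain ⟨κ, hκ, hang⟩ := h z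
      exact ⟨κ, hκ, exists_cellChart_site hY hc hz hang, fun h => absurd hz h⟩
    · obtain ⟨ρ, E, hE, hE'⟩ := hsee z hz
      obtain ⟨κ, hκ, h1, h2⟩ := exists_cellChart_of_notMem hY hne hc0 hc hz hE hE'
      exact ⟨κ, hκ, h1, fun _ => h2⟩
  choose κ hκ hcell hfar using hchart
  have := hY.to_subtype
  have hnet : ∀ x, ∃ z, mX.dist x z ≤ 2 * τ ∧ κ z < 2 * Real.pi := by
    intro x
    obtain ⟨y, hxy⟩ := hnear x
    -- A farthest point `z` of the cell of `y` becomes a cone-point. It cannot be a site: the only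
    -- site in the cell is `y`, and points close to `y` belong to the cell and are farther from `y`.
    obtain ⟨z, hz, hmax⟩ := (hclosed y).isCompact.exists_isMaxOn (f := fun x => dist x (y : X))
      ⟨x, hxy⟩ (by fun_prop)
    have hmax : ∀ x ∈ siteCell Y y, dist x (y : X) ≤ dist z y := fun x hx => hmax hx
    have hzY : z ∉ Y := by
      intro hzY
      obtain ⟨κ', -, hang⟩ := h y
      obtain ⟨ρ, E, hE⟩ := hasConeAngle_iff.1 hang
      obtain ⟨r, hr1, hr2⟩ := ((eventually_nearest hY (y : X)).and (Ioo_mem_nhdsGT hE.2.1)).exists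
      have hr3 : r / 2 ∈ Ico 0 ρ := ⟨by linarith [hr2.1], by linarith [hr2.1, hr2.2]⟩
      have h6 := hE.dist_apex hr3 0
      obtain ⟨y', hy'⟩ := hnear (E (r / 2) 0)
      have h7 := hr1 y' y'.2 (E (r / 2) 0) (by
        rw [Metric.mem_ball, h6]; linarith [hr2.1]) hy'
      rw [Metric.infDist_zero_of_mem y.2, dist_eq_zero] at h7
      have h8 : y' = y := Subtype.ext h7.symm
      rw [h8] at hy'
      have h9 := hmax _ hy'
      have h10 : dist z (y : X) = Metric.infDist z Y := hz
      rw [h10, Metric.infDist_zero_of_mem hzY, h6] at h9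
      linarith [hr2.1]
    refine ⟨z, ?_, hfar z hzY ⟨y, hz, hmax⟩⟩
    have e1 : dist x (y : X) = Metric.infDist x Y := hxy
    have e2 : dist z (y : X) = Metric.infDist z Y := hz
    have e3 := hdense x
    have e4 := hdense z
    have e5 := dist_triangle_right x z (y : X)
    change dist x z ≤ _
    linarith
  obtain ⟨M, h1, h2, h3, h4, h5⟩ := exists_metric_of_cells hI hclosed hnear hK.le
    (deform_comm (siteHeight Y c)) (dist_le_deform hc) (deform_le hK.le hq hcq hb hcK.le)
    (continuous_deform hc (continuous_siteHeight Y c)) hcell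
  refine ⟨M, h1, h2, h3, h4, κ, hκ, h5, hnet⟩

/-- By `IsConeChart.angle_le` no cone angle at `z` exceeds `κ z`. Hence all angles are at most `2π`,
and a point with `κ z < 2π` is a genuine cone-point. -/
lemma IsIntrinsic.properties_of_net {Y : Type*} [MetricSpace Y] [CompactSpace Y]
    (hI : IsIntrinsic Y) {κ : Y → ℝ} (hκ : ∀ z, κ z ≤ 2 * Real.pi)
    (hang : ∀ z, HasConeAngle z (κ z)) {b : ℝ}
    (hnet : ∀ x, ∃ z, dist x z ≤ b ∧ κ z < 2 * Real.pi) :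
    IsHyperbolicConeMetric Y ∧ IsConvexConeMetric Y ∧ coneSparsity Y ≤ ENNReal.ofReal b := by
  have huniq : ∀ z κ', HasConeAngle z κ' → κ' ≤ κ z := by
    intro z κ' h
    obtain ⟨_, _, h1⟩ := hasConeAngle_iff.1 (hang z)
    obtain ⟨_, _, h2⟩ := hasConeAngle_iff.1 h
    exact h1.angle_le h2
  refine ⟨⟨hI, finite_conePoints fun p => ⟨κ p, hκ p, hang p⟩, fun p => ⟨κ p, hang p⟩⟩,
    fun p κ' h => (huniq p κ' h).trans (hκ p), iSup_le fun x => ?_⟩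
  obtain ⟨z, hz, hz2⟩ := hnet x
  have hzV : z ∈ conePoints Y := fun h => absurd (huniq z _ h) (not_le.2 hz2)
  refine (Metric.infEDist_le_edist_of_mem hzV).trans ?_
  rw [edist_dist]
  exact ENNReal.ofReal_le_ofReal hz

/-- The target for the sparsity is `b = δ (sys) / 2`. With `τ = b / 8` and `K < 2` the perturbed
metric has cone-points within `K * (2 * τ) ≤ b` of every point. With `K` close to 1, `δ` at its
systole stays above `b`, and the identity map has distortion at most `log K`. -/
lemma ConvexConeMetric.dense_balanced {S : Type*} [t : TopologicalSpace S] [CompactSpace S]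
    [ConnectedSpace S] (hS : ¬ SimplyConnectedSpace S) {δ : ℝ → ℝ}
    (hδ : ContinuousOn δ (Ioi 0)) (hδ_pos : ∀ t, 0 < t → 0 < δ t) :
    Dense (ConvexConeMetric.balanced S δ) := by
  refine EMetric.dense_iff.2 fun d ε hε => ?_
  obtain ⟨m, ht, h1, h2⟩ := d
  subst ht
  have hs0 : 0 < (systole S).toReal :=
    ENNReal.toReal_pos (systole_pos h1.2.2).ne' (systole_lt_top hS h1.2.2).ne
  set b := δ (systole S).toReal / 2 with hb
  have hb0 : 0 < b := half_pos (hδ_pos _ hs0)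
  have hb1 : b < δ (systole S).toReal := by linarith
  have hK1 : ∀ᶠ K in 𝓝[>] (1 : ℝ), ENNReal.ofReal (Real.log K) < ε := by
    refine eventually_nhdsWithin_of_eventually_nhds ?_
    have : ContinuousAt (fun K : ℝ => ENNReal.ofReal (Real.log K)) 1 :=
      ENNReal.continuous_ofReal.continuousAt.comp (Real.continuousAt_log one_ne_zero)
    exact this.eventually (gt_mem_nhds (by simpa using hε))
  obtain ⟨K, ⟨hK1, hK2⟩, hK3⟩ := ((hK1.and (eventually_lt_systole hS h1.2.2 hδ hb1)).and
    (Ioo_mem_nhdsGT (one_lt_two))).exists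
  obtain ⟨F, hF⟩ : ∃ F : S ≃ₜ S, (F : S → S) = id := ⟨Homeomorph.refl S, rfl⟩
  obtain ⟨M, m1, m2, m3, m4, κ, hκ, hang, hnet⟩ := exists_perturbation h1.1
    (fun p => by
      obtain ⟨κ, hκ⟩ := h1.2.2 p
      exact ⟨κ, h2 p κ hκ, hκ⟩) hK3.1 (by positivity : 0 < b / 8)
  have hK0 : 0 < K := by linarith [hK3.1]
  have m5 : ∀ x y, m.dist x y ≤ K * M.dist x y := fun x y => by
    have h3 : 0 ≤ M.dist x y := @dist_nonneg S M.toPseudoMetricSpace x y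
    have h4 := le_mul_of_one_le_left h3 hK3.1.le
    exact (m2 x y).trans h4
  have hcomp : @CompactSpace S M.toPseudoMetricSpace.toUniformSpace.toTopologicalSpace := by
    rw [m1]; infer_instance
  obtain ⟨p1, p2, p3⟩ := @IsIntrinsic.properties_of_net S M hcomp m4 κ hκ hang b (fun x => by
    obtain ⟨z, hz, hz2⟩ := hnet x
    refine ⟨z, ?_, hz2⟩
    have h3 := m3 x z
    have h4 := mul_le_mul_of_nonneg_left hz hK0.le
    change M.dist x z ≤ b
    nlinarith [hK3.2])
  obtain ⟨f, hf⟩ := exists_homeomorph_coe_eq m1 F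
  have hsys := @hK2 S M f (by rw [hf, hF]; exact m3) (by rw [hf, hF]; exact m5)
  refine ⟨@ConvexConeMetric.mk S m.toPseudoMetricSpace.toUniformSpace.toTopologicalSpace M m1 p1 p2,
    ?_, ?_⟩
  · rw [Metric.mem_eball, edist_comm]
    refine lt_of_le_of_lt (iInf_le _ F) (lt_of_le_of_lt ?_ hK1)
    rw [hF]
    exact @distortion_le_of_le_mul S S m M id Function.injective_id K m3 m5
  · exact p3.trans_lt ((ENNReal.ofReal_lt_ofReal_iff_of_nonneg hb0.le).2 hsys)

end Density

end ConeSurface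

theorem mainTheorem7 {S : Type*} [TopologicalSpace S] [T2Space S] [CompactSpace S]
    [ConnectedSpace S] [ChartedSpace (EuclideanSpace ℝ (Fin 2)) S]
    (hS : ¬ SimplyConnectedSpace S)
    (δ : ℝ → ℝ) (hδ : ContinuousOn δ (Set.Ioi 0)) (hδ_pos : ∀ t, 0 < t → 0 < δ t) :
    IsOpen (ConeSurface.ConvexConeMetric.balanced S δ) ∧
      Dense (ConeSurface.ConvexConeMetric.balanced S δ) :=
  ⟨ConeSurface.ConvexConeMetric.isOpen_balanced hS hδ,
    ConeSurface.ConvexConeMetric.dense_balanced hS hδ hδ_pos⟩
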